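/- Let $R=\mathbb Z[1/2]$ and let $G=\mu_3\rtimes\mathbb Z/2\mathbb Z$ over $R$, where the generator $\sigma$ of $\mathbb Z/2\mathbb Z$ acts on $\mu_3$ by inversion. Stacks over $R$ are viewed as categories fibred in groupoids over affine $R$-schemes $T$ (a stack is determined by its restriction to affine schemes). A $G$-cover of $T$ is a finite locally free commutative associative unital $\mathcal O_T$-algebra with a compatible coaction of $\mathcal O_T[G]$ which, fppf locally on $T$, is isomorphic as a $G$-comodule to the regular representation $\mathcal O_T[G]$; $G\text{-Cov}$ is the stack of $G$-covers. Let $\mathcal Y$ be the stack of sequences $\chi=(\mathcal L,\mathcal F,\alpha,\beta,\langle-,-\rangle)$ with $\mathcal L$ invertible, $\mathcal F$ locally free of rank $2$, and maps $\alpha\colon\mathcal L\otimes\mathcal F\to\mathcal F$, $\beta\colon\mathrm{Sym}^2\mathcal F\to\mathcal F$, $\langle-,-\rangle\colon\det\mathcal F\to\mathcal L$. Put $m(l,l')=\tfrac12\operatorname{tr}\bigl(\alpha(l\otimes\alpha(l'\otimes-))\bigr)$ and $(u,v)=\operatorname{tr}\bigl(w\mapsto\alpha(\langle w,u\rangle\otimes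 v)\bigr)$. To $\chi$ one associates $\mathcal A_\chi=\mathcal O_T\oplus\mathcal L\oplus\mathcal F_1\oplus\mathcal F_2$ with $\mathcal F_1=\mathcal F_2=\mathcal F$, where $\mu_3$ acts with weights $0,0,1,2$ and $\sigma$ acts by $1$ on $\mathcal O_T$, by $-1$ on $\mathcal L$ and exchanges $\mathcal F_1$ and $\mathcal F_2$ through $\mathrm{id}_{\mathcal F}$; its multiplication (not necessarily commutative or associative) has unit $1\in\mathcal O_T$ and is given by $m$ on $\mathcal L\otimes\mathcal L$, by $\alpha$ between $\mathcal L$ and $\mathcal F_1$ and $-\alpha$ between $\mathcal L$ and $\mathcal F_2$ (on both sides), by $\beta\colon\mathcal F_1\otimes\mathcal F_1\to\mathcal F_2$ and $\beta\colon\mathcal F_2\otimes\mathcal F_2\to\mathcal F_1$, by $(-,-)+\langle-,-\rangle\colon\mathcal F_1\otimes\mathcal F_2\to\mathcal O_T\oplus\mathcal L$ and by $(-,-)-\langle-,-\rangle\colon\mathcal F_2\otimes\mathcal F_1\to\mathcal O_T\oplus\mathcal L$. One writes $\chi\in G\text{-Cov}$ for a $G$-cover isomorphic to $\mathcal A_\chi$.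 Let $\mathcal Z_2\subseteq G\text{-Cov}$ be the full substack of the $\chi$ with $\beta=\langle-,-\rangle=0$ and $\alpha=(\operatorname{tr}\alpha/2)\otimes\mathrm{id}_{\mathcal F}$, and let $\{0\}\subseteq\mathcal Z_2$ be the closed substack of the $\chi$ with $\alpha=\beta=\langle-,-\rangle=0$; the complement $\mathcal Z_2-\{0\}$ consists of the objects of $\mathcal Z_2$ no pullback of which to a nonempty scheme lies in $\{0\}$. Let $\mathcal Z_2'$ be the stack of triples $(\mathcal L,\mathcal F,\mu)$ with $\mathcal L$ invertible, $\mathcal F$ locally free of rank $2$ and $\mu\colon\mathcal L\to\mathcal O$ a map. **Theorem.** 1. For every triple, $\mathcal A_\chi$ with $\chi=(\mathcal L,\mathcal F,\mu\otimes\mathrm{id}_{\mathcal F},0,0)$ is a $G$-cover in $\mathcal Z_2$, and $(\mathcal L,\mathcal F,\mu)\mapsto(\mathcal L,\mathcal F,\mu\otimes\mathrm{id}_{\mathcal F},0,0)$ defines an equivalence of stacks $\mathcal Z_2'\to\mathcal Z_2$. 2. $\mathcal Z_2'\simeq[\mathbb A^1_R/\mathbb G_m]\times \mathrm B\mathrm{GL}_2$,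 and hence $\mathcal Z_2\simeq[\mathbb A^1_R/\mathbb G_m]\times \mathrm B\mathrm{GL}_2$, where $\mathbb G_m$ acts on $\mathbb A^1_R$ by scaling. 3. $\mathcal Z_2-\{0\}$ is an open substack of $G\text{-Cov}$, and $\mathcal Z_2-\{0\}\simeq \mathrm B\mathrm{GL}_2$. -/

import Mathlib

/-!
Stacks over `ℤ[1/2]` are handled through their restriction to affine schemes, which determines
them. An affine scheme over `ℤ[1/2]` is written as a commutative `ℤ[1/2]`-algebra, so a stack is
a category with a functor to the category of such algebras: an arrow `X ⟶ Y` over `φ : A ⟶ B`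
exhibits the object `Y` over `Spec B` as the pullback of the object `X` along
`Spec B → Spec A`. A locally free sheaf of finite rank on `Spec A` is a finite projective
`A`-module.
-/

universe u

open CategoryTheory TensorProduct

set_option linter.unusedSimpArgs false
set_option linter.unusedVariables false

noncomputable section
namespace GCovers

/-- The base ring `ℤ[1/2]`. -/
abbrev BaseRing : Type := Localization.Away (2 : ℤ)

/-- The element `1/2` of the base ring. -/
def half : BaseRing := IsLocalization.Away.invSelf (2 : ℤ)

/-- The category of commutative `ℤ[1/2]`-algebras, that is, the opposite of the category of affine
schemes over `ℤ[1/2]`. -/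
abbrev Alg := CommAlgCat.{u} BaseRing

/-- The ring homomorphism underlying a morphism of algebras. -/
def rh {A B : Alg.{u}} (φ : A ⟶ B) : A →+* B := φ.hom.toRingHom

section Pullback

variable {A B C : Type*} [CommRing A] [CommRing B] [CommRing C]

/-- A semilinear map `f : M → N` over `φ : A → B` is a pullback if it exhibits `N` as `B ⊗[A] M`. -/
def IsPullback (φ : A →+* B) {M N : Type*} [AddCommGroup M] [Module A M] [AddCommGroup N]
    [Module B N] (f : M →ₛₗ[φ] N) : Prop :=
  letI : Algebra A B := φ.toAlgebra
  letI : Module A N := Module.compHom N φ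
  haveI : IsScalarTower A B N := ⟨fun a b n => mul_smul (φ a) b n⟩
  IsBaseChange B
    ({ toFun := f, map_add' := map_add f, map_smul' := f.map_smulₛₗ } : M →ₗ[A] N)

variable {M M' N N' P : Type*} [AddCommGroup M] [Module A M] [AddCommGroup M'] [Module A M']
  [AddCommGroup N] [Module B N] [AddCommGroup N'] [Module B N'] [AddCommGroup P] [Module C P]

theorem isPullback_id (f : M →ₛₗ[RingHom.id A] M) (hf : ∀ m, f m = m) :
    IsPullback (RingHom.id A) f := by
  let _ : Algebra A A := (RingHom.id A).toAlgebra
  let _ : Module A M := Module.compHom M (RingHom.id A)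
  exact IsBaseChange.of_equiv (TensorProduct.lid A M) (fun x => by
    simpa using (hf x).symm)

theorem IsPullback.comp {φ : A →+* B} {ψ : B →+* C} {f : M →ₛₗ[φ] N} {g : N →ₛₗ[ψ] P}
    (hf : IsPullback φ f) (hg : IsPullback ψ g) {χ : A →+* C} (hχ : ∀ a, χ a = ψ (φ a))
    (h : M →ₛₗ[χ] P) (hh : ∀ m, h m = g (f m)) : IsPullback χ h := by
  obtain rfl : χ = ψ.comp φ := RingHom.ext hχ
  let _ : Algebra A B := φ.toAlgebra
  let _ : Algebra B C := ψ.toAlgebra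
  let _ : Algebra A C := (ψ.comp φ).toAlgebra
  let _ : Module A N := Module.compHom N φ
  let _ : Module B P := Module.compHom P ψ
  let _ : Module A P := Module.compHom P (ψ.comp φ)
  have _ : IsScalarTower A B C := IsScalarTower.of_algebraMap_eq fun _ => rfl
  have _ : IsScalarTower A B N := ⟨fun a b n => mul_smul (φ a) b n⟩
  have _ : IsScalarTower B C P := ⟨fun a b n => mul_smul (ψ a) b n⟩
  have _ : IsScalarTower A C P := ⟨fun a b n => mul_smul (ψ (φ a)) b n⟩
  have _ : IsScalarTower A B P := ⟨fun a b n => by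
    change ψ (φ a * b) • n = ψ (φ a) • ψ b • n
    rw [map_mul, mul_smul]⟩
  have := IsBaseChange.comp (S := B) (T := C) hf hg
  unfold IsPullback
  convert this using 1
  ext m
  exact hh m

theorem isPullback_ringHom (φ : A →+* B) (f : A →ₛₗ[φ] B) (hf : ∀ a, f a = φ a) :
    IsPullback φ f := by
  let _ : Algebra A B := φ.toAlgebra
  exact IsBaseChange.of_equiv (TensorProduct.AlgebraTensorModule.rid A B B) (fun x => by
    change φ x * 1 = f x
    rw [hf, mul_one])

theorem IsPullback.prod {φ : A →+* B} {f : M →ₛₗ[φ] N} {g : M' →ₛₗ[φ] N'}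
    (hf : IsPullback φ f) (hg : IsPullback φ g)
    (h : M × M' →ₛₗ[φ] N × N') (hh : ∀ m, h m = (f m.1, g m.2)) : IsPullback φ h := by
  let _ : Algebra A B := φ.toAlgebra
  let _ : Module A N := Module.compHom N φ
  let _ : Module A N' := Module.compHom N' φ
  have _ : IsScalarTower A B N := ⟨fun a b n => mul_smul (φ a) b n⟩
  have _ : IsScalarTower A B N' := ⟨fun a b n => mul_smul (φ a) b n⟩
  refine IsBaseChange.of_equiv ((TensorProduct.prodRight A B B M M').trans
    (LinearEquiv.prodCongr (IsBaseChange.equiv hf) (IsBaseChange.equiv hg))) (fun x => ?_)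
  have e₁ := IsBaseChange.equiv_tmul hf 1 x.1
  have e₂ := IsBaseChange.equiv_tmul hg 1 x.2
  rw [one_smul] at e₁ e₂
  exact (Prod.ext e₁ e₂).trans (hh x).symm

theorem IsPullback.ext {φ : A →+* B} {f : M →ₛₗ[φ] N} (hf : IsPullback φ f)
    {Q : Type*} [AddCommGroup Q] [Module B Q] {g h : N →ₗ[B] Q} (H : ∀ m, g (f m) = h (f m)) :
    g = h := by
  let _ : Algebra A B := φ.toAlgebra
  let _ : Module A N := Module.compHom N φ
  have _ : IsScalarTower A B N := ⟨fun a b n => mul_smul (φ a) b n⟩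
  exact IsBaseChange.algHom_ext hf g h H

theorem IsPullback.exists_dual {φ : A →+* B} {f : M →ₛₗ[φ] N} (hf : IsPullback φ f)
    (ξ : M →ₗ[A] A) : ∃ η : N →ₗ[B] B, ∀ m, η (f m) = φ (ξ m) := by
  let _ : Algebra A B := φ.toAlgebra
  let _ : Module A N := Module.compHom N φ
  have _ : IsScalarTower A B N := ⟨fun a b n => mul_smul (φ a) b n⟩
  exact ⟨IsBaseChange.lift hf ((Algebra.linearMap A B).comp ξ),
    fun m => IsBaseChange.lift_eq hf _ m⟩

end Pullback

section Trace

/-- The trace of an endomorphism of a finite projective module `M`, through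
`End M ≃ Mᵛ ⊗ M → A`. (Mathlib's `LinearMap.trace` is zero unless `M` has a finite basis.) -/
def trace {A : Type*} [CommRing A] {M : Type*} [AddCommGroup M] [Module A M] [Module.Finite A M]
    [Module.Projective A M] : (M →ₗ[A] M) →ₗ[A] A :=
  (contractLeft A M).comp (dualTensorHomEquiv A M M).symm.toLinearMap

variable {A B : Type*} [CommRing A] [CommRing B]
  {M N : Type*} [AddCommGroup M] [Module A M] [AddCommGroup N] [Module B N]
  [Module.Finite A M] [Module.Projective A M] [Module.Finite B N] [Module.Projective B N]

theorem trace_dualTensorHom (t : Module.Dual A M ⊗[A] M) :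
    trace (dualTensorHom A M M t) = contractLeft A M t := by
  simp only [trace, LinearMap.comp_apply]
  congr 1
  exact (dualTensorHomEquiv A M M).symm_apply_apply t

theorem trace_pullback {φ : A →+* B} {f : M →ₛₗ[φ] N} (hf : IsPullback φ f)
    (g : M →ₗ[A] M) (h : N →ₗ[B] N) (H : ∀ m, h (f m) = f (g m)) :
    trace h = φ (trace g) := by
  suffices K : ∀ t : Module.Dual A M ⊗[A] M, ∃ s : Module.Dual B N ⊗[B] N,
      (∀ m, dualTensorHom B N N s (f m) = f (dualTensorHom A M M t m)) ∧
      contractLeft B N s = φ (contractLeft A M t) by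
    obtain ⟨t, rfl⟩ := (dualTensorHomEquiv A M M).surjective g
    obtain ⟨s, hs, hs'⟩ := K t
    have e : h = dualTensorHom B N N s := hf.ext fun m => by rw [H, hs]; rfl
    rw [e, trace_dualTensorHom, hs', ← trace_dualTensorHom]; rfl
  intro t
  induction t with
  | zero => exact ⟨0, by simp, by simp⟩
  | tmul ξ m =>
    obtain ⟨η, hη⟩ := hf.exists_dual ξ
    exact ⟨η ⊗ₜ f m, fun m' => by simp [hη], by simp [hη]⟩
  | add x y hx hy =>
    obtain ⟨s, hs, hs'⟩ := hx
    obtain ⟨t, ht, ht'⟩ := hy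
    exact ⟨s + t, fun m => by simp [hs, ht], by simp [hs', ht']⟩

end Trace

section GroupScheme

/- The group scheme `G = μ₃ ⋊ ℤ/2`: a point with values in a ring `C` is a pair `(ζ, ε)` with
`ζ ^ 3 = 1` and `ε ^ 2 = ε`, where `ε = 0` on the neutral component and `ε = 1` where the point is
in the coset of the generator `σ`. As `σ` acts on `μ₃` by inversion, which on `μ₃` is squaring, the
product is `(ζ, ε) (ξ, δ) = (ζ ((1 - ε) ξ + ε ξ ^ 2), ε + δ - 2 ε δ)`. -/

/-- The first coordinate of the product `(ζ, ε) (ξ, δ)`. -/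
def mulX {C : Type*} [CommRing C] (ζ ε ξ : C) : C := ζ * ((1 - ε) * ξ + ε * ξ ^ 2)

/-- The second coordinate of the product `(ζ, ε) (ξ, δ)`. -/
def mulE {C : Type*} [CommRing C] (ε δ : C) : C := ε + δ - 2 * ε * δ

theorem mulX_pow {C : Type*} [CommRing C] {ζ ε ξ : C} (h₁ : ζ ^ 3 = 1) (h₂ : ε ^ 2 = ε)
    (h₃ : ξ ^ 3 = 1) : mulX ζ ε ξ ^ 3 = 1 := by
  unfold mulX; grind

theorem mulE_sq {C : Type*} [CommRing C] {ε δ : C} (h₁ : ε ^ 2 = ε) (h₂ : δ ^ 2 = δ) :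
    mulE ε δ ^ 2 = mulE ε δ := by
  unfold mulE; grind

theorem mulX_assoc {C : Type*} [CommRing C] {X1 X2 X3 E1 E2 : C} (h4 : E1 ^ 2 = E1)
    (h5 : E2 ^ 2 = E2) (h3 : X3 ^ 3 = 1) :
    mulX (mulX X1 E1 X2) (mulE E1 E2) X3 = mulX X1 E1 (mulX X2 E2 X3) := by
  unfold mulX mulE; grind

theorem mulE_assoc {C : Type*} [CommRing C] (E1 E2 E3 : C) :
    mulE (mulE E1 E2) E3 = mulE E1 (mulE E2 E3) := by
  unfold mulE; ring

variable (A : Type*) [CommRing A]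

/-- The coordinate ring `A[x, e] / (x ^ 3 - 1, e ^ 2 - e)` of the group scheme `G` over `A`; it is
a Hopf algebra below. -/
def GRing : Type _ :=
  MvPolynomial (Fin 2) A ⧸ (Ideal.span {MvPolynomial.X 0 ^ 3 - 1,
    MvPolynomial.X 1 ^ 2 - MvPolynomial.X 1} : Ideal (MvPolynomial (Fin 2) A))

instance : CommRing (GRing A) := inferInstanceAs (CommRing (_ ⧸ _))

instance : Algebra A (GRing A) :=
  inferInstanceAs (Algebra A (MvPolynomial (Fin 2) A ⧸ (Ideal.span {MvPolynomial.X 0 ^ 3 - 1,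
    MvPolynomial.X 1 ^ 2 - MvPolynomial.X 1} : Ideal (MvPolynomial (Fin 2) A))))

namespace GRing

def mk : MvPolynomial (Fin 2) A →ₐ[A] GRing A :=
  Ideal.Quotient.mkₐ A _

def x : GRing A := mk A (MvPolynomial.X 0)

def e : GRing A := mk A (MvPolynomial.X 1)

theorem x_pow : x A ^ 3 = 1 := by
  rw [← sub_eq_zero, x, ← map_one (mk A), ← map_pow, ← map_sub]
  exact Ideal.Quotient.eq_zero_iff_mem.2 (Ideal.subset_span (by simp))

theorem e_sq : e A ^ 2 = e A := by
  rw [← sub_eq_zero, e, ← map_pow, ← map_sub]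
  exact Ideal.Quotient.eq_zero_iff_mem.2 (Ideal.subset_span (by simp))

variable {A}

theorem mk_surjective : Function.Surjective (mk A) := Ideal.Quotient.mk_surjective

variable {C : Type*} [CommRing C]

def liftRingHom (φ : A →+* C) (ξ ε : C) (h₁ : ξ ^ 3 = 1) (h₂ : ε ^ 2 = ε) : GRing A →+* C :=
  Ideal.Quotient.lift _ (MvPolynomial.eval₂Hom φ ![ξ, ε]) (fun p hp => by
    have : Ideal.span {MvPolynomial.X 0 ^ 3 - 1, MvPolynomial.X 1 ^ 2 - MvPolynomial.X 1} ≤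
        RingHom.ker (MvPolynomial.eval₂Hom φ ![ξ, ε]) := by
      rw [Ideal.span_le]
      rintro _ (rfl | rfl) <;> simp [h₁, h₂]
    exact this hp)

theorem liftRingHom_mk (φ : A →+* C) (ξ ε : C) (h₁ : ξ ^ 3 = 1) (h₂ : ε ^ 2 = ε) (p) :
    liftRingHom φ ξ ε h₁ h₂ (mk A p) = MvPolynomial.eval₂Hom φ ![ξ, ε] p := rfl

theorem liftRingHom_x (φ : A →+* C) (ξ ε : C) (h₁ : ξ ^ 3 = 1) (h₂ : ε ^ 2 = ε) :
    liftRingHom φ ξ ε h₁ h₂ (x A) = ξ := by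
  simp [x, liftRingHom_mk]

theorem liftRingHom_e (φ : A →+* C) (ξ ε : C) (h₁ : ξ ^ 3 = 1) (h₂ : ε ^ 2 = ε) :
    liftRingHom φ ξ ε h₁ h₂ (e A) = ε := by
  simp [e, liftRingHom_mk]

theorem liftRingHom_algebraMap (φ : A →+* C) (ξ ε : C) (h₁ : ξ ^ 3 = 1) (h₂ : ε ^ 2 = ε) (a : A) :
    liftRingHom φ ξ ε h₁ h₂ (algebraMap A _ a) = φ a := by
  rw [← (mk A).commutes, liftRingHom_mk]
  simp

def lift [Algebra A C] (ξ ε : C) (h₁ : ξ ^ 3 = 1) (h₂ : ε ^ 2 = ε) : GRing A →ₐ[A] C where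
  __ := liftRingHom (algebraMap A C) ξ ε h₁ h₂
  commutes' a := liftRingHom_algebraMap _ _ _ _ _ a

@[simp] theorem lift_x [Algebra A C] (ξ ε : C) (h₁ : ξ ^ 3 = 1) (h₂ : ε ^ 2 = ε) :
    lift ξ ε h₁ h₂ (x A) = ξ := liftRingHom_x _ ξ ε h₁ h₂

@[simp] theorem lift_e [Algebra A C] (ξ ε : C) (h₁ : ξ ^ 3 = 1) (h₂ : ε ^ 2 = ε) :
    lift ξ ε h₁ h₂ (e A) = ε := liftRingHom_e _ ξ ε h₁ h₂

@[ext] theorem algHom_ext [Algebra A C] {f g : GRing A →ₐ[A] C} (hx : f (x A) = g (x A))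
    (he : f (e A) = g (e A)) : f = g := by
  have : f.comp (mk A) = g.comp (mk A) := by
    ext i; fin_cases i
    · exact hx
    · exact he
  ext p
  obtain ⟨p, rfl⟩ := mk_surjective p
  exact congr($this p)

variable (A)

theorem inl_x : (x A ⊗ₜ[A] (1 : GRing A)) ^ 3 = 1 := by
  rw [Algebra.TensorProduct.tmul_pow, x_pow, one_pow]; rfl

theorem inr_x : ((1 : GRing A) ⊗ₜ[A] x A) ^ 3 = 1 := by
  rw [Algebra.TensorProduct.tmul_pow, x_pow, one_pow]; rfl

theorem inl_e : (e A ⊗ₜ[A] (1 : GRing A)) ^ 2 = e A ⊗ₜ 1 := by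
  rw [Algebra.TensorProduct.tmul_pow, e_sq, one_pow]

theorem inr_e : ((1 : GRing A) ⊗ₜ[A] e A) ^ 2 = 1 ⊗ₜ e A := by
  rw [Algebra.TensorProduct.tmul_pow, e_sq, one_pow]

def comulAlgHom : GRing A →ₐ[A] GRing A ⊗[A] GRing A :=
  lift (mulX (x A ⊗ₜ 1) (e A ⊗ₜ 1) (1 ⊗ₜ x A)) (mulE (e A ⊗ₜ 1) (1 ⊗ₜ e A))
    (mulX_pow (inl_x A) (inl_e A) (inr_x A)) (mulE_sq (inl_e A) (inr_e A))

def counitAlgHom : GRing A →ₐ[A] A := lift 1 0 (one_pow 3) (zero_pow two_ne_zero)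

def antipodeAlgHom : GRing A →ₐ[A] GRing A :=
  lift ((1 - e A) * x A ^ 2 + e A * x A) (e A)
    (by have := x_pow A; have := e_sq A; grind) (e_sq A)

theorem map_mulX {C D : Type*} [CommRing C] [CommRing D] [Algebra A C] [Algebra A D]
    (f : C →ₐ[A] D) (ζ ε ξ : C) : f (mulX ζ ε ξ) = mulX (f ζ) (f ε) (f ξ) := by
  simp [mulX]

theorem map_mulE {C D : Type*} [CommRing C] [CommRing D] [Algebra A C] [Algebra A D]
    (f : C →ₐ[A] D) (ε δ : C) : f (mulE ε δ) = mulE (f ε) (f δ) := by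
  simp [mulE, map_ofNat]

instance : Bialgebra A (GRing A) :=
  Bialgebra.ofAlgHom (comulAlgHom A) (counitAlgHom A)
    (by
      have h0 := Algebra.TensorProduct.one_def (R := A) (A := GRing A) (B := GRing A)
      have h3 : (((1 : GRing A) ⊗ₜ[A] ((1 : GRing A) ⊗ₜ[A] x A))) ^ 3 = 1 := by
        rw [Algebra.TensorProduct.tmul_pow, inr_x, one_pow]; rfl
      have h4 : (e A ⊗ₜ[A] ((1 : GRing A) ⊗ₜ[A] (1 : GRing A))) ^ 2 = e A ⊗ₜ (1 ⊗ₜ 1) := by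
        rw [← h0, Algebra.TensorProduct.tmul_pow, e_sq, one_pow]
      have h5 : (((1 : GRing A) ⊗ₜ[A] (e A ⊗ₜ[A] (1 : GRing A)))) ^ 2 = 1 ⊗ₜ (e A ⊗ₜ 1) := by
        rw [Algebra.TensorProduct.tmul_pow, inl_e, one_pow]
      let g : GRing A ⊗[A] GRing A →ₐ[A] GRing A ⊗[A] (GRing A ⊗[A] GRing A) :=
        (Algebra.TensorProduct.assoc A A A (GRing A) (GRing A) (GRing A)).toAlgHom.comp
          Algebra.TensorProduct.includeLeft
      have hg : ∀ t, (Algebra.TensorProduct.assoc A A A (GRing A) (GRing A) (GRing A)).toAlgHom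
        (t ⊗ₜ 1) = g t := fun _ => rfl
      let r : GRing A ⊗[A] GRing A →ₐ[A] GRing A ⊗[A] (GRing A ⊗[A] GRing A) :=
        Algebra.TensorProduct.includeRight
      have hr : ∀ t, 1 ⊗ₜ[A] t = r t := fun _ => rfl
      ext
      · simp only [comulAlgHom, AlgHom.comp_apply, lift_x, map_mulX,
          Algebra.TensorProduct.map_tmul, map_one, AlgHom.id_apply, hg, lift_e]
        rw [hr (mulX _ _ _)]
        simp only [map_mulX, map_mulE]
        simp only [g, r, AlgHom.comp_apply, Algebra.TensorProduct.includeLeft_apply,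
          Algebra.TensorProduct.includeRight_apply, h0]
        exact mulX_assoc (X1 := x A ⊗ₜ[A] ((1 : GRing A) ⊗ₜ[A] (1 : GRing A))) h4 h5 h3
      · simp only [comulAlgHom, AlgHom.comp_apply, lift_e, map_mulE,
          Algebra.TensorProduct.map_tmul, map_one, AlgHom.id_apply, hg]
        rw [hr (mulE _ _)]
        simp only [map_mulE]
        simp only [g, r, AlgHom.comp_apply, Algebra.TensorProduct.includeLeft_apply,
          Algebra.TensorProduct.includeRight_apply, h0]
        exact mulE_assoc _ _ _)
    (by
      ext <;> simp [comulAlgHom, counitAlgHom, map_mulX, map_mulE, mulX, mulE])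
    (by
      ext
      · simp [comulAlgHom, counitAlgHom, map_mulX, mulX]
        rw [← Algebra.TensorProduct.one_def, mul_one, sub_add_cancel, mul_one]
      · simp [comulAlgHom, counitAlgHom, map_mulE, mulE])

theorem comulAlgHom_apply (a : GRing A) : Bialgebra.comulAlgHom A (GRing A) a = comulAlgHom A a :=
  rfl

theorem counitAlgHom_apply (a : GRing A) :
    Bialgebra.counitAlgHom A (GRing A) a = counitAlgHom A a :=
  rfl

instance : HopfAlgebra A (GRing A) :=
  HopfAlgebra.ofAlgHom (antipodeAlgHom A)
    (by
      have h₁ := x_pow A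
      have h₂ := e_sq A
      ext
      · simp only [AlgHom.comp_apply, comulAlgHom_apply, counitAlgHom_apply, comulAlgHom,
          counitAlgHom, lift_x, lift_e, map_mulX]
        simp [antipodeAlgHom]
        unfold mulX
        grind
      · simp only [AlgHom.comp_apply, comulAlgHom_apply, counitAlgHom_apply, comulAlgHom,
          counitAlgHom, lift_x, lift_e, map_mulE]
        simp [antipodeAlgHom]
        unfold mulE
        grind)
    (by
      have h₁ := x_pow A
      have h₂ := e_sq A
      ext
      · simp only [AlgHom.comp_apply, comulAlgHom_apply, counitAlgHom_apply, comulAlgHom,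
          counitAlgHom, lift_x, lift_e, map_mulX]
        simp [antipodeAlgHom]
        unfold mulX
        grind
      · simp only [AlgHom.comp_apply, comulAlgHom_apply, counitAlgHom_apply, comulAlgHom,
          counitAlgHom, lift_x, lift_e, map_mulE]
        simp [antipodeAlgHom]
        unfold mulE
        grind)

end GRing
end GroupScheme

namespace GRing

variable {A B : Type*} [CommRing A] [CommRing B]

/-- The base change map `O(G_A) → O(G_B)` along `φ : A → B`, as a ring homomorphism. -/
def mapRingHom (φ : A →+* B) : GRing A →+* GRing B :=
  liftRingHom ((algebraMap B (GRing B)).comp φ) (x B) (e B) (x_pow B) (e_sq B)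

/-- The base change map `O(G_A) → O(G_B)` along `φ : A → B`, as a semilinear map. -/
def map (φ : A →+* B) : GRing A →ₛₗ[φ] GRing B where
  toFun := mapRingHom φ
  map_add' := map_add _
  map_smul' a p := by
    rw [Algebra.smul_def, Algebra.smul_def, map_mul, mapRingHom, liftRingHom_algebraMap]
    rfl

theorem map_mul (φ : A →+* B) (p q : GRing A) : map φ (p * q) = map φ p * map φ q :=
  _root_.map_mul (mapRingHom φ) p q

theorem map_sub (φ : A →+* B) (p q : GRing A) : map φ (p - q) = map φ p - map φ q :=
  _root_.map_sub (mapRingHom φ) p q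

theorem map_pow (φ : A →+* B) (p : GRing A) (n : ℕ) : map φ (p ^ n) = map φ p ^ n :=
  _root_.map_pow (mapRingHom φ) p n

theorem map_one (φ : A →+* B) : map φ (1 : GRing A) = 1 :=
  _root_.map_one (mapRingHom φ)

theorem map_x (φ : A →+* B) : map φ (x A) = x B := liftRingHom_x _ _ _ (x_pow B) (e_sq B)

theorem map_e (φ : A →+* B) : map φ (e A) = e B := liftRingHom_e _ _ _ (x_pow B) (e_sq B)

theorem ringHom_ext {C : Type*} [CommRing C] {f g : GRing A →+* C}
    (h : ∀ a, f (algebraMap A _ a) = g (algebraMap A _ a)) (hx : f (x A) = g (x A))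
    (he : f (e A) = g (e A)) : f = g := by
  have : f.comp (mk A).toRingHom = g.comp (mk A).toRingHom := by
    refine MvPolynomial.ringHom_ext (fun a => ?_) (fun i => ?_)
    · have := (mk A).commutes a
      rw [MvPolynomial.algebraMap_eq] at this
      change f (mk A (MvPolynomial.C a)) = g (mk A (MvPolynomial.C a))
      rw [this, h]
    · fin_cases i
      · exact hx
      · exact he
  ext p
  obtain ⟨p, rfl⟩ := mk_surjective p
  exact congr($this p)

theorem mapRingHom_algebraMap (φ : A →+* B) (a : A) :
    mapRingHom φ (algebraMap A _ a) = algebraMap B _ (φ a) :=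
  liftRingHom_algebraMap ((algebraMap B (GRing B)).comp φ) _ _ (x_pow B) (e_sq B) a

theorem map_comp {C : Type*} [CommRing C] (φ : A →+* B) (ψ : B →+* C) (p : GRing A) :
    map (ψ.comp φ) p = map ψ (map φ p) := by
  have : mapRingHom (ψ.comp φ) = (mapRingHom ψ).comp (mapRingHom φ) :=
    ringHom_ext (fun a => by simp [mapRingHom_algebraMap])
      ((map_x (ψ.comp φ)).trans ((congrArg (map ψ) (map_x φ)).trans (map_x ψ)).symm)
      ((map_e (ψ.comp φ)).trans ((congrArg (map ψ) (map_e φ)).trans (map_e ψ)).symm)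
  exact congr($this p)

theorem map_id (p : GRing A) : map (RingHom.id A) p = p := by
  have : mapRingHom (RingHom.id A) = RingHom.id _ :=
    ringHom_ext (fun a => by simp [mapRingHom_algebraMap]) (map_x _) (map_e _)
  exact congr($this p)

end GRing

section Semilinear

/-- The composite of semilinear maps. -/
def compS {A B C : Alg.{u}} {φ : A ⟶ B} {ψ : B ⟶ C} {M N P : Type*} [AddCommGroup M]
    [Module A M] [AddCommGroup N] [Module B N] [AddCommGroup P] [Module C P]
    (g : N →ₛₗ[rh ψ] P) (f : M →ₛₗ[rh φ] N) : M →ₛₗ[rh (φ ≫ ψ)] P :=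
  haveI : RingHomCompTriple (rh φ) (rh ψ) (rh (φ ≫ ψ)) := ⟨rfl⟩
  g.comp f

/-- The identity as a semilinear map. -/
def idS (A : Alg.{u}) (M : Type*) [AddCommGroup M] [Module A M] : M →ₛₗ[rh (𝟙 A)] M :=
  (LinearMap.id : M →ₗ[A] M)

@[simp] theorem idS_apply (A : Alg.{u}) (M : Type*) [AddCommGroup M] [Module A M] (m : M) :
    idS A M m = m := rfl

variable {A B C : Alg.{u}} {φ : A ⟶ B} {ψ : B ⟶ C} {M N P : Type*} [AddCommGroup M]
    [Module A M] [AddCommGroup N] [Module B N] [AddCommGroup P] [Module C P]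

@[simp] theorem compS_apply (g : N →ₛₗ[rh ψ] P) (f : M →ₛₗ[rh φ] N) (m : M) :
    compS g f m = g (f m) := rfl

theorem IsPullback.compS {g : N →ₛₗ[rh ψ] P} {f : M →ₛₗ[rh φ] N} (hg : IsPullback (rh ψ) g)
    (hf : IsPullback (rh φ) f) : IsPullback (rh (φ ≫ ψ)) (compS g f) :=
  hf.comp hg (fun _ => rfl) _ (fun _ => rfl)

theorem isPullback_idS (A : Alg.{u}) (M : Type*) [AddCommGroup M] [Module A M] :
    IsPullback (rh (𝟙 A)) (idS A M) :=
  isPullback_id (A := A) (M := M) _ (fun _ => rfl)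

end Semilinear

/-- The objects `χ = (L, F, α, β, ⟨-,-⟩)` of the stack `𝒴`: an invertible sheaf `L`, a locally free
sheaf `F` of rank two, and maps `α : L ⊗ F → F`, `β : Sym² F → F` and `ω = ⟨-,-⟩ : det F → L`,
written as bilinear, symmetric bilinear and alternating bilinear maps. -/
structure Datum where
  base : Alg.{u}
  L : Type u
  F : Type u
  [addCommGroupL : AddCommGroup L]
  [moduleL : Module base L]
  [finiteL : Module.Finite base L]
  [projectiveL : Module.Projective base L]
  [addCommGroupF : AddCommGroup F]
  [moduleF : Module base F]
  [finiteF : Module.Finite base F]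
  [projectiveF : Module.Projective base F]
  rankL : ∀ p : PrimeSpectrum base, Module.rankAtStalk (R := base) L p = 1
  rankF : ∀ p : PrimeSpectrum base, Module.rankAtStalk (R := base) F p = 2
  α : L →ₗ[base] F →ₗ[base] F
  β : F →ₗ[base] F →ₗ[base] F
  ω : F →ₗ[base] F →ₗ[base] L
  β_symm : ∀ u v, β u v = β v u
  ω_alt : ∀ u, ω u u = 0

namespace Datum

attribute [instance] addCommGroupL moduleL finiteL projectiveL addCommGroupF moduleF finiteF
  projectiveF

/-- Arrows of `𝒴`. -/
structure Hom (χ χ' : Datum.{u}) where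
  base : χ.base ⟶ χ'.base
  mapL : χ.L →ₛₗ[rh base] χ'.L
  mapF : χ.F →ₛₗ[rh base] χ'.F
  pullbackL : IsPullback (rh base) mapL
  pullbackF : IsPullback (rh base) mapF
  map_α : ∀ l u, mapF (χ.α l u) = χ'.α (mapL l) (mapF u)
  map_β : ∀ u v, mapF (χ.β u v) = χ'.β (mapF u) (mapF v)
  map_ω : ∀ u v, mapL (χ.ω u v) = χ'.ω (mapF u) (mapF v)

instance : Category Datum.{u} where
  Hom := Hom
  id χ :=
    { base := 𝟙 _
      mapL := idS _ _
      mapF := idS _ _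
      pullbackL := isPullback_idS _ _
      pullbackF := isPullback_idS _ _
      map_α := fun _ _ => rfl
      map_β := fun _ _ => rfl
      map_ω := fun _ _ => rfl }
  comp f g :=
    { base := f.base ≫ g.base
      mapL := compS g.mapL f.mapL
      mapF := compS g.mapF f.mapF
      pullbackL := g.pullbackL.compS f.pullbackL
      pullbackF := g.pullbackF.compS f.pullbackF
      map_α := fun l u => by simp [f.map_α, g.map_α]
      map_β := fun u v => by simp [f.map_β, g.map_β]
      map_ω := fun u v => by simp [f.map_ω, g.map_ω] }
  id_comp _ := rfl
  comp_id _ := rfl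
  assoc _ _ _ := rfl

/-- The structure functor. -/
def proj : Datum.{u} ⥤ Alg.{u} where
  obj χ := χ.base
  map f := f.base

variable (χ : Datum.{u})

/-- The map `m = (1/2) tr (α ∘ (id ⊗ α)) : L ⊗ L → O`. -/
def m : χ.L →ₗ[χ.base] χ.L →ₗ[χ.base] χ.base :=
  LinearMap.mk₂ χ.base
    (fun l l' => algebraMap BaseRing χ.base half * trace ((χ.α l).comp (χ.α l')))
    (fun l₁ l₂ l' => by simp [LinearMap.add_comp, mul_add])
    (fun c l l' => by simp [LinearMap.smul_comp, mul_left_comm])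
    (fun l l₁ l₂ => by simp [LinearMap.comp_add, mul_add])
    (fun c l l' => by simp [LinearMap.comp_smul, mul_left_comm])

/-- The map `(-,-) : F ⊗ F ≃ Fᵛ ⊗ det F ⊗ F → Fᵛ ⊗ L ⊗ F → Fᵛ ⊗ F → O`. The isomorphism
`F ≃ Fᵛ ⊗ det F` sends `u` to `w ↦ w ∧ u`, so `(u, v)` is the trace of `w ↦ α (⟨w, u⟩ ⊗ v)`; if `t`
generates `L` this is `⟨α (t ⊗ v), u⟩`. -/
def bracket : χ.F →ₗ[χ.base] χ.F →ₗ[χ.base] χ.base :=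
  LinearMap.mk₂ χ.base (fun u v => trace ((χ.α.flip v).comp (χ.ω.flip u)))
    (fun l₁ l₂ l' => by simp [LinearMap.comp_add])
    (fun c l l' => by simp [LinearMap.comp_smul])
    (fun l l₁ l₂ => by simp [LinearMap.add_comp])
    (fun c l l' => by simp [LinearMap.smul_comp])

theorem m_apply (l l' : χ.L) :
    χ.m l l' = algebraMap BaseRing χ.base half * trace ((χ.α l).comp (χ.α l')) := rfl

theorem bracket_apply (u v : χ.F) :
    χ.bracket u v = trace ((χ.α.flip v).comp (χ.ω.flip u)) := rfl

variable {χ} {χ' : Datum.{u}}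

theorem Hom.map_m (f : Hom χ χ') (l l' : χ.L) :
    χ'.m (f.mapL l) (f.mapL l') = rh f.base (χ.m l l') := by
  rw [m_apply, m_apply, map_mul, trace_pullback f.pullbackF ((χ.α l).comp (χ.α l'))]
  · congr 1
    exact (f.base.hom.commutes half).symm
  · intro u
    simp [f.map_α]

theorem Hom.map_bracket (f : Hom χ χ') (u v : χ.F) :
    χ'.bracket (f.mapF u) (f.mapF v) = rh f.base (χ.bracket u v) := by
  rw [bracket_apply, bracket_apply, trace_pullback f.pullbackF]
  intro w
  simp [f.map_α, f.map_ω]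

end Datum

/-- The objects of the stack of locally free sheaves of finite rank with a coaction of `G` and an
equivariant multiplication, neither associative nor commutative in general, with an invariant
unit. -/
structure GAlgebra where
  base : Alg.{u}
  carrier : Type u
  [addCommGroup : AddCommGroup carrier]
  [module : Module base carrier]
  [finite : Module.Finite base carrier]
  [projective : Module.Projective base carrier]
  one : carrier
  mul : carrier →ₗ[base] carrier →ₗ[base] carrier
  coact : carrier →ₗ[base] carrier ⊗[base] GRing base
  one_mul : ∀ a, mul one a = a
  mul_one : ∀ a, mul a one = a
  coassoc : (TensorProduct.assoc base carrier (GRing base) (GRing base)).toLinearMap ∘ₗ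
      TensorProduct.map coact LinearMap.id ∘ₗ coact =
    TensorProduct.map LinearMap.id (Coalgebra.comul (R := base) (A := GRing base)) ∘ₗ coact
  counit : (TensorProduct.rid base carrier).toLinearMap ∘ₗ
    TensorProduct.map LinearMap.id (Coalgebra.counit (R := base) (A := GRing base)) ∘ₗ coact =
      LinearMap.id
  coact_one : coact one = one ⊗ₜ 1
  coact_mul : ∀ a b, coact (mul a b) =
    TensorProduct.map₂ mul (LinearMap.mul base (GRing base)) (coact a) (coact b)

namespace GAlgebra

attribute [instance] addCommGroup module finite projective

/-- Arrows: equivariant, multiplicative, unital base change maps. -/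
structure Hom (X Y : GAlgebra.{u}) where
  base : X.base ⟶ Y.base
  map : X.carrier →ₛₗ[rh base] Y.carrier
  pullback : IsPullback (rh base) map
  map_one : map X.one = Y.one
  map_mul : ∀ a b, map (X.mul a b) = Y.mul (map a) (map b)
  map_coact : ∀ a, Y.coact (map a) = TensorProduct.map map (GRing.map (rh base)) (X.coact a)

instance : Category GAlgebra.{u} where
  Hom := Hom
  id X :=
    { base := 𝟙 _
      map := idS _ _
      pullback := isPullback_idS _ _
      map_one := rfl
      map_mul := fun _ _ => rfl
      map_coact := fun a => by
        change X.coact a = _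
        induction X.coact a with
        | zero => simp
        | tmul a p => simpa using (GRing.map_id p).symm ▸ rfl
        | add p q hp hq => rw [map_add, ← hp, ← hq] }
  comp f g :=
    { base := f.base ≫ g.base
      map := compS g.map f.map
      pullback := g.pullback.compS f.pullback
      map_one := by simp [f.map_one, g.map_one]
      map_mul := fun _ _ => by simp [f.map_mul, g.map_mul]
      map_coact := fun a => by
        rw [compS_apply, g.map_coact, f.map_coact]
        induction GAlgebra.coact _ a with
        | zero => simp
        | tmul a p =>
          simp only [TensorProduct.map_tmul, compS_apply]
          exact congrArg _ (GRing.map_comp (rh f.base) (rh g.base) p).symm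
        | add p q hp hq => simp only [map_add, hp, hq] }
  id_comp _ := rfl
  comp_id _ := rfl
  assoc _ _ _ := rfl

/-- The structure functor. -/
def proj : GAlgebra.{u} ⥤ Alg.{u} where
  obj χ := χ.base
  map f := f.base

end GAlgebra

namespace GRing

variable (A : Type*) [CommRing A]

/- The two dimensional comodule with basis `f₁, f₂` that is induced from the character `x` of `μ₃`
has coaction `f₁ ↦ f₁ ⊗ u₁ + f₂ ⊗ v₂`, `f₂ ↦ f₂ ⊗ u₂ + f₁ ⊗ v₁` with the functions below; `σ`
exchanges `f₁` and `f₂`, and `μ₃` acts on them through `x` and `x ^ 2`. -/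

/-- The sign character `G → ℤ/2 → 𝔾ₘ`. -/
def s : GRing A := 1 - 2 * e A

def u₁ : GRing A := x A * (1 - e A)

def u₂ : GRing A := x A ^ 2 * (1 - e A)

def v₁ : GRing A := x A * e A

def v₂ : GRing A := x A ^ 2 * e A

theorem mul_table :
    s A * s A = 1 ∧ s A * u₁ A = u₁ A ∧ s A * u₂ A = u₂ A ∧ s A * v₁ A = -v₁ A ∧
    s A * v₂ A = -v₂ A ∧ u₁ A * s A = u₁ A ∧ u₂ A * s A = u₂ A ∧ v₁ A * s A = -v₁ A ∧
    v₂ A * s A = -v₂ A ∧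
    u₁ A * u₁ A = u₂ A ∧ u₁ A * u₂ A = 1 - e A ∧ u₁ A * v₁ A = 0 ∧ u₁ A * v₂ A = 0 ∧
    u₂ A * u₁ A = 1 - e A ∧ u₂ A * u₂ A = u₁ A ∧ u₂ A * v₁ A = 0 ∧ u₂ A * v₂ A = 0 ∧
    v₁ A * u₁ A = 0 ∧ v₁ A * u₂ A = 0 ∧ v₁ A * v₁ A = v₂ A ∧ v₁ A * v₂ A = e A ∧
    v₂ A * u₁ A = 0 ∧ v₂ A * u₂ A = 0 ∧ v₂ A * v₁ A = e A ∧ v₂ A * v₂ A = v₁ A := by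
  have h₁ := x_pow A
  have h₂ := e_sq A
  unfold s u₁ u₂ v₁ v₂
  refine ⟨?_, ?_, ?_, ?_, ?_, ?_, ?_, ?_, ?_, ?_, ?_, ?_, ?_, ?_, ?_, ?_, ?_, ?_, ?_, ?_, ?_,
    ?_, ?_, ?_, ?_⟩ <;> grind

theorem tmul_eq (a b : GRing A) : a ⊗ₜ[A] b = (a ⊗ₜ 1) * ((1 : GRing A) ⊗ₜ b) := by simp

theorem comul_table :
    Coalgebra.comul (R := A) (1 : GRing A) = 1 ⊗ₜ 1 ∧
    Coalgebra.comul (R := A) (s A) = s A ⊗ₜ s A ∧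
    Coalgebra.comul (R := A) (u₁ A) = u₁ A ⊗ₜ u₁ A + v₁ A ⊗ₜ v₂ A ∧
    Coalgebra.comul (R := A) (u₂ A) = u₂ A ⊗ₜ u₂ A + v₂ A ⊗ₜ v₁ A ∧
    Coalgebra.comul (R := A) (v₁ A) = u₁ A ⊗ₜ v₁ A + v₁ A ⊗ₜ u₂ A ∧
    Coalgebra.comul (R := A) (v₂ A) = u₂ A ⊗ₜ v₂ A + v₂ A ⊗ₜ u₁ A := by
  have h : ∀ p : GRing A, Coalgebra.comul (R := A) p = comulAlgHom A p := fun _ => rfl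
  obtain ⟨l, r, ht⟩ : ∃ l r : GRing A →ₐ[A] GRing A ⊗[A] GRing A,
      ∀ p q : GRing A, p ⊗ₜ[A] q = l p * r q :=
    ⟨Algebra.TensorProduct.includeLeft, Algebra.TensorProduct.includeRight,
      fun p q => by simp⟩
  have h1 := inl_x A
  have h2 := inr_x A
  have h3 := inl_e A
  have h4 := inr_e A
  have hx : comulAlgHom A (x A) = mulX (x A ⊗ₜ 1) (e A ⊗ₜ 1) (1 ⊗ₜ x A) := lift_x _ _ _ _
  have he : comulAlgHom A (e A) = mulE (e A ⊗ₜ 1) (1 ⊗ₜ e A) := lift_e _ _ _ _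
  simp only [ht, _root_.map_one, one_mul, mul_one, mulX, mulE,
    _root_.map_mul, _root_.map_sub, _root_.map_pow, _root_.map_ofNat]
    at hx he h1 h2 h3 h4
  simp only [h, ht, _root_.map_one, one_mul, mul_one, s, u₁, u₂, v₁, v₂,
    _root_.map_mul, _root_.map_sub, _root_.map_pow,
    _root_.map_ofNat, hx, he]
  generalize l (x A) = a at *
  generalize l (e A) = b at *
  generalize r (x A) = c at *
  generalize r (e A) = d at *
  clear hx he h ht
  refine ⟨?_, ?_, ?_, ?_, ?_, ?_⟩ <;> grind

theorem counit_table :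
    Coalgebra.counit (R := A) (1 : GRing A) = 1 ∧ Coalgebra.counit (R := A) (s A) = 1 ∧
    Coalgebra.counit (R := A) (u₁ A) = 1 ∧ Coalgebra.counit (R := A) (u₂ A) = 1 ∧
    Coalgebra.counit (R := A) (v₁ A) = 0 ∧ Coalgebra.counit (R := A) (v₂ A) = 0 := by
  have h : ∀ p : GRing A, Coalgebra.counit (R := A) p = counitAlgHom A p := fun _ => rfl
  simp [h, counitAlgHom, s, u₁, u₂, v₁, v₂]

theorem map_table {B : Type*} [CommRing B] (φ : A →+* B) :
    map φ (1 : GRing A) = 1 ∧ map φ (s A) = s B ∧ map φ (u₁ A) = u₁ B ∧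
    map φ (u₂ A) = u₂ B ∧ map φ (v₁ A) = v₁ B ∧ map φ (v₂ A) = v₂ B := by
  have h2 : map φ (2 : GRing A) = 2 := map_ofNat (mapRingHom φ) 2
  simp [s, u₁, u₂, v₁, v₂, map_mul, map_sub, map_pow, map_one, map_x, map_e, h2]

end GRing

namespace Datum

variable (χ : Datum.{u})

/-- The module `A_χ = O ⊕ L ⊕ F₁ ⊕ F₂` with `F₁ = F₂ = F`. -/
abbrev Carrier : Type u := χ.base × χ.L × χ.F × χ.F

/-- The multiplication of `A_χ`: `1 ∈ O` is the unit, `L ⊗ L → O` is `m`, `L` acts on `F₁` (on both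
sides) by `α` and on `F₂` by `-α`, `F₁ ⊗ F₁ → F₂` and `F₂ ⊗ F₂ → F₁` are `β`, `F₁ ⊗ F₂ → O ⊕ L` is
`(-,-) + ⟨-,-⟩` and `F₂ ⊗ F₁ → O ⊕ L` is `(-,-) - ⟨-,-⟩`. -/
def algMul : χ.Carrier →ₗ[χ.base] χ.Carrier →ₗ[χ.base] χ.Carrier :=
  LinearMap.mk₂ χ.base
    (fun v w =>
      (v.1 * w.1 + χ.m v.2.1 w.2.1 + χ.bracket v.2.2.1 w.2.2.2 + χ.bracket v.2.2.2 w.2.2.1,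
       v.1 • w.2.1 + w.1 • v.2.1 + χ.ω v.2.2.1 w.2.2.2 - χ.ω v.2.2.2 w.2.2.1,
       v.1 • w.2.2.1 + w.1 • v.2.2.1 + χ.α v.2.1 w.2.2.1 + χ.α w.2.1 v.2.2.1 +
         χ.β v.2.2.2 w.2.2.2,
       v.1 • w.2.2.2 + w.1 • v.2.2.2 - χ.α v.2.1 w.2.2.2 - χ.α w.2.1 v.2.2.2 +
         χ.β v.2.2.1 w.2.2.1))
    (fun v₁ v₂ w => by
      ext <;> simp <;> first | module | ring)
    (fun c v w => by
      ext <;> simp <;> first | module | ring)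
    (fun v w₁ w₂ => by
      ext <;> simp <;> first | module | ring)
    (fun c v w => by
      ext <;> simp <;> first | module | ring)

/-- The inclusion of `O`. -/
def in₀ : χ.base →ₗ[χ.base] χ.Carrier := LinearMap.inl _ _ _

/-- The inclusion of `L`. -/
def inL : χ.L →ₗ[χ.base] χ.Carrier := LinearMap.inr _ _ _ ∘ₗ LinearMap.inl _ _ _

/-- The inclusion of `F₁`. -/
def in₁ : χ.F →ₗ[χ.base] χ.Carrier :=
  LinearMap.inr _ _ _ ∘ₗ LinearMap.inr _ _ _ ∘ₗ LinearMap.inl _ _ _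

/-- The inclusion of `F₂`. -/
def in₂ : χ.F →ₗ[χ.base] χ.Carrier :=
  LinearMap.inr _ _ _ ∘ₗ LinearMap.inr _ _ _ ∘ₗ LinearMap.inr _ _ _

/-- The coaction on `A_χ`: `μ₃` acts with weights `0, 0, 1, 2` on `O, L, F₁, F₂`, and `σ` acts as
the identity on `O`, as `-1` on `L`, and exchanges `F₁` and `F₂` by the identity of `F`. -/
def algCoact : χ.Carrier →ₗ[χ.base] χ.Carrier ⊗[χ.base] GRing χ.base :=
  let t (g : GRing χ.base) : χ.Carrier →ₗ[χ.base] χ.Carrier ⊗[χ.base] GRing χ.base :=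
    (TensorProduct.mk χ.base χ.Carrier (GRing χ.base)).flip g
  (t 1 ∘ₗ χ.in₀).coprod
    ((t (GRing.s _) ∘ₗ χ.inL).coprod
      ((t (GRing.u₁ _) ∘ₗ χ.in₁ + t (GRing.v₂ _) ∘ₗ χ.in₂).coprod
        (t (GRing.u₂ _) ∘ₗ χ.in₂ + t (GRing.v₁ _) ∘ₗ χ.in₁)))

theorem algCoact_apply (v : χ.Carrier) : χ.algCoact v =
    χ.in₀ v.1 ⊗ₜ 1 + (χ.inL v.2.1 ⊗ₜ GRing.s _ +
      ((χ.in₁ v.2.2.1 ⊗ₜ GRing.u₁ _ + χ.in₂ v.2.2.1 ⊗ₜ GRing.v₂ _) +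
        (χ.in₂ v.2.2.2 ⊗ₜ GRing.u₂ _ + χ.in₁ v.2.2.2 ⊗ₜ GRing.v₁ _))) := rfl

theorem algCoact_in₀ (a : χ.base) : χ.algCoact (χ.in₀ a) = χ.in₀ a ⊗ₜ 1 := by
  rw [algCoact_apply]
  change χ.in₀ a ⊗ₜ 1 + (χ.inL 0 ⊗ₜ _ + ((χ.in₁ 0 ⊗ₜ _ + χ.in₂ 0 ⊗ₜ _) +
    (χ.in₂ 0 ⊗ₜ _ + χ.in₁ 0 ⊗ₜ _))) = _
  simp only [map_zero, zero_tmul, add_zero]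

theorem algCoact_inL (a : χ.L) : χ.algCoact (χ.inL a) = χ.inL a ⊗ₜ GRing.s _ := by
  rw [algCoact_apply]
  change χ.in₀ 0 ⊗ₜ 1 + (χ.inL a ⊗ₜ _ + ((χ.in₁ 0 ⊗ₜ _ + χ.in₂ 0 ⊗ₜ _) +
    (χ.in₂ 0 ⊗ₜ _ + χ.in₁ 0 ⊗ₜ _))) = _
  simp only [map_zero, zero_tmul, add_zero, zero_add]

theorem algCoact_in₁ (a : χ.F) :
    χ.algCoact (χ.in₁ a) = χ.in₁ a ⊗ₜ GRing.u₁ _ + χ.in₂ a ⊗ₜ GRing.v₂ _ := by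
  rw [algCoact_apply]
  change χ.in₀ 0 ⊗ₜ 1 + (χ.inL 0 ⊗ₜ _ + ((χ.in₁ a ⊗ₜ _ + χ.in₂ a ⊗ₜ _) +
    (χ.in₂ 0 ⊗ₜ _ + χ.in₁ 0 ⊗ₜ _))) = _
  simp only [map_zero, zero_tmul, add_zero, zero_add]

theorem algCoact_in₂ (a : χ.F) :
    χ.algCoact (χ.in₂ a) = χ.in₂ a ⊗ₜ GRing.u₂ _ + χ.in₁ a ⊗ₜ GRing.v₁ _ := by
  rw [algCoact_apply]
  change χ.in₀ 0 ⊗ₜ 1 + (χ.inL 0 ⊗ₜ _ + ((χ.in₁ 0 ⊗ₜ _ + χ.in₂ 0 ⊗ₜ _) +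
    (χ.in₂ a ⊗ₜ _ + χ.in₁ a ⊗ₜ _))) = _
  simp only [map_zero, zero_tmul, zero_add]

theorem algMul_table (a b : χ.base) (l k : χ.L) (u v : χ.F) :
    χ.algMul (χ.in₀ a) (χ.in₀ b) = χ.in₀ (a * b) ∧
    χ.algMul (χ.in₀ a) (χ.inL l) = χ.inL (a • l) ∧
    χ.algMul (χ.in₀ a) (χ.in₁ u) = χ.in₁ (a • u) ∧
    χ.algMul (χ.in₀ a) (χ.in₂ u) = χ.in₂ (a • u) ∧
    χ.algMul (χ.inL l) (χ.in₀ a) = χ.inL (a • l) ∧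
    χ.algMul (χ.in₁ u) (χ.in₀ a) = χ.in₁ (a • u) ∧
    χ.algMul (χ.in₂ u) (χ.in₀ a) = χ.in₂ (a • u) ∧
    χ.algMul (χ.inL l) (χ.inL k) = χ.in₀ (χ.m l k) ∧
    χ.algMul (χ.inL l) (χ.in₁ u) = χ.in₁ (χ.α l u) ∧
    χ.algMul (χ.inL l) (χ.in₂ u) = -χ.in₂ (χ.α l u) ∧
    χ.algMul (χ.in₁ u) (χ.inL l) = χ.in₁ (χ.α l u) ∧
    χ.algMul (χ.in₂ u) (χ.inL l) = -χ.in₂ (χ.α l u) ∧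
    χ.algMul (χ.in₁ u) (χ.in₁ v) = χ.in₂ (χ.β u v) ∧
    χ.algMul (χ.in₂ u) (χ.in₂ v) = χ.in₁ (χ.β u v) ∧
    χ.algMul (χ.in₁ u) (χ.in₂ v) = χ.in₀ (χ.bracket u v) + χ.inL (χ.ω u v) ∧
    χ.algMul (χ.in₂ u) (χ.in₁ v) = χ.in₀ (χ.bracket u v) - χ.inL (χ.ω u v) := by
  refine ⟨?_, ?_, ?_, ?_, ?_, ?_, ?_, ?_, ?_, ?_, ?_, ?_, ?_, ?_, ?_, ?_⟩ <;>
  simp [algMul, in₀, inL, in₁, in₂]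

theorem carrier_hom_ext {N : Type*} [AddCommGroup N] [Module χ.base N]
    {f g : χ.Carrier →ₗ[χ.base] N} (h₀ : ∀ a, f (χ.in₀ a) = g (χ.in₀ a))
    (hL : ∀ a, f (χ.inL a) = g (χ.inL a)) (h₁ : ∀ a, f (χ.in₁ a) = g (χ.in₁ a))
    (h₂ : ∀ a, f (χ.in₂ a) = g (χ.in₂ a)) : f = g :=
  LinearMap.prod_ext (LinearMap.ext h₀) (LinearMap.prod_ext (LinearMap.ext hL)
    (LinearMap.prod_ext (LinearMap.ext h₁) (LinearMap.ext h₂)))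

theorem carrier_induction {p : χ.Carrier → Prop} (h₀ : ∀ a, p (χ.in₀ a))
    (hL : ∀ a, p (χ.inL a)) (h₁ : ∀ a, p (χ.in₁ a)) (h₂ : ∀ a, p (χ.in₂ a))
    (h : ∀ v w, p v → p w → p (v + w)) (v : χ.Carrier) : p v := by
  have : v = χ.in₀ v.1 + χ.inL v.2.1 + χ.in₁ v.2.2.1 + χ.in₂ v.2.2.2 := by
    simp [in₀, inL, in₁, in₂]
  rw [this]
  exact h _ _ (h _ _ (h _ _ (h₀ _) (hL _)) (h₁ _)) (h₂ _)

theorem algCoact_mul (v w : χ.Carrier) : χ.algCoact (χ.algMul v w) =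
    TensorProduct.map₂ χ.algMul (LinearMap.mul χ.base (GRing χ.base)) (χ.algCoact v)
      (χ.algCoact w) := by
  have t := χ.algMul_table
  obtain ⟨r1, r2, r3, r4, r5, r6, r7, r8, r9, r10, r11, r12, r13, r14, r15, r16, r17, r18, r19,
    r20, r21, r22, r23, r24, r25⟩ := GRing.mul_table χ.base
  have hs : GRing.s χ.base = 1 - GRing.e χ.base - GRing.e χ.base := by
    rw [GRing.s, two_mul, sub_sub]
  have p1 := fun a b => (t a b 0 0 0 0).1
  have p2 := fun a l => (t a 0 l 0 0 0).2.1
  have p3 := fun a u => (t a 0 0 0 u 0).2.2.1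
  have p4 := fun a u => (t a 0 0 0 u 0).2.2.2.1
  have p5 := fun a l => (t a 0 l 0 0 0).2.2.2.2.1
  have p6 := fun a u => (t a 0 0 0 u 0).2.2.2.2.2.1
  have p7 := fun a u => (t a 0 0 0 u 0).2.2.2.2.2.2.1
  have p8 := fun l k => (t 0 0 l k 0 0).2.2.2.2.2.2.2.1
  have p9 := fun l u => (t 0 0 l 0 u 0).2.2.2.2.2.2.2.2.1
  have p10 := fun l u => (t 0 0 l 0 u 0).2.2.2.2.2.2.2.2.2.1
  have p11 := fun l u => (t 0 0 l 0 u 0).2.2.2.2.2.2.2.2.2.2.1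
  have p12 := fun l u => (t 0 0 l 0 u 0).2.2.2.2.2.2.2.2.2.2.2.1
  have p13 := fun u v => (t 0 0 0 0 u v).2.2.2.2.2.2.2.2.2.2.2.2.1
  have p14 := fun u v => (t 0 0 0 0 u v).2.2.2.2.2.2.2.2.2.2.2.2.2.1
  have p15 := fun u v => (t 0 0 0 0 u v).2.2.2.2.2.2.2.2.2.2.2.2.2.2.1
  have p16 := fun u v => (t 0 0 0 0 u v).2.2.2.2.2.2.2.2.2.2.2.2.2.2.2
  refine χ.carrier_induction (p := fun v => χ.algCoact (χ.algMul v w) =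
    TensorProduct.map₂ χ.algMul (LinearMap.mul χ.base (GRing χ.base)) (χ.algCoact v)
      (χ.algCoact w)) (fun a => ?_) (fun a => ?_) (fun a => ?_) (fun a => ?_)
    (fun v v' hv hv' => by simp only [map_add, LinearMap.add_apply, hv, hv']) v <;>
  refine χ.carrier_induction (p := fun w => χ.algCoact (χ.algMul _ w) =
    TensorProduct.map₂ χ.algMul (LinearMap.mul χ.base (GRing χ.base)) (χ.algCoact _)
      (χ.algCoact w)) (fun b => ?_) (fun b => ?_) (fun b => ?_) (fun b => ?_)
    (fun v v' hv hv' => by simp only [map_add, hv, hv']) w <;>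
  simp only [LinearMap.compr₂_apply, LinearMap.compl₁₂_apply, algCoact_in₀, algCoact_inL,
    algCoact_in₁, algCoact_in₂, p1, p2, p3, p4, p5, p6, p7, p8, p9, p10, p11, p12, p13, p14,
    p15, p16, map_add, map_sub, map_neg, LinearMap.add_apply, TensorProduct.map₂_apply_tmul,
    TensorProduct.map_tmul,
    LinearMap.mul_apply', mul_one, one_mul, r1, r2, r3, r4, r5, r6, r7, r8, r9, r10, r11, r12,
    r13, r14, r15, r16, r17, r18, r19, r20, r21, r22, r23, r24, r25, tmul_zero, add_zero,
    zero_add, neg_tmul, tmul_neg, neg_neg, neg_add, neg_sub] <;>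
  first
  | done
  | (simp only [hs, tmul_sub, add_tmul, sub_tmul]; abel)

/-- The algebra `A_χ`. -/
def toGAlgebra : GAlgebra.{u} where
  base := χ.base
  carrier := χ.Carrier
  one := χ.in₀ 1
  mul := χ.algMul
  coact := χ.algCoact
  one_mul v := by ext <;> simp [algMul, in₀]
  mul_one v := by ext <;> simp [algMul, in₀]
  coassoc := by
    obtain ⟨c0, cs, c1, c2, d1, d2⟩ := GRing.comul_table χ.base
    apply χ.carrier_hom_ext <;> intro a <;>
    simp only [LinearMap.comp_apply, algCoact_in₀, algCoact_inL, algCoact_in₁, algCoact_in₂,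
      map_add, TensorProduct.map_tmul, LinearMap.id_apply, c0, cs, c1, c2, d1, d2,
      TensorProduct.add_tmul, TensorProduct.tmul_add, LinearEquiv.coe_coe,
      TensorProduct.assoc_tmul]
    · abel
    · abel
  counit := by
    obtain ⟨c0, cs, c1, c2, d1, d2⟩ := GRing.counit_table χ.base
    apply χ.carrier_hom_ext <;> intro a <;>
    simp only [LinearMap.comp_apply, algCoact_in₀, algCoact_inL, algCoact_in₁, algCoact_in₂,
      map_add, TensorProduct.map_tmul, LinearMap.id_apply, c0, cs, c1, c2, d1, d2,
      LinearEquiv.coe_coe, TensorProduct.rid_tmul, one_smul, zero_smul, add_zero]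
  coact_one := χ.algCoact_in₀ 1
  coact_mul := χ.algCoact_mul

end Datum

namespace Datum

variable {χ χ' : Datum.{u}}

/-- The map `A_χ → A_χ'` induced by an arrow `χ → χ'`. -/
def Hom.mapCarrier (f : Hom χ χ') : χ.Carrier →ₛₗ[rh f.base] χ'.Carrier where
  toFun v := (rh f.base v.1, f.mapL v.2.1, f.mapF v.2.2.1, f.mapF v.2.2.2)
  map_add' v w := by ext <;> simp
  map_smul' c v := by ext <;> simp

theorem Hom.isPullback_mapCarrier (f : Hom χ χ') : IsPullback (rh f.base) f.mapCarrier :=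
  IsPullback.prod
    (isPullback_ringHom (rh f.base)
      { toFun := rh f.base, map_add' := map_add _, map_smul' := map_mul _ } (fun _ => rfl))
    (g := { toFun := fun v => (f.mapL v.1, f.mapF v.2.1, f.mapF v.2.2)
            map_add' := fun v w => by ext <;> simp
            map_smul' := fun v w => by ext <;> simp })
    (IsPullback.prod f.pullbackL
      (g := { toFun := fun v => (f.mapF v.1, f.mapF v.2)
              map_add' := fun v w => by ext <;> simp
              map_smul' := fun v w => by ext <;> simp })
      (IsPullback.prod f.pullbackF f.pullbackF _ (fun _ => rfl)) _ (fun _ => rfl)) _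
    (fun _ => rfl)

theorem Hom.mapCarrier_in (f : Hom χ χ') (a : χ.base) (l : χ.L) (u : χ.F) :
    f.mapCarrier (χ.in₀ a) = χ'.in₀ (rh f.base a) ∧ f.mapCarrier (χ.inL l) = χ'.inL (f.mapL l) ∧
    f.mapCarrier (χ.in₁ u) = χ'.in₁ (f.mapF u) ∧ f.mapCarrier (χ.in₂ u) = χ'.in₂ (f.mapF u) := by
  refine ⟨?_, ?_, ?_, ?_⟩ <;> simp [mapCarrier, in₀, inL, in₁, in₂]

theorem Hom.mapCarrier_algMul (f : Hom χ χ') (v w : χ.Carrier) :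
    f.mapCarrier (χ.algMul v w) = χ'.algMul (f.mapCarrier v) (f.mapCarrier w) := by
  have e : ∀ v, f.mapCarrier v = (rh f.base v.1, f.mapL v.2.1, f.mapF v.2.2.1, f.mapF v.2.2.2) :=
    fun _ => rfl
  refine Prod.ext ?_ (Prod.ext ?_ (Prod.ext ?_ ?_)) <;>
  simp [algMul, e, f.map_m, f.map_bracket, f.map_α, f.map_β, f.map_ω]

theorem Hom.mapCarrier_algCoact (f : Hom χ χ') (v : χ.Carrier) :
    χ'.algCoact (f.mapCarrier v) =
      TensorProduct.map f.mapCarrier (GRing.map (rh f.base)) (χ.algCoact v) := by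
  obtain ⟨t1, t2, t3, t4, t5, t6⟩ := GRing.map_table χ.base (rh f.base)
  have p1 := fun a => (f.mapCarrier_in a 0 0).1
  have p2 := fun l => (f.mapCarrier_in 0 l 0).2.1
  have p3 := fun u => (f.mapCarrier_in 0 0 u).2.2.1
  have p4 := fun u => (f.mapCarrier_in 0 0 u).2.2.2
  refine χ.carrier_induction (p := fun v => χ'.algCoact (f.mapCarrier v) =
    TensorProduct.map f.mapCarrier (GRing.map (rh f.base)) (χ.algCoact v))
    (fun a => ?_) (fun a => ?_) (fun a => ?_) (fun a => ?_)
    (fun v v' hv hv' => by simp only [map_add, hv, hv']) v <;>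
  simp only [p1, p2, p3, p4, algCoact_in₀, algCoact_inL, algCoact_in₁, algCoact_in₂,
    map_add, TensorProduct.map_tmul, t1, t2, t3, t4, t5, t6]

/-- The functor `χ ↦ A_χ`. -/
def toGAlgebraFunctor : Datum.{u} ⥤ GAlgebra.{u} where
  obj χ := χ.toGAlgebra
  map {χ χ'} f :=
    { base := Hom.base f
      map := Hom.mapCarrier f
      pullback := Hom.isPullback_mapCarrier f
      map_one := by
        refine ((Hom.mapCarrier_in f 1 0 0).1).trans ?_
        rw [map_one]
        rfl
      map_mul := Hom.mapCarrier_algMul f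
      map_coact := Hom.mapCarrier_algCoact f }
  map_id _ := rfl
  map_comp _ _ := rfl

end Datum

/-- The objects `(L, F, μ)` of the stack of triples: an invertible sheaf `L`, a locally free sheaf
`F` of rank two and a map `μ : L → O`. -/
structure Triple where
  base : Alg.{u}
  L : Type u
  F : Type u
  [addCommGroupL : AddCommGroup L]
  [moduleL : Module base L]
  [finiteL : Module.Finite base L]
  [projectiveL : Module.Projective base L]
  [addCommGroupF : AddCommGroup F]
  [moduleF : Module base F]
  [finiteF : Module.Finite base F]
  [projectiveF : Module.Projective base F]
  rankL : ∀ p : PrimeSpectrum base, Module.rankAtStalk (R := base) L p = 1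
  rankF : ∀ p : PrimeSpectrum base, Module.rankAtStalk (R := base) F p = 2
  μ : L →ₗ[base] base

namespace Triple

attribute [instance] addCommGroupL moduleL finiteL projectiveL addCommGroupF moduleF finiteF
  projectiveF

/-- Arrows of the stack of triples. -/
structure Hom (z z' : Triple.{u}) where
  base : z.base ⟶ z'.base
  mapL : z.L →ₛₗ[rh base] z'.L
  mapF : z.F →ₛₗ[rh base] z'.F
  pullbackL : IsPullback (rh base) mapL
  pullbackF : IsPullback (rh base) mapF
  map_μ : ∀ l, rh base (z.μ l) = z'.μ (mapL l)

instance : Category Triple.{u} where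
  Hom := Hom
  id z :=
    { base := 𝟙 _
      mapL := idS _ _
      mapF := idS _ _
      pullbackL := isPullback_idS _ _
      pullbackF := isPullback_idS _ _
      map_μ := fun _ => rfl }
  comp f g :=
    { base := f.base ≫ g.base
      mapL := compS g.mapL f.mapL
      mapF := compS g.mapF f.mapF
      pullbackL := g.pullbackL.compS f.pullbackL
      pullbackF := g.pullbackF.compS f.pullbackF
      map_μ := fun l => by
        rw [compS_apply, ← g.map_μ, ← f.map_μ]
        rfl }
  id_comp _ := rfl
  comp_id _ := rfl
  assoc _ _ _ := rfl

/-- The structure functor. -/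
def proj : Triple.{u} ⥤ Alg.{u} where
  obj z := z.base
  map f := f.base

/-- `(L, F, μ) ↦ (L, F, μ ⊗ id, 0, 0)`. -/
def toDatum : Triple.{u} ⥤ Datum.{u} where
  obj z :=
    { base := z.base
      L := z.L
      F := z.F
      rankL := z.rankL
      rankF := z.rankF
      α := LinearMap.lsmul z.base z.F ∘ₗ z.μ
      β := 0
      ω := 0
      β_symm := fun _ _ => rfl
      ω_alt := fun _ => rfl }
  map {z z'} f :=
    { base := Hom.base f
      mapL := Hom.mapL f
      mapF := Hom.mapF f
      pullbackL := Hom.pullbackL f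
      pullbackF := Hom.pullbackF f
      map_α := fun l u => by
        have := Hom.map_μ f l
        simp [← this]
      map_β := fun u v => by simp
      map_ω := fun u v => by simp }
  map_id _ := rfl
  map_comp _ _ := rfl

end Triple

section Stacks

/-- A based functor is an equivalence of stacks if it is fully faithful and every object of the
target is isomorphic, over the identity of its base, to an object of the image. -/
def IsStackEquiv {X Y : BasedCategory Alg.{u}} (F : BasedFunctor X Y) : Prop :=
  F.toFunctor.Full ∧ F.toFunctor.Faithful ∧
    ∀ y : Y.obj, ∃ (x : X.obj) (i : F.toFunctor.obj x ≅ y),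
      Y.p.IsHomLift (𝟙 (Y.p.obj y)) i.hom

/-- `X` and `Y` are equivalent stacks. -/
def StackEquiv (X Y : BasedCategory Alg.{u}) : Prop :=
  ∃ F : BasedFunctor X Y, IsStackEquiv F

/-- The product of two stacks over the base ring. Objects are pairs of objects together with an
isomorphism of their bases. -/
def stackProd (X Y : BasedCategory Alg.{u}) : BasedCategory Alg.{u} :=
  BasedCategory.ofFunctor (Limits.CategoricalPullback.π₁ X.p Y.p ⋙ X.p)

end Stacks

section QuotientStack

/-- A left action of a group functor `G` on a set valued functor `X`. -/
structure GAction (G : Alg.{u} ⥤ GrpCat.{u}) (X : Alg.{u} ⥤ Type u) where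
  act : ∀ C : Alg.{u}, G.obj C → X.obj C → X.obj C
  one_act : ∀ (C : Alg.{u}) (p : X.obj C), act C 1 p = p
  mul_act : ∀ (C : Alg.{u}) (g h : G.obj C) (p : X.obj C), act C (g * h) p = act C g (act C h p)
  natural : ∀ {C D : Alg.{u}} (ψ : C ⟶ D) (g : G.obj C) (p : X.obj C),
    X.map ψ (act C g p) = act D (G.map ψ g) (X.map ψ p)

variable {G : Alg.{u} ⥤ GrpCat.{u}} {X : Alg.{u} ⥤ Type u}

/-- An object of the quotient stack `[X/G]` over `Spec base`: a `G`-torsor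
`P = Spec total → Spec base` for the fppf topology, and an equivariant map `P → X`. For `G` affine
and of finite presentation and flat over the base ring (here `𝔾ₘ` and `GL₂`), a torsor over an
affine scheme is an affine scheme, faithfully flat and of finite presentation over the base, with
a `G`-action that preserves the fibres and is simply transitive on them. -/
structure QuotientObj (ρ : GAction G X) where
  base : Alg.{u}
  total : Alg.{u}
  proj : base ⟶ total
  faithfullyFlat : (rh proj).FaithfullyFlat
  finitePresentation : (rh proj).FinitePresentation
  action : GAction G (coyoneda.obj (Opposite.op total))
  proj_act : ∀ (C : Alg.{u}) (g : G.obj C) (p : total ⟶ C), proj ≫ action.act C g p = proj ≫ p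
  simply_transitive : ∀ (C : Alg.{u}) (p q : total ⟶ C), proj ≫ p = proj ≫ q →
    ∃! g : G.obj C, action.act C g p = q
  toSpace : coyoneda.obj (Opposite.op total) ⟶ X
  equivariant : ∀ (C : Alg.{u}) (g : G.obj C) (p : total ⟶ C),
    toSpace.app C (action.act C g p) = ρ.act C g (toSpace.app C p)

namespace QuotientObj

variable {ρ : GAction G X}

/-- Arrows of the quotient stack: equivariant maps of torsors over a map of bases, compatible with
the maps to `X`. -/
@[ext]
structure Hom (P Q : QuotientObj ρ) where
  base : P.base ⟶ Q.base
  total : P.total ⟶ Q.total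
  comm : P.proj ≫ total = base ≫ Q.proj
  map_act : ∀ (C : Alg.{u}) (g : G.obj C) (q : Q.total ⟶ C),
    total ≫ (Q.action.act C g q : Q.total ⟶ C) = P.action.act C g (total ≫ q)
  map_toSpace : ∀ (C : Alg.{u}) (q : Q.total ⟶ C),
    P.toSpace.app C (total ≫ q) = Q.toSpace.app C q

instance : Category (QuotientObj ρ) where
  Hom := Hom
  id P :=
    { base := 𝟙 _
      total := 𝟙 _
      comm := by simp
      map_act := fun C g q => by
        rw [Category.id_comp]
        exact congrArg _ (Category.id_comp q).symm
      map_toSpace := fun C q => congrArg _ (Category.id_comp q) }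
  comp {P Q R} f g :=
    { base := f.base ≫ g.base
      total := f.total ≫ g.total
      comm := by rw [← Category.assoc, f.comm, Category.assoc, g.comm, Category.assoc]
      map_act := fun C a q => by
        rw [Category.assoc, g.map_act, f.map_act]
        exact congrArg _ (Category.assoc f.total g.total q).symm
      map_toSpace := fun C q => by
        refine Eq.trans ?_ ((f.map_toSpace C (g.total ≫ q)).trans (g.map_toSpace C q))
        exact congrArg _ (Category.assoc f.total g.total q) }
  id_comp f := Hom.ext (Category.id_comp _) (Category.id_comp _)
  comp_id f := Hom.ext (Category.comp_id _) (Category.comp_id _)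
  assoc f g h := Hom.ext (Category.assoc _ _ _) (Category.assoc _ _ _)

end QuotientObj

/-- The quotient stack `[X/G]`. -/
def quotientStack (ρ : GAction G X) : BasedCategory Alg.{u} :=
  BasedCategory.ofFunctor
    { obj := fun P : QuotientObj ρ => P.base
      map := fun f => QuotientObj.Hom.base f }

/-- The terminal space `Spec ℤ[1/2]`, as the functor with one point. -/
def point : Alg.{u} ⥤ Type u := (Functor.const _).obj PUnit

/-- The trivial action on the point. -/
def trivialAction (G : Alg.{u} ⥤ GrpCat.{u}) : GAction G point.{u} where
  act _ _ p := p
  one_act _ _ := rfl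
  mul_act _ _ _ _ := rfl
  natural _ _ _ := rfl

/-- The classifying stack `BG = [pt/G]` of `G`-torsors. -/
def classifyingStack (G : Alg.{u} ⥤ GrpCat.{u}) : BasedCategory Alg.{u} :=
  quotientStack (trivialAction G)

/-- The group scheme `𝔾ₘ`. -/
def Gm : Alg.{u} ⥤ GrpCat.{u} where
  obj C := GrpCat.of Cˣ
  map φ := GrpCat.ofHom (Units.map (rh φ).toMonoidHom)

/-- The group scheme `GL₂`. -/
def GL₂ : Alg.{u} ⥤ GrpCat.{u} where
  obj C := GrpCat.of (Matrix.GeneralLinearGroup (Fin 2) C)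
  map φ := GrpCat.ofHom (Matrix.GeneralLinearGroup.map (rh φ))
  map_id C := rfl
  map_comp f g := rfl

/-- The affine line `𝔸¹`. -/
def affineLine : Alg.{u} ⥤ Type u where
  obj C := C
  map φ := TypeCat.ofHom (rh φ)

/-- The scaling action of `𝔾ₘ` on `𝔸¹`. -/
def scaling : GAction Gm.{u} affineLine.{u} where
  act C g x := ((show Cˣ from g) : C) * (show C from x)
  one_act C x := one_mul (M := C) x
  mul_act C g h x := mul_assoc (G := C) ((show Cˣ from g) : C) ((show Cˣ from h) : C) x
  natural {C D} ψ g x := map_mul (rh ψ) ((show Cˣ from g) : C) (show C from x)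

end QuotientStack

section GCov

/-- `X` is (the algebra of) a `G`-cover: it is a commutative and associative algebra which is, as a
`G`-comodule and fppf locally on the base, isomorphic to the regular representation. -/
def IsGCover : ObjectProperty GAlgebra.{u} := fun X =>
  (∀ a b, X.mul a b = X.mul b a) ∧
  (∀ a b c, X.mul (X.mul a b) c = X.mul a (X.mul b c)) ∧
  ∃ (B : Alg.{u}) (φ : X.base ⟶ B), (rh φ).FaithfullyFlat ∧ (rh φ).FinitePresentation ∧
    ∃ f : X.carrier →ₛₗ[rh φ] GRing B, IsPullback (rh φ) f ∧
      ∀ a, Coalgebra.comul (R := B) (f a) =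
        TensorProduct.map f (GRing.map (rh φ)) (X.coact a)

/-- The stack `G`-Cov of `G`-covers. -/
abbrev GCov := IsGCover.{u}.FullSubcategory

namespace GCov

/-- The structure functor. -/
def proj : GCov.{u} ⥤ Alg.{u} := IsGCover.ι ⋙ GAlgebra.proj

/-- The full subcategory of `G`-Cov given by a property of `G`-covers, over the base. -/
def substack (P : ObjectProperty GCov.{u}) : BasedCategory Alg.{u} :=
  BasedCategory.ofFunctor (P.ι ⋙ proj)

/-- `X` is isomorphic to `A_χ` over the identity of its base; this is the meaning of `χ ∈ G`-Cov. -/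
def IsOfDatum (X : GCov.{u}) (χ : Datum.{u}) : Prop :=
  ∃ i : χ.toGAlgebra ≅ X.obj, GAlgebra.proj.IsHomLift (𝟙 X.obj.base) i.hom

/-- The substack `Z₂` of `G`-Cov where `β = ⟨-,-⟩ = 0` and `α = ((tr α) / 2) ⊗ id`. -/
def Z₂ : ObjectProperty GCov.{u} := fun X =>
  ∃ χ : Datum.{u}, IsOfDatum X χ ∧ χ.β = 0 ∧ χ.ω = 0 ∧
    ∀ l u, χ.α l u = (algebraMap BaseRing χ.base half * trace (χ.α l)) • u

/-- The substack `{0}` of `G`-Cov where `α = β = ⟨-,-⟩ = 0`. -/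
def zero : ObjectProperty GCov.{u} := fun X =>
  ∃ χ : Datum.{u}, IsOfDatum X χ ∧ χ.α = 0 ∧ χ.β = 0 ∧ χ.ω = 0

/-- The complement `Q - P` of a closed substack `P` of `Q`: the objects of `Q` no pullback of which
to a nonempty scheme lies in `P`. -/
def diff (Q P : ObjectProperty GCov.{u}) : ObjectProperty GCov.{u} := fun X =>
  Q X ∧ ∀ (Y : GCov.{u}) (_ : X ⟶ Y), P Y → Subsingleton Y.obj.base

/-- The substack of `G`-Cov given by `P` is open: for each `G`-cover over `Spec A` there is an open
`U ⊆ Spec A` such that a map `Spec B → Spec A` factors through `U` if and only if the pullback of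
the cover to `Spec B` satisfies `P`. -/
def IsOpenSubstack (P : ObjectProperty GCov.{u}) : Prop :=
  ∀ X : GCov.{u}, ∃ U : Set (PrimeSpectrum X.obj.base), IsOpen U ∧
    ∀ (Y : GCov.{u}) (f : X ⟶ Y),
      P Y ↔ ∀ q : PrimeSpectrum Y.obj.base, PrimeSpectrum.comap (rh (proj.map f)) q ∈ U

end GCov

/-- The stack of triples `(L, F, μ)`. -/
def tripleStack : BasedCategory Alg.{u} := BasedCategory.ofFunctor Triple.proj

end GCov

end GCovers

end

/-!
The algebra `A_χ` of a triple `(L, F, μ)` is an explicit cover: with `α = μ ⊗ id` and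
`β = ⟨-,-⟩ = 0`, commutativity is visible, and the only nontrivial case of associativity is
`μ(l) μ(l') l'' = μ(l') μ(l'') l`, which holds because a bilinear map on an invertible sheaf is
symmetric. Over a cover where `L` and `F` have frames, these frames identify the comodule `A_χ`
with the regular representation (`Datum.isGCover_of_smul`, `Datum.exists_regular`). An equivariant
map `A_χ → A_χ'` preserves the isotypic parts, so that it is a map of data; hence
`χ ↦ A_χ` is fully faithful. As `μ` is recovered from `α = μ ⊗ id` by a trace, triples form the
substack `Z₂` (`Triple.isStackEquiv_toZ₂`).

Locally free sheaves of rank `n` are torsors under a group functor `G ≃ GLₙ`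
(`stackEquiv_bundleStack`). The frames of a sheaf are represented by an algebra `FrameRing` with
explicit generators and relations; it is smooth by the infinitesimal lifting criterion, hence flat,
and it is faithfully flat because there are frames over residue fields. The functor of frames is
fully faithful because a vector in the universal frame that transforms like a coordinate vector
descends (`Bundle.exists_of_equivariant`). It is essentially surjective because descent along a
faithfully flat map is effective for free modules (`bijective_liftBaseChange_descended`): over the
product of a torsor with itself, the two tautological points differ by an element of `GLₙ`, which is
the gluing matrix. A linear form on an invertible sheaf `L` is the same as a function on the frames
of `L` that `𝔾ₘ` scales, whence `Z₂' ≃ [𝔸¹/𝔾ₘ] × BGL₂` (`stackEquiv_tripleStack`).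

Openness requires a description of all covers near `Z₂ - {0}`, and every cover is of the form `A_χ`
(`GCov.exists_isOfDatum`). The coefficients of the coaction split a cover `X` into
`O ⊕ L ⊕ F ⊕ σ(F)`. The ranks of the summands are those of the regular representation, and the
products of the summands define `α`, `β` and `⟨-,-⟩`. Associativity forces the product on `L` to be
`½ tr (α(l) α(l'))`, since `α(l) α(l')` is multiplication by `l l'`, and forces the component in `O`
of `u σ(v)` to be the bracket `(u, v)`, by taking the trace of `w ↦ w (σ(u) v)`
(`GAlgebra.trace_α_ω_flip`); here `tr α` vanishes on the image of `⟨-,-⟩`.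

Then `Z₂ - {0}` is the locus where `tr α` is onto (`GCov.diff_iff_exists_trace_eq_one`), which is
open. Suppose that `tr α(l₀) = 1`. As `α(l₀)² = ½ tr (α(l₀)²)` by associativity, the theorem of
Cayley and Hamilton gives `α(l₀) = ½`; as `L` is invertible, `α = (tr α / 2) ⊗ id`; and
associativity with `l₀` as a factor shows `β = -β` and `⟨-,-⟩ = -⟨-,-⟩`, so that both vanish
(`Datum.eq_of_trace_eq_one`). Conversely, a triple whose form `μ` is not onto lies in `{0}` over
the nonempty closed subscheme defined by the image of `μ`. Finally, if `μ` is onto, it identifies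
`L` with `O`; so `F ↦ (O, F, id)` is an equivalence of the stack of locally free sheaves of rank two
with `Z₂ - {0}` (`isStackEquiv_toDiff`), and the former is `BGL₂`.
-/

noncomputable section
namespace GCovers

/-! ### Pullbacks of modules -/

section PullbackTools

variable {A B C : Type*} [CommRing A] [CommRing B] [CommRing C]
  {M N P : Type*} [AddCommGroup M] [Module A M] [AddCommGroup N] [Module B N]
  [AddCommGroup P] [Module C P]

/-- A finite projective module has a finite dual basis. -/
theorem exists_dualBasis (A M : Type*) [CommRing A] [AddCommGroup M] [Module A M]
    [Module.Finite A M] [Module.Projective A M] :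
    ∃ (n : ℕ) (x : Fin n → M) (ξ : Fin n → M →ₗ[A] A), ∀ m, ∑ i, ξ i m • x i = m := by
  obtain ⟨n, f, hf⟩ := Module.Finite.exists_fin' A M
  obtain ⟨g, hg⟩ := Module.projective_lifting_property f LinearMap.id hf
  refine ⟨n, fun i => f (Pi.single i 1), fun i => LinearMap.proj i ∘ₗ g, fun m => ?_⟩
  have h := congr($hg m)
  rw [LinearMap.comp_apply, LinearMap.pi_apply_eq_sum_univ f (g m)] at h
  convert! h using 4
  ext j
  simp [Pi.single_apply, eq_comm]

/-- A semilinear map out of a module with a dual basis is a pullback as soon as the dual basis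
extends to the target. -/
theorem isPullback_of_dualBasis {φ : A →+* B} {f : M →ₛₗ[φ] N} {ι : Type*} [Fintype ι]
    {x : ι → M} {ξ : ι → M →ₗ[A] A} (hx : ∀ m, ∑ i, ξ i m • x i = m) {η : ι → N →ₗ[B] B}
    (hη : ∀ i m, η i (f m) = φ (ξ i m)) (hs : ∀ w, ∑ i, η i w • f (x i) = w) :
    IsPullback φ f := by
  let _ : Algebra A B := φ.toAlgebra
  let _ : Module A N := Module.compHom N φ
  have _ : IsScalarTower A B N := ⟨fun a b n => mul_smul (φ a) b n⟩
  let g : M →ₗ[A] N := { toFun := f, map_add' := map_add f, map_smul' := f.map_smulₛₗ }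
  let e : B ⊗[A] M →ₗ[B] N := LinearMap.liftBaseChange B g
  let k : N →ₗ[B] B ⊗[A] M := ∑ i, (η i).smulRight (1 ⊗ₜ[A] x i)
  have hk : ∀ w, k w = ∑ i, η i w • (1 ⊗ₜ[A] x i) := fun w => by simp [k]
  have he : ∀ b m, e (b ⊗ₜ m) = b • f m := fun b m => by simp [e, g]
  have h1 : e ∘ₗ k = LinearMap.id := by
    ext w
    simp only [LinearMap.comp_apply, hk, map_sum, map_smul, he, one_smul, LinearMap.id_apply, hs]
  have h2 : k ∘ₗ e = LinearMap.id := by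
    ext m
    have h3 : ∀ i, φ (ξ i m) • ((1 : B) ⊗ₜ[A] x i) = (1 : B) ⊗ₜ[A] (ξ i m • x i) := fun i =>
      (TensorProduct.tmul_smul (R := A) (ξ i m) (1 : B) (x i)).symm
    change k (e (1 ⊗ₜ m)) = 1 ⊗ₜ m
    rw [he, one_smul, hk]
    simp only [hη, h3]
    rw [← TensorProduct.tmul_sum, hx]
  exact IsBaseChange.of_equiv (LinearEquiv.ofLinearMap e k h1 h2) (fun m => by
    change e (1 ⊗ₜ m) = f m
    rw [he, one_smul])

/-- The universal property of a pullback. -/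
theorem IsPullback.exists_lift {φ : A →+* B} {f : M →ₛₗ[φ] N} (hf : IsPullback φ f)
    {Q : Type*} [AddCommGroup Q] [Module B Q] (g : M →ₛₗ[φ] Q) :
    ∃ h : N →ₗ[B] Q, ∀ m, h (f m) = g m := by
  let _ : Algebra A B := φ.toAlgebra
  let _ : Module A N := Module.compHom N φ
  have _ : IsScalarTower A B N := ⟨fun a b n => mul_smul (φ a) b n⟩
  let _ : Module A Q := Module.compHom Q φ
  have _ : IsScalarTower A B Q := ⟨fun a b n => mul_smul (φ a) b n⟩
  exact ⟨IsBaseChange.lift hf { toFun := g, map_add' := map_add g, map_smul' := g.map_smulₛₗ },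
    fun m => IsBaseChange.lift_eq hf _ m⟩

theorem IsPullback.induction {φ : A →+* B} {f : M →ₛₗ[φ] N} (hf : IsPullback φ f)
    {p : N → Prop} (h0 : p 0) (hm : ∀ m, p (f m)) (hs : ∀ (b : B) n, p n → p (b • n))
    (ha : ∀ n n', p n → p n' → p (n + n')) (n : N) : p n := by
  let _ : Algebra A B := φ.toAlgebra
  let _ : Module A N := Module.compHom N φ
  have _ : IsScalarTower A B N := ⟨fun a b n => mul_smul (φ a) b n⟩
  exact IsBaseChange.inductionOn hf n p h0 hm hs ha

/-- If `f` and `g ∘ f` are pullbacks, then so is `g`. -/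
theorem IsPullback.of_comp {φ : A →+* B} {ψ : B →+* C} {f : M →ₛₗ[φ] N} {g : N →ₛₗ[ψ] P}
    (hf : IsPullback φ f) {χ : A →+* C} (hχ : ∀ a, χ a = ψ (φ a)) {h : M →ₛₗ[χ] P}
    (hh : ∀ m, h m = g (f m)) (hp : IsPullback χ h) : IsPullback ψ g := by
  obtain rfl : χ = ψ.comp φ := RingHom.ext hχ
  let _ : Algebra A B := φ.toAlgebra
  let _ : Algebra B C := ψ.toAlgebra
  let _ : Algebra A C := (ψ.comp φ).toAlgebra
  let _ : Module A N := Module.compHom N φ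
  let _ : Module B P := Module.compHom P ψ
  let _ : Module A P := Module.compHom P (ψ.comp φ)
  have _ : IsScalarTower A B C := IsScalarTower.of_algebraMap_eq fun _ => rfl
  have _ : IsScalarTower A B N := ⟨fun a b n => mul_smul (φ a) b n⟩
  have _ : IsScalarTower B C P := ⟨fun a b n => mul_smul (ψ a) b n⟩
  have _ : IsScalarTower A C P := ⟨fun a b n => mul_smul (ψ (φ a)) b n⟩
  have _ : IsScalarTower A B P := ⟨fun a b n => by
    change ψ (φ a * b) • n = ψ (φ a) • ψ b • n
    rw [map_mul, mul_smul]⟩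
  refine IsBaseChange.of_comp (S := B) (T := C) hf (h := {
    toFun := g, map_add' := map_add g, map_smul' := g.map_smulₛₗ }) ?_
  unfold IsPullback at hp
  convert hp using 1
  ext m
  exact (hh m).symm

/-- A retract of a pullback is a pullback. -/
theorem IsPullback.retract [Module.Finite A M] [Module.Projective A M] {φ : A →+* B}
    {M' N' : Type*} [AddCommGroup M'] [Module A M'] [AddCommGroup N'] [Module B N']
    {h : M' →ₛₗ[φ] N'} (hh : IsPullback φ h) {f : M →ₛₗ[φ] N} (i : M →ₗ[A] M') (r : M' →ₗ[A] M)
    (j : N →ₗ[B] N') (s : N' →ₗ[B] N) (hri : ∀ m, r (i m) = m) (hsj : ∀ n, s (j n) = n)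
    (hi : ∀ m, h (i m) = j (f m)) (hs : ∀ m, s (h m) = f (r m)) : IsPullback φ f := by
  obtain ⟨n, x, ξ, hx⟩ := exists_dualBasis A M
  choose η hη using fun k => hh.exists_dual (ξ k ∘ₗ r)
  refine isPullback_of_dualBasis hx (η := fun k => η k ∘ₗ j) (fun k m => ?_) (fun w => ?_)
  · rw [LinearMap.comp_apply, ← hi, hη, LinearMap.comp_apply, hri]
  · have : ∑ k, (η k).smulRight (f (x k)) = s := hh.ext fun m => by
      simp only [LinearMap.sum_apply, LinearMap.smulRight_apply, hη, hs]
      conv_rhs => rw [← hx (r m)]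
      simp [map_sum, f.map_smulₛₗ]
    have h := congr($this (j w))
    rw [hsj] at h
    simpa using h

/-- A pullback along a bijection is bijective. -/
theorem IsPullback.bijective {φ : A →+* B} {f : M →ₛₗ[φ] N} (hf : IsPullback φ f)
    (hφ : Function.Bijective φ) : Function.Bijective f := by
  let e := RingEquiv.ofBijective φ hφ
  have he : ∀ a, e a = φ a := fun _ => rfl
  -- the inverse of `φ` makes `M` the universal target
  let _ : Module B M := Module.compHom M (e.symm : B →+* A)
  have hsm : ∀ (b : B) (m : M), b • m = e.symm b • m := fun _ _ => rfl
  obtain ⟨g, hg⟩ := hf.exists_lift (Q := M)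
    { toFun := fun m => m, map_add' := fun _ _ => rfl, map_smul' := fun a m => by
        rw [hsm, ← he, e.symm_apply_apply] }
  refine ⟨fun m m' h => ?_, fun n => ?_⟩
  · have := congrArg g h
    rwa [hg, hg] at this
  · refine hf.induction (p := fun n => ∃ m, f m = n) ⟨0, map_zero f⟩ (fun m => ⟨m, rfl⟩) ?_ ?_ n
    · rintro b _ ⟨m, rfl⟩
      refine ⟨e.symm b • m, ?_⟩
      rw [f.map_smulₛₗ, ← he, e.apply_symm_apply]
    · rintro _ _ ⟨m, rfl⟩ ⟨m', rfl⟩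
      exact ⟨m + m', map_add f m m'⟩

/-- A bijective semilinear map over a bijection is a pullback. -/
theorem isPullback_of_bijective {φ : A →+* B} (hφ : Function.Bijective φ) {f : M →ₛₗ[φ] N}
    (hf : Function.Bijective f) : IsPullback φ f := by
  let _ : Algebra A B := φ.toAlgebra
  let _ : Module A N := Module.compHom N φ
  have _ : IsScalarTower A B N := ⟨fun a b n => mul_smul (φ a) b n⟩
  let g : M →ₗ[A] N := { toFun := f, map_add' := map_add f, map_smul' := f.map_smulₛₗ }
  let e : B ⊗[A] M →ₗ[B] N := LinearMap.liftBaseChange B g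
  have he : ∀ m, e (1 ⊗ₜ m) = f m := fun m => by simp [e, g]
  have hsurj : ∀ t : B ⊗[A] M, ∃ m, 1 ⊗ₜ[A] m = t := fun t => by
    induction t with
    | zero => exact ⟨0, by simp⟩
    | tmul b m =>
      obtain ⟨a, rfl⟩ := hφ.2 b
      refine ⟨a • m, ?_⟩
      rw [← TensorProduct.smul_tmul]
      congr 1
      change φ a * 1 = _
      rw [mul_one]
    | add s t hs ht =>
      obtain ⟨m, rfl⟩ := hs
      obtain ⟨m', rfl⟩ := ht
      exact ⟨m + m', by rw [TensorProduct.tmul_add]⟩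
  refine IsBaseChange.of_equiv (LinearEquiv.ofBijective e ⟨fun s t h => ?_, fun n => ?_⟩)
    (fun m => he m)
  · obtain ⟨m, rfl⟩ := hsurj s
    obtain ⟨m', rfl⟩ := hsurj t
    rw [he, he] at h
    rw [hf.1 h]
  · obtain ⟨m, rfl⟩ := hf.2 n
    exact ⟨1 ⊗ₜ m, he m⟩

/-- The canonical map `M → B ⊗[A] M` along a ring homomorphism `A → B`. -/
def baseChangeMap (φ : A →+* B) (M : Type*) [AddCommGroup M] [Module A M] :
    letI : Algebra A B := φ.toAlgebra
    M →ₛₗ[φ] B ⊗[A] M :=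
  letI : Algebra A B := φ.toAlgebra
  { toFun := fun m => 1 ⊗ₜ m
    map_add' := fun m m' => TensorProduct.tmul_add _ _ _
    map_smul' := fun a m => TensorProduct.tmul_smul (R := A) a (1 : B) m }

theorem isPullback_of_equiv {φ : A →+* B} {f : M →ₛₗ[φ] N} :
    letI : Algebra A B := φ.toAlgebra
    ∀ (e : B ⊗[A] M ≃ₗ[B] N) (_ : ∀ m, e (1 ⊗ₜ m) = f m), IsPullback φ f := by
  let _ : Algebra A B := φ.toAlgebra
  let _ : Module A N := Module.compHom N φ
  have _ : IsScalarTower A B N := ⟨fun a b n => mul_smul (φ a) b n⟩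
  exact fun e he => IsBaseChange.of_equiv e he

theorem isPullback_baseChangeMap (φ : A →+* B) :
    letI : Algebra A B := φ.toAlgebra
    IsPullback φ (baseChangeMap φ M) :=
  letI : Algebra A B := φ.toAlgebra
  isPullback_of_equiv (LinearEquiv.refl B (B ⊗[A] M)) (fun _ => rfl)

theorem IsPullback.rankAtStalk_eq [Module.Finite A M] [Module.Projective A M] {φ : A →+* B}
    {f : M →ₛₗ[φ] N} (hf : IsPullback φ f) (q : PrimeSpectrum B) :
    Module.rankAtStalk (R := B) N q = Module.rankAtStalk (R := A) M (PrimeSpectrum.comap φ q) := by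
  let _ : Algebra A B := φ.toAlgebra
  let _ : Module A N := Module.compHom N φ
  have _ : IsScalarTower A B N := ⟨fun a b n => mul_smul (φ a) b n⟩
  have hf' : IsBaseChange B ({ toFun := f, map_add' := map_add f, map_smul' := f.map_smulₛₗ } :
    M →ₗ[A] N) := hf
  exact Module.rankAtStalk_isBaseChange (R := A) (S := B) hf' q

/-- Being a pullback can be checked after a faithfully flat base change. -/
theorem IsPullback.of_faithfullyFlat {φ : A →+* B} {ψ : B →+* C} {f : M →ₛₗ[φ] N}
    {g : N →ₛₗ[ψ] P} (hg : IsPullback ψ g) (hψ : ψ.FaithfullyFlat) {χ : A →+* C}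
    (hχ : ∀ a, χ a = ψ (φ a)) {h : M →ₛₗ[χ] P} (hh : ∀ m, h m = g (f m))
    (hp : IsPullback χ h) : IsPullback φ f := by
  obtain rfl : χ = ψ.comp φ := RingHom.ext hχ
  let _ : Algebra A B := φ.toAlgebra
  let _ : Algebra B C := ψ.toAlgebra
  let _ : Module A N := Module.compHom N φ
  let _ : Module B P := Module.compHom P ψ
  have _ : IsScalarTower A B N := ⟨fun a b n => mul_smul (φ a) b n⟩
  have _ : IsScalarTower B C P := ⟨fun a b n => mul_smul (ψ a) b n⟩
  have _ : Module.FaithfullyFlat B C := hψ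
  let f' : M →ₗ[A] N := { toFun := f, map_add' := map_add f, map_smul' := f.map_smulₛₗ }
  let e : B ⊗[A] M →ₗ[B] N := LinearMap.liftBaseChange B f'
  have he : ∀ m, e (1 ⊗ₜ m) = f m := fun m => by simp [e, f']
  let ge : B ⊗[A] M →ₛₗ[ψ] P := g.comp e
  have hge : IsPullback ψ ge :=
    (isPullback_baseChangeMap (M := M) φ).of_comp hχ (h := h)
      (fun m => by change h m = g (e (1 ⊗ₜ m)); rw [he, hh]) hp
  have hb : Function.Bijective (e.lTensor C) := by
    have hg' : IsBaseChange C ({ toFun := g, map_add' := map_add g, map_smul' := g.map_smulₛₗ } :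
      N →ₗ[B] P) := hg
    have hge' : IsBaseChange C (
      { toFun := ge, map_add' := map_add ge, map_smul' := ge.map_smulₛₗ } :
      B ⊗[A] M →ₗ[B] P) := hge
    have hc : ∀ t, hg'.equiv (e.lTensor C t) = hge'.equiv t := fun t => by
      induction t with
      | zero => simp
      | tmul c m =>
        rw [LinearMap.lTensor_tmul, IsBaseChange.equiv_tmul, IsBaseChange.equiv_tmul]
        rfl
      | add s t hs ht => simp only [map_add, hs, ht]
    have : Function.Bijective (hg'.equiv ∘ e.lTensor C) := by
      rw [show hg'.equiv ∘ e.lTensor C = _ from funext hc]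
      exact (hge'.equiv).bijective
    exact (Function.Bijective.of_comp_iff' (hg'.equiv).bijective _).1 this
  have hb' := (Module.FaithfullyFlat.lTensor_bijective_iff_bijective B C e).1 hb
  exact IsBaseChange.of_equiv (LinearEquiv.ofBijective e hb') (fun m => he m)

/-- Faithfully flat pullbacks are injective. -/
theorem IsPullback.injective {φ : A →+* B} {f : M →ₛₗ[φ] N} (hf : IsPullback φ f)
    (hφ : φ.FaithfullyFlat) : Function.Injective f := by
  let _ : Algebra A B := φ.toAlgebra
  let _ : Module A N := Module.compHom N φ
  have _ : IsScalarTower A B N := ⟨fun a b n => mul_smul (φ a) b n⟩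
  have _ : Module.FaithfullyFlat A B := hφ
  intro m m' h
  refine Module.FaithfullyFlat.tensorProduct_mk_injective (A := A) (B := B) M ?_
  have hf' : IsBaseChange B ({ toFun := f, map_add' := map_add f, map_smul' := f.map_smulₛₗ } :
    M →ₗ[A] N) := hf
  refine hf'.equiv.injective ?_
  change hf'.equiv (1 ⊗ₜ m) = hf'.equiv (1 ⊗ₜ m')
  rw [IsBaseChange.equiv_tmul, IsBaseChange.equiv_tmul]
  exact congrArg _ h

end PullbackTools

/-! ### Equivalences of stacks -/

section StackEquivalences

theorem isHomLift_id_of_eq {X : BasedCategory Alg.{u}} {R S : Alg.{u}} (h : R = S) {a b : X.obj}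
    (f : a ⟶ b) (hf : X.p.IsHomLift (𝟙 R) f) : X.p.IsHomLift (𝟙 S) f := by
  subst h
  exact hf

theorem StackEquiv.trans {X Y Z : BasedCategory Alg.{u}} (h₁ : StackEquiv X Y)
    (h₂ : StackEquiv Y Z) : StackEquiv X Z := by
  obtain ⟨F, _, _, hF⟩ := h₁
  obtain ⟨G, _, _, hG⟩ := h₂
  refine ⟨BasedFunctor.comp F G, inferInstanceAs (F.toFunctor ⋙ G.toFunctor).Full,
    inferInstanceAs (F.toFunctor ⋙ G.toFunctor).Faithful, fun z => ?_⟩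
  obtain ⟨y, j, hj⟩ := hG z
  obtain ⟨x, i, hi⟩ := hF y
  refine ⟨x, G.toFunctor.mapIso i ≪≫ j, ?_⟩
  have e : Y.p.obj y = Z.p.obj z :=
    (G.w_obj y).symm.trans (IsHomLift.domain_eq Z.p (𝟙 (Z.p.obj z)) j.hom)
  have h1 : Z.p.IsHomLift (𝟙 (Y.p.obj y)) (G.toFunctor.map i.hom) :=
    BasedFunctor.preserves_isHomLift G _ _
  have h2 := isHomLift_id_of_eq e _ h1
  exact IsHomLift.comp_of_lift_id Z.p _ (G.toFunctor.map i.hom) j.hom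

theorem StackEquiv.symm {X Y : BasedCategory Alg.{u}} (h : StackEquiv X Y) : StackEquiv Y X := by
  obtain ⟨F, _, _, hF⟩ := h
  choose G₀ i hi using hF
  let G : Y.obj ⥤ X.obj :=
    { obj := G₀
      map := fun {y y'} f => F.toFunctor.preimage ((i y).hom ≫ f ≫ (i y').inv)
      map_id := fun y => F.toFunctor.map_injective (by simp)
      map_comp := fun f g => F.toFunctor.map_injective (by simp) }
  have hG : ∀ {y y' : Y.obj} (f : y ⟶ y'),
      F.toFunctor.map (G.map f) = (i y).hom ≫ f ≫ (i y').inv := fun f =>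
    F.toFunctor.map_preimage _
  have hlift : ∀ {y y' : Y.obj} (f : y ⟶ y'), X.p.IsHomLift (Y.p.map f) (G.map f) :=
      fun {y y'} f => by
    rw [← BasedFunctor.isHomLift_iff F]
    rw [hG]
    have := hi y
    have := hi y'
    have h1 : Y.p.IsHomLift (𝟙 (Y.p.obj y')) (i y').inv :=
      IsHomLift.lift_id_inv Y.p _ (i y')
    infer_instance
  refine ⟨⟨G, CategoryTheory.Functor.ext (fun y => ?_) (fun y y' f => ?_)⟩, ⟨fun {y y'} g => ?_⟩,
    ⟨fun {y y' f f'} h => ?_⟩, fun x => ?_⟩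
  · exact (F.w_obj (G₀ y)).symm.trans (IsHomLift.domain_eq Y.p (𝟙 (Y.p.obj y)) (i y).hom)
  · have := hlift f
    exact IsHomLift.fac' X.p (Y.p.map f) (G.map f)
  · refine ⟨(i y).inv ≫ F.toFunctor.map g ≫ (i y').hom, F.toFunctor.map_injective ?_⟩
    change F.toFunctor.map (G.map _) = _
    rw [hG]
    simp
  · have h' : F.toFunctor.map (G.map f) = F.toFunctor.map (G.map f') := congrArg _ h
    rw [hG, hG] at h'
    simpa using h'
  · refine ⟨F.toFunctor.obj x, F.toFunctor.preimageIso (i (F.toFunctor.obj x)), ?_⟩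
    refine isHomLift_id_of_eq (F.w_obj x) _ ?_
    rw [← BasedFunctor.isHomLift_iff F]
    change Y.p.IsHomLift _ (F.toFunctor.map (F.toFunctor.preimage _))
    rw [F.toFunctor.map_preimage]
    exact hi _

end StackEquivalences

/-! ### The algebra of frames -/

section FrameRing

variable {A : Type u} [CommRing A] {n m : ℕ}

/-- The relations `X Y = 1` and `Y X = E` between an `n × m` matrix `X` and an `m × n` matrix `Y` of
indeterminates. -/
def frameRelations (n : ℕ) (E : Matrix (Fin m) (Fin m) A) :
    Set (MvPolynomial ((Fin n × Fin m) ⊕ (Fin m × Fin n)) A) :=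
  Set.range (fun p : Fin n × Fin n => ∑ k, MvPolynomial.X (Sum.inl (p.1, k)) *
      MvPolynomial.X (Sum.inr (k, p.2)) - MvPolynomial.C ((1 : Matrix (Fin n) (Fin n) A) p.1 p.2)) ∪
    Set.range (fun p : Fin m × Fin m => ∑ k, MvPolynomial.X (Sum.inr (p.1, k)) *
      MvPolynomial.X (Sum.inl (k, p.2)) - MvPolynomial.C (E p.1 p.2))

/-- For an idempotent matrix `E`, the algebra representing the isomorphisms between the image of `E`
and the free module of rank `n`. Such an isomorphism is given by matrices `X` and `Y` with
`X Y = 1` and `Y X = E`. -/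
abbrev FrameRing (n : ℕ) (E : Matrix (Fin m) (Fin m) A) : Type u :=
  MvPolynomial ((Fin n × Fin m) ⊕ (Fin m × Fin n)) A ⧸ Ideal.span (frameRelations n E)

namespace FrameRing

variable (n) (E : Matrix (Fin m) (Fin m) A)

/-- The matrix of the universal isomorphism. -/
def X : Matrix (Fin n) (Fin m) (FrameRing n E) :=
  fun i j => Ideal.Quotient.mk _ (MvPolynomial.X (Sum.inl (i, j)))

/-- The matrix of the inverse of the universal isomorphism. -/
def Y : Matrix (Fin m) (Fin n) (FrameRing n E) :=
  fun i j => Ideal.Quotient.mk _ (MvPolynomial.X (Sum.inr (i, j)))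

theorem X_mul_Y : X n E * Y n E = 1 := by
  rw [← sub_eq_zero]
  ext i j
  have h := Ideal.Quotient.eq_zero_iff_mem.2 (Ideal.subset_span (s := frameRelations n E)
    (Or.inl ⟨(i, j), rfl⟩))
  rw [map_sub, map_sum] at h
  simp only [map_mul] at h
  rw [Matrix.sub_apply, Matrix.mul_apply]
  refine Eq.trans (congrArg (_ - ·) ?_) h
  rw [Matrix.one_apply, Matrix.one_apply]
  split_ifs <;> simp

theorem Y_mul_X : Y n E * X n E = E.map (algebraMap A _) := by
  rw [← sub_eq_zero]
  ext i j
  have h := Ideal.Quotient.eq_zero_iff_mem.2 (Ideal.subset_span (s := frameRelations n E)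
    (Or.inr ⟨(i, j), rfl⟩))
  rw [map_sub, map_sum] at h
  simp only [map_mul] at h
  exact h

variable {n E}

theorem exists_lift {C : Type*} [CommRing C] [Algebra A C] (x : Matrix (Fin n) (Fin m) C)
    (y : Matrix (Fin m) (Fin n) C) (h₁ : x * y = 1) (h₂ : y * x = E.map (algebraMap A C)) :
    ∃ f : FrameRing n E →ₐ[A] C, (X n E).map f = x ∧ (Y n E).map f = y := by
  let g : MvPolynomial ((Fin n × Fin m) ⊕ (Fin m × Fin n)) A →ₐ[A] C :=
    MvPolynomial.aeval (Sum.elim (fun p => x p.1 p.2) (fun p => y p.1 p.2))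
  have hg : ∀ p ∈ Ideal.span (frameRelations n E), g p = 0 := fun p hp => by
    have : Ideal.span (frameRelations n E) ≤ RingHom.ker g := by
      rw [Ideal.span_le]
      rintro _ (⟨⟨i, j⟩, rfl⟩ | ⟨⟨i, j⟩, rfl⟩)
      · have : (x * y) i j = algebraMap A C ((1 : Matrix (Fin n) (Fin n) A) i j) := by
          rw [h₁, Matrix.one_apply, Matrix.one_apply]
          split_ifs <;> simp
        rw [Matrix.mul_apply] at this
        simp [g, this]
      · have := congr($h₂ i j)
        rw [Matrix.mul_apply, Matrix.map_apply] at this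
        simp [g, this]
    exact this hp
  refine ⟨Ideal.Quotient.liftₐ _ g hg, ?_, ?_⟩ <;> ext i j
  · change g (MvPolynomial.X (Sum.inl (i, j))) = _
    simp [g]
  · change g (MvPolynomial.X (Sum.inr (i, j))) = _
    simp [g]

/-- A homomorphism out of the algebra of frames is determined by the frame, as the inverse frame is
unique. -/
theorem ringHom_ext {C : Type*} [CommRing C] {f g : FrameRing n E →+* C}
    (h : ∀ a, f (algebraMap A _ a) = g (algebraMap A _ a)) (hX : (X n E).map f = (X n E).map g) :
    f = g := by
  have hY : (Y n E).map f = (Y n E).map g := by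
    have e1 : (X n E).map f * (Y n E).map f = 1 := by
      rw [← Matrix.map_mul, X_mul_Y, Matrix.map_one _ (map_zero f) (map_one f)]
    have e2 : (X n E).map g * (Y n E).map g = 1 := by
      rw [← Matrix.map_mul, X_mul_Y, Matrix.map_one _ (map_zero g) (map_one g)]
    have e3 : (Y n E).map f * (X n E).map f = (Y n E).map g * (X n E).map g := by
      rw [← Matrix.map_mul, ← Matrix.map_mul, Y_mul_X]
      ext i j
      exact h _
    calc (Y n E).map f = (Y n E).map f * ((X n E).map f * (Y n E).map f) := by
          rw [e1, Matrix.mul_one]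
      _ = (Y n E).map g * ((X n E).map g * (Y n E).map f) := by
          rw [← Matrix.mul_assoc, e3, Matrix.mul_assoc]
      _ = (Y n E).map g := by rw [← hX, e1, Matrix.mul_one]
  refine Ideal.Quotient.ringHom_ext (MvPolynomial.ringHom_ext (fun a => h a) ?_)
  rintro (⟨i, j⟩ | ⟨i, j⟩)
  · exact congr($hX i j)
  · exact congr($hY i j)

instance finitePresentation : Algebra.FinitePresentation A (FrameRing n E) := by
  refine Algebra.FinitePresentation.quotient ?_
  refine ⟨(((Set.finite_range _).union (Set.finite_range _) :
    (frameRelations n E).Finite)).toFinset, ?_⟩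
  rw [Set.Finite.coe_toFinset]
  rfl

/-- Frames lift along square zero extensions: lift the matrices `X` and `Y` arbitrarily to `x` and
`y`, and correct the inverse of `x E`. -/
theorem formallySmooth (hE : E * E = E) : Algebra.FormallySmooth A (FrameRing n E) := by
  rw [Algebra.FormallySmooth.iff_comp_surjective]
  intro B _ _ I hI f
  have hI' : ∀ a ∈ I, ∀ b ∈ I, a * b = 0 := fun a ha b hb => by
    have := Ideal.mul_mem_mul ha hb
    rwa [← pow_two, hI, Ideal.mem_bot] at this
  have hN : ∀ {p : ℕ} (N : Matrix (Fin p) (Fin p) B),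
      N.map (Ideal.Quotient.mk I) = 0 → N * N = 0 := fun N h => by
    ext i j
    rw [Matrix.mul_apply, Matrix.zero_apply]
    exact Finset.sum_eq_zero fun k _ => hI' _ (Ideal.Quotient.eq_zero_iff_mem.1 congr($h i k)) _
      (Ideal.Quotient.eq_zero_iff_mem.1 congr($h k j))
  obtain ⟨s, hs⟩ := (Ideal.Quotient.mk_surjective (I := I)).hasRightInverse
  let q := Ideal.Quotient.mk I
  have hsm : ∀ {p r : ℕ} (N : Matrix (Fin p) (Fin r) (B ⧸ I)), (N.map s).map q = N := fun N => by
    ext i j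
    exact hs _
  have hqE : (E.map (algebraMap A B)).map q = E.map (algebraMap A (B ⧸ I)) := by
    ext i j
    rfl
  let e := E.map (algebraMap A B)
  have he : e * e = e := by
    rw [← Matrix.map_mul, hE]
  let x₀ := (X n E).map f
  let y₀ := (Y n E).map f
  have hxy : x₀ * y₀ = 1 := by
    rw [← Matrix.map_mul, X_mul_Y, Matrix.map_one _ (map_zero f) (map_one f)]
  have hyx : y₀ * x₀ = e.map q := by
    rw [← Matrix.map_mul, Y_mul_X, hqE]
    ext i j
    exact f.commutes _
  let x₁ := x₀.map s * e
  let y₁ := e * y₀.map s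
  have hqx : x₁.map q = x₀ := by
    rw [Matrix.map_mul, hsm, ← hyx, ← Matrix.mul_assoc, hxy, Matrix.one_mul]
  have hqy : y₁.map q = y₀ := by
    rw [Matrix.map_mul, hsm, ← hyx, Matrix.mul_assoc, hxy, Matrix.mul_one]
  let d := x₁ * y₁ - 1
  have hqd : d.map q = 0 := by
    rw [Matrix.map_sub _ (map_sub q), Matrix.map_mul, hqx, hqy, hxy,
      Matrix.map_one _ (map_zero q) (map_one q), sub_self]
  have hd : d * d = 0 := hN d hqd
  let y₂ := y₁ * (1 - d)
  have hqy₂ : y₂.map q = y₀ := by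
    rw [Matrix.map_mul, hqy, Matrix.map_sub _ (map_sub q), hqd,
      Matrix.map_one _ (map_zero q) (map_one q), sub_zero, Matrix.mul_one]
  have h₁ : x₁ * y₂ = 1 := by
    have : x₁ * y₁ = 1 + d := by simp only [d]; abel
    rw [← Matrix.mul_assoc, this, Matrix.mul_sub, Matrix.mul_one, Matrix.add_mul, hd,
      Matrix.one_mul, add_zero, add_sub_cancel_right]
  have hxe : x₁ * e = x₁ := by rw [Matrix.mul_assoc, he]
  have hey : e * y₂ = y₂ := by rw [← Matrix.mul_assoc, ← Matrix.mul_assoc, he]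
  have h₂ : y₂ * x₁ = e := by
    let N := e - y₂ * x₁
    have hq : N.map q = 0 := by
      rw [Matrix.map_sub _ (map_sub q), Matrix.map_mul, hqx, hqy₂, hyx, sub_self]
    -- the difference of the commuting idempotents `e` and `y₂ x₁` is idempotent and of square zero
    have : N * N = N := by
      have a1 : e * (y₂ * x₁) = y₂ * x₁ := by rw [← Matrix.mul_assoc, hey]
      have a2 : y₂ * x₁ * e = y₂ * x₁ := by rw [Matrix.mul_assoc, hxe]
      have a3 : y₂ * x₁ * (y₂ * x₁) = y₂ * x₁ := by
        rw [Matrix.mul_assoc, ← Matrix.mul_assoc x₁, h₁, Matrix.one_mul]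
      simp only [N, Matrix.sub_mul, Matrix.mul_sub, he, a1, a2, a3, sub_self, sub_zero]
    rw [hN N hq] at this
    exact (sub_eq_zero.1 this.symm).symm
  obtain ⟨g, hgX, hgY⟩ := exists_lift x₁ y₂ h₁ h₂
  refine ⟨g, AlgHom.coe_ringHom_injective (ringHom_ext (fun a => ?_) ?_)⟩
  · exact (((Ideal.Quotient.mkₐ A I).comp g).commutes a).trans (f.commutes a).symm
  · change ((X n E).map g).map q = x₀
    rw [hgX, hqx]

theorem flat (hE : E * E = E) : Module.Flat A (FrameRing n E) := by
  have := formallySmooth (n := n) hE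
  have : Algebra.Smooth A (FrameRing n E) := {}
  infer_instance

end FrameRing

end FrameRing

/-! ### Frames of locally free sheaves -/

section Frames

variable {A : Type u} [CommRing A] {M : Type u} [AddCommGroup M] [Module A M] {n m : ℕ}
  {x : Fin m → M} {ξ : Fin m → M →ₗ[A] A}

/-- Semilinear maps that agree on the vectors of a dual basis agree. -/
theorem semilinear_ext_of_dualBasis (hx : ∀ v, ∑ i, ξ i v • x i = v) {C : Type*} [CommRing C]
    {N : Type*} [AddCommGroup N] [Module C N] {φ : A →+* C} {h k : M →ₛₗ[φ] N}
    (H : ∀ j, h (x j) = k (x j)) : h = k := by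
  ext v
  rw [← hx v]
  simp [map_sum, LinearMap.map_smulₛₗ, H]

theorem exists_frame_of_matrix (hx : ∀ v, ∑ i, ξ i v • x i = v) {C : Type*} [CommRing C]
    {φ : A →+* C} {X : Matrix (Fin n) (Fin m) C} {Y : Matrix (Fin m) (Fin n) C} (h₁ : X * Y = 1)
    (h₂ : Y * X = Matrix.of fun i j => φ (ξ i (x j))) :
    ∃ h : M →ₛₗ[φ] (Fin n → C), IsPullback φ h ∧ ∀ i j, h (x j) i = X i j := by
  let h : M →ₛₗ[φ] (Fin n → C) :=
    { toFun := fun v => X.mulVec fun k => φ (ξ k v)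
      map_add' := fun v w => by
        rw [← Matrix.mulVec_add]
        congr 1
        ext k
        simp
      map_smul' := fun a v => by
        rw [← Matrix.mulVec_smul]
        congr 1
        ext k
        simp }
  have hh : ∀ v, h v = X.mulVec fun k => φ (ξ k v) := fun _ => rfl
  have hX : X * (Y * X) = X := by rw [← Matrix.mul_assoc, h₁, Matrix.one_mul]
  have hxj : ∀ i j, h (x j) i = X i j := fun i j => by
    conv_rhs => rw [← hX, h₂, Matrix.mul_apply]
    rfl
  have hYX : ∀ v, Y.mulVec (h v) = fun k => φ (ξ k v) := fun v => by
    rw [hh, Matrix.mulVec_mulVec, h₂]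
    ext k
    conv_rhs => rw [← hx v]
    simp [Matrix.mulVec, dotProduct, mul_comm]
  refine ⟨h, isPullback_of_dualBasis hx
    (η := fun k => LinearMap.proj k ∘ₗ Y.mulVecLin) (fun i v => congrFun (hYX v) i)
    (fun w => ?_), hxj⟩
  have : X.mulVec (Y.mulVec w) = w := by rw [Matrix.mulVec_mulVec, h₁, Matrix.one_mulVec]
  conv_rhs => rw [← this]
  ext i
  simp [hxj, Matrix.mulVec, dotProduct, mul_comm]

theorem exists_inverse_of_frame (hx : ∀ v, ∑ i, ξ i v • x i = v) {C : Type*} [CommRing C]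
    {φ : A →+* C} {h : M →ₛₗ[φ] (Fin n → C)} (hh : IsPullback φ h) :
    ∃ Y : Matrix (Fin m) (Fin n) C, (Matrix.of fun i j => h (x j) i) * Y = 1 ∧
      Y * (Matrix.of fun i j => h (x j) i) = Matrix.of fun i j => φ (ξ i (x j)) := by
  choose η hη using fun k => hh.exists_dual (ξ k)
  let Y : Matrix (Fin m) (Fin n) C := Matrix.of fun j i => η j (Pi.single i 1)
  have hY : ∀ w, Y.mulVec w = fun j => η j w := fun w => by
    ext j
    rw [LinearMap.pi_apply_eq_sum_univ (η j) w]
    simp only [Matrix.mulVec, dotProduct, Y, Matrix.of_apply, smul_eq_mul]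
    refine Finset.sum_congr rfl fun i _ => ?_
    rw [mul_comm]
    congr 3
    ext k
    simp [Pi.single_apply, eq_comm]
  refine ⟨Y, ?_, ?_⟩
  · have : ((Matrix.of fun i j => h (x j) i) * Y).mulVecLin = LinearMap.id := hh.ext fun v => by
      rw [Matrix.mulVecLin_apply, ← Matrix.mulVec_mulVec, hY, LinearMap.id_apply]
      conv_rhs => rw [← hx v]
      ext i
      simp [Matrix.mulVec, dotProduct, hη, mul_comm]
    refine Matrix.toLin'.injective ?_
    rw [Matrix.toLin'_one]
    exact this
  · ext i j
    have := congrFun (hY (h (x j))) i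
    rw [hη] at this
    exact this

/-- A module whose rank at the kernel of `φ : A → K` is `n` has a frame over the field `K`. -/
theorem exists_frame_of_field [Module.Finite A M] [Module.Projective A M]
    (hr : ∀ p : PrimeSpectrum A, Module.rankAtStalk (R := A) M p = n) {K : Type*} [Field K]
    (φ : A →+* K) : ∃ h : M →ₛₗ[φ] (Fin n → K), IsPullback φ h := by
  let _ : Algebra A K := φ.toAlgebra
  have h1 := (isPullback_baseChangeMap (M := M) φ).rankAtStalk_eq ⊥
  rw [hr, Module.rankAtStalk_eq_finrank_of_free] at h1
  let e : K ⊗[A] M ≃ₗ[K] (Fin n → K) := LinearEquiv.ofFinrankEq _ _ (by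
    rw [Module.finrank_fin_fun]
    exact h1)
  let h : M →ₛₗ[φ] (Fin n → K) := e.toLinearMap.comp (baseChangeMap φ M)
  exact ⟨h, isPullback_of_equiv e fun v => rfl⟩

/-- The algebra of frames of a locally free sheaf of rank `n`, with its universal frame. -/
theorem exists_universal_frame (A : Type u) [CommRing A] (M : Type u) [AddCommGroup M] [Module A M]
    [Module.Finite A M] [Module.Projective A M] {n : ℕ}
    (hr : ∀ p : PrimeSpectrum A, Module.rankAtStalk (R := A) M p = n) :
    ∃ (m : ℕ) (E : Matrix (Fin m) (Fin m) A)
      (h : M →ₛₗ[algebraMap A (FrameRing n E)] (Fin n → FrameRing n E)),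
      IsPullback (algebraMap A (FrameRing n E)) h ∧
      (algebraMap A (FrameRing n E)).FaithfullyFlat ∧
      (∀ (C : Type u) [CommRing C] (φ : A →+* C) (k : M →ₛₗ[φ] (Fin n → C)), IsPullback φ k →
        ∃ t : FrameRing n E →+* C, t.comp (algebraMap A _) = φ ∧ ∀ v i, k v i = t (h v i)) ∧
      ∀ (C : Type u) [CommRing C] (s t : FrameRing n E →+* C),
        (∀ a, s (algebraMap A _ a) = t (algebraMap A _ a)) → (∀ v i, s (h v i) = t (h v i)) →
        s = t := by
  obtain ⟨m, x, ξ, hx⟩ := exists_dualBasis A M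
  let E : Matrix (Fin m) (Fin m) A := Matrix.of fun i j => ξ i (x j)
  have hE : E * E = E := by
    ext i k
    change _ = ξ i (x k)
    conv_rhs => rw [← hx (x k)]
    simp [E, Matrix.mul_apply, mul_comm]
  obtain ⟨h, hh, hX⟩ := exists_frame_of_matrix (φ := algebraMap A (FrameRing n E)) hx
    (FrameRing.X_mul_Y n E) (FrameRing.Y_mul_X n E)
  have hlift : ∀ (C : Type u) [CommRing C] (φ : A →+* C) (k : M →ₛₗ[φ] (Fin n → C)),
      IsPullback φ k →
      ∃ t : FrameRing n E →+* C, t.comp (algebraMap A _) = φ ∧ ∀ v i, k v i = t (h v i) := by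
    intro C _ φ k hk
    obtain ⟨Y, h₁, h₂⟩ := exists_inverse_of_frame hx hk
    let _ : Algebra A C := φ.toAlgebra
    obtain ⟨t, ht, -⟩ := FrameRing.exists_lift (E := E) _ Y h₁ h₂
    refine ⟨t, RingHom.ext fun a => t.commutes a, ?_⟩
    have hc : ∀ a, t (algebraMap A _ a) = φ a := t.commutes
    let k' : M →ₛₗ[φ] (Fin n → C) :=
      { toFun := fun v i => t (h v i)
        map_add' := fun v w => by ext; simp
        map_smul' := fun a v => by
          ext i
          rw [h.map_smulₛₗ, Pi.smul_apply, smul_eq_mul, map_mul, hc]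
          rfl }
    have : k = k' := semilinear_ext_of_dualBasis hx fun j => by
      ext i
      change _ = t (h (x j) i)
      rw [hX]
      exact congr($ht i j).symm
    intro v i
    rw [this]
    rfl
  refine ⟨m, E, h, hh, ?_, hlift, fun C _ s t h₁ h₂ => FrameRing.ringHom_ext h₁ ?_⟩
  · rw [RingHom.FaithfullyFlat.iff_flat_and_comap_surjective]
    refine ⟨(RingHom.flat_algebraMap_iff).2 (FrameRing.flat hE), fun p => ?_⟩
    obtain ⟨k, hk⟩ := exists_frame_of_field hr (algebraMap A p.asIdeal.ResidueField)
    obtain ⟨t, ht, -⟩ := hlift _ _ k hk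
    refine ⟨PrimeSpectrum.comap t ⊥, ?_⟩
    rw [← PrimeSpectrum.comap_comp_apply, ht]
    ext a
    simp
  · ext i j
    simpa [hX] using h₂ (x j) i

end Frames

/-! ### Faithfully flat descent of scalars -/

section Scalars

/-- Ring homomorphisms between `ℤ[1/2]`-algebras are algebra homomorphisms. -/
def ofRingHom {A B : Alg.{u}} (f : A →+* B) : A ⟶ B :=
  CommAlgCat.ofHom { f with
    commutes' := fun r => by
      have : f.comp (algebraMap BaseRing A) = algebraMap BaseRing B :=
        IsLocalization.ringHom_ext (Submonoid.powers (2 : ℤ)) (Subsingleton.elim _ _)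
      exact congr($this r) }

theorem rh_comp {A B C : Alg.{u}} (f : A ⟶ B) (g : B ⟶ C) (a : A) :
    rh (f ≫ g) a = rh g (rh f a) := rfl

theorem alg_hom_ext {A B : Alg.{u}} {f g : A ⟶ B} (h : ∀ a, rh f a = rh g a) : f = g := by
  ext a
  exact h a

/-- The object of `Alg` given by a ring over an object of `Alg`. -/
def algOver (A : Alg.{u}) (C : Type u) [CommRing C] (φ : A →+* C) : Alg.{u} :=
  letI : Algebra BaseRing C := (φ.comp (algebraMap BaseRing A)).toAlgebra
  CommAlgCat.of BaseRing C

/-- The structure map of `algOver`. -/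
def toAlgOver (A : Alg.{u}) (C : Type u) [CommRing C] (φ : A →+* C) : A ⟶ algOver A C φ :=
  ofRingHom (B := algOver A C φ) φ

/-- The pushout `S ⊗[A] T` of rings. -/
theorem exists_pushout {A S T : Alg.{u}} (φ : A ⟶ S) (ψ : A ⟶ T) :
    ∃ (D : Alg.{u}) (l : S ⟶ D) (r : T ⟶ D), φ ≫ l = ψ ≫ r ∧
      ((rh ψ).FaithfullyFlat → (rh l).FaithfullyFlat) ∧
      ((rh ψ).FinitePresentation → (rh l).FinitePresentation) := by
  let _ : Algebra A S := (rh φ).toAlgebra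
  let _ : Algebra A T := (rh ψ).toAlgebra
  let l : S →+* S ⊗[A] T := Algebra.TensorProduct.includeLeftRingHom
  let r : T →+* S ⊗[A] T := (Algebra.TensorProduct.includeRight (R := A)).toRingHom
  have hl : l = algebraMap S (S ⊗[A] T) := rfl
  refine ⟨algOver S (S ⊗[A] T) l, toAlgOver _ _ l, ofRingHom (B := algOver S (S ⊗[A] T) l) r,
    alg_hom_ext fun a => ?_, fun h => ?_, fun h => ?_⟩
  · change l (algebraMap A S a) = r (algebraMap A T a)
    change (algebraMap A S a) ⊗ₜ[A] (1 : T) = (1 : S) ⊗ₜ[A] (algebraMap A T a)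
    rw [Algebra.algebraMap_eq_smul_one, Algebra.algebraMap_eq_smul_one, TensorProduct.smul_tmul]
  · have : Module.FaithfullyFlat A T := h
    exact (RingHom.faithfullyFlat_algebraMap_iff (R := S) (S := S ⊗[A] T)).2 inferInstance
  · have : Algebra.FinitePresentation A T := h
    exact (RingHom.finitePresentation_algebraMap (A := S) (B := S ⊗[A] T)).2 inferInstance

/-- Faithfully flat descent of functions: `A` is the equalizer of `S ⇉ S ⊗[A] S`. -/
theorem exists_of_forall_eq {A S : Alg.{u}} (φ : A ⟶ S) (hφ : (rh φ).FaithfullyFlat) (s : S)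
    (hs : ∀ (C : Alg.{u}) (p q : S ⟶ C), φ ≫ p = φ ≫ q → rh p s = rh q s) :
    ∃ a, rh φ a = s := by
  let _ : Algebra A S := (rh φ).toAlgebra
  have : Module.FaithfullyFlat A S := hφ
  let l : S →+* S ⊗[A] S := Algebra.TensorProduct.includeLeftRingHom
  let r : S →+* S ⊗[A] S := (Algebra.TensorProduct.includeRight (R := A)).toRingHom
  have h := hs (algOver S (S ⊗[A] S) l) (toAlgOver _ _ l)
    (ofRingHom (B := algOver S (S ⊗[A] S) l) r) (alg_hom_ext fun a => by
      change (algebraMap A S a) ⊗ₜ[A] (1 : S) = (1 : S) ⊗ₜ[A] (algebraMap A S a)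
      rw [Algebra.algebraMap_eq_smul_one, TensorProduct.smul_tmul])
  change s ⊗ₜ[A] (1 : S) = (1 : S) ⊗ₜ[A] s at h
  refine ((Algebra.IsEffective.of_faithfullyFlat A S) s).1 ?_
  rw [Algebra.TensorProduct.includeLeftSubRight_apply, h, sub_self]

end Scalars

/-! ### Vectors and linear groups -/

section Vectors

variable {n : ℕ}

/-- The linear action of `GLₙ` on column vectors. -/
def glAct {C : Type*} [CommRing C] (g : Matrix.GeneralLinearGroup (Fin n) C) :
    (Fin n → C) →ₗ[C] (Fin n → C) :=
  Matrix.mulVecLin g.val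

theorem glAct_one {C : Type*} [CommRing C] (v : Fin n → C) :
    glAct (1 : Matrix.GeneralLinearGroup (Fin n) C) v = v := by
  simp [glAct]

theorem glAct_mul {C : Type*} [CommRing C] (g h : Matrix.GeneralLinearGroup (Fin n) C)
    (v : Fin n → C) : glAct (g * h) v = glAct g (glAct h v) := by
  simp [glAct]

theorem glAct_injective {C : Type*} [CommRing C] {g h : Matrix.GeneralLinearGroup (Fin n) C}
    (H : ∀ v, glAct g v = glAct h v) : g = h := by
  refine Units.ext (Matrix.toLin'.injective (LinearMap.ext H))

theorem glAct_bijective {C : Type*} [CommRing C] (g : Matrix.GeneralLinearGroup (Fin n) C) :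
    Function.Bijective (glAct g) := by
  refine Function.bijective_iff_has_inverse.2 ⟨glAct g⁻¹, fun v => ?_, fun v => ?_⟩
  · rw [← glAct_mul, inv_mul_cancel, glAct_one]
  · rw [← glAct_mul, mul_inv_cancel, glAct_one]

/-- Two frames differ by a unique element of `GLₙ`. -/
theorem existsUnique_glAct {A C M : Type*} [CommRing A] [CommRing C] [AddCommGroup M] [Module A M]
    {φ : A →+* C} {h k : M →ₛₗ[φ] (Fin n → C)} (hh : IsPullback φ h) (hk : IsPullback φ k) :
    ∃! g : Matrix.GeneralLinearGroup (Fin n) C, ∀ v, k v = glAct g (h v) := by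
  obtain ⟨a, ha⟩ := hh.exists_lift k
  obtain ⟨b, hb⟩ := hk.exists_lift h
  have hab : a ∘ₗ b = LinearMap.id := hk.ext fun v => by simp [ha, hb]
  have hba : b ∘ₗ a = LinearMap.id := hh.ext fun v => by simp [ha, hb]
  refine ⟨⟨LinearMap.toMatrix' a, LinearMap.toMatrix' b, ?_, ?_⟩, fun v => ?_, fun g hg => ?_⟩
  · rw [← LinearMap.toMatrix'_comp, hab, LinearMap.toMatrix'_id]
  · rw [← LinearMap.toMatrix'_comp, hba, LinearMap.toMatrix'_id]
  · change k v = (LinearMap.toMatrix' a).mulVec (h v)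
    rw [← ha, ← Matrix.toLin'_apply, Matrix.toLin'_toMatrix']
  · refine glAct_injective fun w => ?_
    change _ = (LinearMap.toMatrix' a).mulVec w
    rw [← Matrix.toLin'_apply, Matrix.toLin'_toMatrix']
    have : glAct g = a := hh.ext fun v => by rw [← hg, ha]
    rw [this]

theorem IsPullback.glAct {A C M : Type*} [CommRing A] [CommRing C] [AddCommGroup M] [Module A M]
    {φ : A →+* C} {h : M →ₛₗ[φ] (Fin n → C)} (hh : IsPullback φ h)
    (g : Matrix.GeneralLinearGroup (Fin n) C) : IsPullback φ ((GCovers.glAct g).comp h) :=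
  hh.comp (isPullback_of_bijective Function.bijective_id (glAct_bijective g)) (fun _ => rfl) _
    (fun _ => rfl)

/-- Base change of column vectors. -/
def mapVec {A B : Alg.{u}} (n : ℕ) (t : A ⟶ B) : (Fin n → A) →ₛₗ[rh t] (Fin n → B) where
  toFun v i := rh t (v i)
  map_add' v w := by ext; simp
  map_smul' a v := by ext; simp

@[simp] theorem mapVec_apply {A B : Alg.{u}} (t : A ⟶ B) (v : Fin n → A) (i : Fin n) :
    mapVec n t v i = rh t (v i) := rfl

theorem pi_sum_single {C : Type*} [CommRing C] (v : Fin n → C) :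
    ∑ i, v i • (Pi.single i 1 : Fin n → C) = v := by
  ext j
  simp [Pi.single_apply]

theorem isPullback_mapVec {A B : Alg.{u}} (t : A ⟶ B) : IsPullback (rh t) (mapVec n t) := by
  refine isPullback_of_dualBasis (x := fun i => Pi.single i 1) (ξ := fun i => LinearMap.proj i)
    (fun v => pi_sum_single v) (η := fun i => LinearMap.proj i) (fun i v => rfl) (fun w => ?_)
  have : ∀ i, mapVec n t (Pi.single i 1) = Pi.single i 1 := fun i => by
    ext j
    by_cases h : j = i <;> simp [Pi.single_apply, h]
  simp only [this]
  exact pi_sum_single w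

theorem mapVec_glAct {A B : Alg.{u}} (t : A ⟶ B) (g : Matrix.GeneralLinearGroup (Fin n) A)
    (v : Fin n → A) : mapVec n t (glAct g v) =
      glAct (Matrix.GeneralLinearGroup.map (rh t) g) (mapVec n t v) := by
  ext i
  simp [glAct, Matrix.mulVec, dotProduct]

theorem mapVec_comp {A B C : Alg.{u}} (s : A ⟶ B) (t : B ⟶ C) (v : Fin n → A) :
    mapVec n (s ≫ t) v = mapVec n t (mapVec n s v) := rfl

/-- An isomorphism of a group functor with `GLₙ`. -/
structure LinearStructure (n : ℕ) (G : Alg.{u} ⥤ GrpCat.{u}) where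
  equiv : ∀ C : Alg.{u}, G.obj C ≃* Matrix.GeneralLinearGroup (Fin n) C
  natural : ∀ {C D : Alg.{u}} (ψ : C ⟶ D) (g : G.obj C),
    equiv D (G.map ψ g) = Matrix.GeneralLinearGroup.map (rh ψ) (equiv C g)

namespace LinearStructure

variable {G : Alg.{u} ⥤ GrpCat.{u}} (e : LinearStructure n G)

/-- The action of `G ≃ GLₙ` on column vectors. -/
def act {C : Alg.{u}} (g : G.obj C) : (Fin n → C) →ₗ[C] (Fin n → C) := glAct (e.equiv C g)

theorem one_act {C : Alg.{u}} (v : Fin n → C) : e.act (1 : G.obj C) v = v := by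
  rw [act, map_one, glAct_one]

theorem mul_act {C : Alg.{u}} (g h : G.obj C) (v : Fin n → C) :
    e.act (g * h) v = e.act g (e.act h v) := by
  rw [act, map_mul, glAct_mul]
  rfl

theorem map_act {C D : Alg.{u}} (ψ : C ⟶ D) (g : G.obj C) (v : Fin n → C) :
    mapVec n ψ (e.act g v) = e.act (G.map ψ g) (mapVec n ψ v) := by
  rw [act, mapVec_glAct, ← e.natural]
  rfl

theorem existsUnique_act {A : Type*} [CommRing A] {C : Alg.{u}} {M : Type*} [AddCommGroup M]
    [Module A M] {φ : A →+* C} {h k : M →ₛₗ[φ] (Fin n → C)} (hh : IsPullback φ h)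
    (hk : IsPullback φ k) : ∃! g : G.obj C, ∀ v, k v = e.act g (h v) := by
  obtain ⟨g, hg, hu⟩ := existsUnique_glAct hh hk
  refine ⟨(e.equiv C).symm g, fun v => ?_, fun g' hg' => ?_⟩
  · rw [act, MulEquiv.apply_symm_apply, hg]
  · rw [← hu _ hg', MulEquiv.symm_apply_apply]

end LinearStructure

end Vectors

/-! ### Bundles and their frames -/

/-- The objects of the stack of locally free sheaves of rank `n`. -/
structure Bundle (n : ℕ) where
  base : Alg.{u}
  F : Type u
  [addCommGroupF : AddCommGroup F]
  [moduleF : Module base F]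
  [finiteF : Module.Finite base F]
  [projectiveF : Module.Projective base F]
  rankF : ∀ p : PrimeSpectrum base, Module.rankAtStalk (R := base) F p = n

namespace Bundle

attribute [instance] addCommGroupF moduleF finiteF projectiveF

variable {n : ℕ}

/-- Arrows of the stack of locally free sheaves of rank `n`. -/
@[ext]
structure Hom (E E' : Bundle.{u} n) where
  base : E.base ⟶ E'.base
  mapF : E.F →ₛₗ[rh base] E'.F
  pullbackF : IsPullback (rh base) mapF

instance : Category (Bundle.{u} n) where
  Hom := Hom
  id E :=
    { base := 𝟙 _
      mapF := idS _ _
      pullbackF := isPullback_idS _ _ }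
  comp f g :=
    { base := f.base ≫ g.base
      mapF := compS g.mapF f.mapF
      pullbackF := g.pullbackF.compS f.pullbackF }
  id_comp _ := rfl
  comp_id _ := rfl
  assoc _ _ _ := rfl

/-- The structure functor. -/
def proj : Bundle.{u} n ⥤ Alg.{u} where
  obj E := E.base
  map f := f.base

theorem hom_ext {E E' : Bundle.{u} n} {f g : E ⟶ E'} (h : Hom.base f = Hom.base g)
    (h' : ∀ v, Hom.mapF f v = Hom.mapF g v) : f = g := by
  obtain ⟨b, m, p⟩ := f
  obtain ⟨b', m', p'⟩ := g
  obtain rfl : b = b' := h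
  obtain rfl : m = m' := LinearMap.ext h'
  rfl

/-- The space of frames of a bundle, with the universal frame. -/
structure FrameSpace (E : Bundle.{u} n) where
  total : Alg.{u}
  proj : E.base ⟶ total
  frame : E.F →ₛₗ[rh proj] (Fin n → total)
  isPullback : IsPullback (rh proj) frame
  faithfullyFlat : (rh proj).FaithfullyFlat
  finitePresentation : (rh proj).FinitePresentation
  exists_lift : ∀ (C : Alg.{u}) (φ : E.base ⟶ C) (k : E.F →ₛₗ[rh φ] (Fin n → C)),
    IsPullback (rh φ) k → ∃ t : total ⟶ C, proj ≫ t = φ ∧ ∀ v, k v = mapVec n t (frame v)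
  hom_ext : ∀ (C : Alg.{u}) (s t : total ⟶ C), proj ≫ s = proj ≫ t →
    (∀ v, mapVec n s (frame v) = mapVec n t (frame v)) → s = t

theorem nonempty_frameSpace (E : Bundle.{u} n) : Nonempty E.FrameSpace := by
  obtain ⟨m, M, h, hh, hf, hl, hu⟩ := exists_universal_frame E.base E.F E.rankF
  let T : Alg.{u} := CommAlgCat.of BaseRing (FrameRing n M)
  exact ⟨{
    total := T
    proj := ofRingHom (B := T) (algebraMap E.base (FrameRing n M))
    frame := h
    isPullback := hh
    faithfullyFlat := hf
    finitePresentation :=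
      (RingHom.finitePresentation_algebraMap (A := E.base) (B := FrameRing n M)).2 inferInstance
    exists_lift := fun C φ k hk => by
      obtain ⟨t, ht, ht'⟩ := hl C (rh φ) k hk
      exact ⟨ofRingHom (A := T) t, alg_hom_ext fun a => congr($ht a), fun v => funext (ht' v)⟩
    hom_ext := fun C s t h₁ h₂ => by
      have := hu C (rh s) (rh t) (fun a => congr(rh $h₁ a)) (fun v i => congr($(h₂ v) i))
      exact alg_hom_ext fun a => congr($this a) }⟩

/-- A choice of the space of frames. -/
def frames (E : Bundle.{u} n) : E.FrameSpace := Classical.choice E.nonempty_frameSpace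

/-- The frame of a point of the space of frames. -/
def frameAt (E : Bundle.{u} n) {C : Alg.{u}} (t : E.frames.total ⟶ C) :
    E.F →ₛₗ[rh (E.frames.proj ≫ t)] (Fin n → C) :=
  compS (mapVec n t) E.frames.frame

theorem frameAt_apply (E : Bundle.{u} n) {C : Alg.{u}} (t : E.frames.total ⟶ C) (v : E.F) :
    E.frameAt t v = mapVec n t (E.frames.frame v) := rfl

theorem isPullback_frameAt (E : Bundle.{u} n) {C : Alg.{u}} (t : E.frames.total ⟶ C) :
    IsPullback (rh (E.frames.proj ≫ t)) (E.frameAt t) :=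
  (isPullback_mapVec t).compS E.frames.isPullback

end Bundle

/-! ### Torsors of frames -/

namespace QuotientObj

variable {G : Alg.{u} ⥤ GrpCat.{u}} {X : Alg.{u} ⥤ Type u} {ρ : GAction G X}

/-- The underlying torsor of an object of `[X/G]`. -/
def torsor (P : QuotientObj ρ) : QuotientObj (trivialAction G) where
  base := P.base
  total := P.total
  proj := P.proj
  faithfullyFlat := P.faithfullyFlat
  finitePresentation := P.finitePresentation
  action := P.action
  proj_act := P.proj_act
  simply_transitive := P.simply_transitive
  toSpace := { app := fun _ => TypeCat.ofHom fun _ => PUnit.unit }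
  equivariant _ _ _ := rfl

/-- The map of torsors underlying an arrow of `[X/G]`. -/
def Hom.torsor {P Q : QuotientObj ρ} (f : Hom P Q) : P.torsor ⟶ Q.torsor :=
  show Hom P.torsor Q.torsor from
  { base := f.base
    total := f.total
    comm := f.comm
    map_act := f.map_act
    map_toSpace := fun _ _ => rfl }

theorem act_injective (P : QuotientObj ρ) {C : Alg.{u}} {g h : G.obj C} {p : P.total ⟶ C}
    (H : P.action.act C g p = P.action.act C h p) : g = h :=
  (P.simply_transitive C p (P.action.act C h p) (P.proj_act C h p).symm).unique H rfl

theorem act_natural (P : QuotientObj ρ) {C D : Alg.{u}} (ψ : C ⟶ D) (g : G.obj C)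
    (p : P.total ⟶ C) : (P.action.act C g p : P.total ⟶ C) ≫ ψ =
      P.action.act D (G.map ψ g) (p ≫ ψ) :=
  P.action.natural ψ g p

/-- The total space of the source of an arrow over an isomorphism of bases has the same points as
that of the target: locally a point of the source lifts, because both are torsors, and the lifts
glue by uniqueness. -/
theorem Hom.exists_lift {P Q : QuotientObj ρ} (f : Hom P Q) [IsIso f.base] {C : Alg.{u}}
    (p : P.total ⟶ C) : ∃ q : Q.total ⟶ C, f.total ≫ q = p := by
  have hinj : ∀ (D : Alg.{u}) (q q' : Q.total ⟶ D), f.total ≫ q = f.total ≫ q' → q = q' := by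
    intro D q q' h
    have h1 : Q.proj ≫ q = Q.proj ≫ q' := by
      have h2 := congrArg (P.proj ≫ ·) h
      simp only [← Category.assoc, f.comm] at h2
      simp only [Category.assoc] at h2
      exact (cancel_epi f.base).1 h2
    obtain ⟨g, hg, -⟩ := Q.simply_transitive D q q' h1
    have h3 : P.action.act D g (f.total ≫ q) = P.action.act D 1 (f.total ≫ q) := by
      rw [← f.map_act, hg, ← h]
      exact (P.action.one_act D _).symm
    rw [act_injective P h3] at hg
    rw [← hg]
    exact (Q.action.one_act D _).symm
  -- pass to the faithfully flat cover of `C` on which `Q` has a point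
  obtain ⟨D, l, r, hlr, hff, -⟩ := exists_pushout (inv f.base ≫ P.proj ≫ p) Q.proj
  have hl := hff Q.faithfullyFlat
  have hb : P.proj ≫ f.total ≫ r = P.proj ≫ p ≫ l := by
    rw [← Category.assoc, f.comm, Category.assoc, ← hlr]
    simp
  obtain ⟨g, hg, -⟩ := P.simply_transitive D (f.total ≫ r) (p ≫ l) hb
  let q : Q.total ⟶ D := Q.action.act D g r
  have hq : f.total ≫ q = p ≫ l := by rw [f.map_act, hg]
  have hdesc : ∀ x, ∃ c, rh l c = rh q x := fun x => by
    refine exists_of_forall_eq l hl _ fun D' s t hst => ?_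
    have : q ≫ s = q ≫ t := hinj D' _ _ (by
      rw [← Category.assoc, ← Category.assoc, hq, Category.assoc, Category.assoc, hst])
    exact congr(rh $this x)
  choose k hk using hdesc
  have hli := hl.injective
  let q' : Q.total →+* C :=
    { toFun := k
      map_one' := hli (by rw [hk, map_one, map_one])
      map_mul' := fun x y => hli (by rw [hk, map_mul, map_mul, hk, hk])
      map_zero' := hli (by rw [hk, map_zero, map_zero])
      map_add' := fun x y => hli (by rw [hk, map_add, map_add, hk, hk]) }
  refine ⟨ofRingHom q', alg_hom_ext fun x => hli ?_⟩
  rw [rh_comp]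
  exact (hk _).trans congr(rh $hq x)

/-- An arrow of `[X/G]` over an isomorphism is an isomorphism. -/
theorem Hom.isIso {P Q : QuotientObj ρ} (f : P ⟶ Q) (hf : IsIso (Hom.base f)) : IsIso f := by
  obtain ⟨s, hs⟩ := Hom.exists_lift f (𝟙 _)
  have hs' : s ≫ Hom.total f = 𝟙 _ := by
    -- `Q.total → P.total → Q.total` is the identity because points of `Q` inject into those of `P`
    obtain ⟨g, hg, -⟩ := Q.simply_transitive Q.total (s ≫ Hom.total f) (𝟙 _) (by
      rw [Category.comp_id]
      refine (cancel_epi (Hom.base f)).1 ?_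
      rw [← Category.assoc, ← Category.assoc, ← Hom.comm f, Category.assoc P.proj, hs,
        Category.comp_id])
    have h3 : P.action.act _ g (Hom.total f ≫ s ≫ Hom.total f) =
        P.action.act _ 1 (Hom.total f ≫ s ≫ Hom.total f) := by
      rw [← Hom.map_act f, hg, ← Category.assoc, hs]
      exact (Category.comp_id _).trans
        ((Category.id_comp _).symm.trans (P.action.one_act _ _).symm)
    rw [act_injective P h3] at hg
    rw [← hg]
    exact (Q.action.one_act _ _).symm
  let r : Hom Q P :=
    { base := inv (Hom.base f)
      total := s
      comm := by
        refine (cancel_epi (Hom.base f)).1 ?_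
        rw [← Category.assoc, ← Hom.comm f, Category.assoc, hs]
        simp
      map_act := fun C g p => by
        have h : Hom.total f ≫ (s ≫ (P.action.act C g p : P.total ⟶ C)) =
            Hom.total f ≫ (Q.action.act C g (s ≫ p) : Q.total ⟶ C) := by
          rw [Hom.map_act f, ← Category.assoc, hs, Category.id_comp, ← Category.assoc, hs]
          exact congrArg _ (Category.id_comp p).symm
        have := congrArg (s ≫ ·) h
        simpa only [← Category.assoc, hs', Category.id_comp] using this
      map_toSpace := fun C p => by
        rw [← Hom.map_toSpace f, ← Category.assoc, hs, Category.id_comp] }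
  exact ⟨r, Hom.ext (IsIso.hom_inv_id (Hom.base f)) hs, Hom.ext (IsIso.inv_hom_id (Hom.base f)) hs'⟩

end QuotientObj

namespace Bundle

variable {n : ℕ} {G : Alg.{u} ⥤ GrpCat.{u}} (e : LinearStructure n G) (E : Bundle.{u} n)

theorem exists_act {C : Alg.{u}} (g : G.obj C) (p : E.frames.total ⟶ C) :
    ∃ q : E.frames.total ⟶ C, E.frames.proj ≫ q = E.frames.proj ≫ p ∧
      ∀ v, mapVec n q (E.frames.frame v) = e.act g (mapVec n p (E.frames.frame v)) := by
  obtain ⟨q, h₁, h₂⟩ := E.frames.exists_lift C _ _ ((E.isPullback_frameAt p).glAct (e.equiv C g))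
  exact ⟨q, h₁, fun v => (h₂ v).symm⟩

/-- The action of `G ≃ GLₙ` on frames. -/
def frameAction : GAction G (coyoneda.obj (Opposite.op E.frames.total)) where
  act C g p := (E.exists_act e g p).choose
  one_act C p := E.frames.hom_ext C _ _ (E.exists_act e 1 p).choose_spec.1 fun v => by
    rw [(E.exists_act e 1 p).choose_spec.2, e.one_act]
  mul_act C g h p := E.frames.hom_ext C _ _
    ((E.exists_act e (g * h) p).choose_spec.1.trans
      ((E.exists_act e g _).choose_spec.1.trans (E.exists_act e h p).choose_spec.1).symm)
    fun v => by
      rw [(E.exists_act e (g * h) p).choose_spec.2, (E.exists_act e g _).choose_spec.2,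
        (E.exists_act e h p).choose_spec.2, e.mul_act]
  natural {C D} ψ g p := by
    refine E.frames.hom_ext D ((E.exists_act e g p).choose ≫ ψ) _ ?_ fun v => ?_
    · rw [← Category.assoc, (E.exists_act e g p).choose_spec.1,
        (E.exists_act e (G.map ψ g) (p ≫ ψ)).choose_spec.1, Category.assoc]
    · rw [mapVec_comp, (E.exists_act e g p).choose_spec.2,
        (E.exists_act e (G.map ψ g) (p ≫ ψ)).choose_spec.2, e.map_act, mapVec_comp]

theorem proj_frameAction {C : Alg.{u}} (g : G.obj C) (p : E.frames.total ⟶ C) :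
    E.frames.proj ≫ (E.frameAction e).act C g p = E.frames.proj ≫ p :=
  (E.exists_act e g p).choose_spec.1

theorem mapVec_frameAction {C : Alg.{u}} (g : G.obj C) (p : E.frames.total ⟶ C) (v : E.F) :
    mapVec n ((E.frameAction e).act C g p : E.frames.total ⟶ C) (E.frames.frame v) =
      e.act g (mapVec n p (E.frames.frame v)) :=
  (E.exists_act e g p).choose_spec.2 v

theorem frameAction_simply_transitive (C : Alg.{u}) (p q : E.frames.total ⟶ C)
    (h : E.frames.proj ≫ p = E.frames.proj ≫ q) :
    ∃! g : G.obj C, (E.frameAction e).act C g p = q := by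
  let k : E.F →ₛₗ[rh (E.frames.proj ≫ p)] (Fin n → C) :=
    { toFun := E.frameAt q
      map_add' := map_add _
      map_smul' := fun a v => by rw [h]; exact (E.frameAt q).map_smulₛₗ a v }
  have hk : IsPullback (rh (E.frames.proj ≫ p)) k :=
    (isPullback_id (LinearMap.id : E.F →ₗ[E.base] E.F) fun _ => rfl).comp
      (E.isPullback_frameAt q) (fun a => congr(rh $h a)) _ (fun _ => rfl)
  obtain ⟨g, hg, hu⟩ := e.existsUnique_act (E.isPullback_frameAt p) hk
  refine ⟨g, E.frames.hom_ext C _ _ ((E.proj_frameAction e g p).trans h) fun v => ?_,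
    fun g' hg' => hu g' fun v => ?_⟩
  · rw [E.mapVec_frameAction e g p]
    exact (hg v).symm
  · subst hg'
    exact E.mapVec_frameAction e g' p v

variable {X : Alg.{u} ⥤ Type u} {ρ : GAction G X}

/-- The object of `[X/G]` given by the frames of a bundle and an equivariant map. -/
def frameObj (s : coyoneda.obj (Opposite.op E.frames.total) ⟶ X)
    (hs : ∀ (C : Alg.{u}) (g : G.obj C) (p : E.frames.total ⟶ C),
      s.app C ((E.frameAction e).act C g p) = ρ.act C g (s.app C p)) : QuotientObj ρ where
  base := E.base
  total := E.frames.total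
  proj := E.frames.proj
  faithfullyFlat := E.frames.faithfullyFlat
  finitePresentation := E.frames.finitePresentation
  action := E.frameAction e
  proj_act _ g p := E.proj_frameAction e g p
  simply_transitive := E.frameAction_simply_transitive e
  toSpace := s
  equivariant := hs

variable {E} {E' : Bundle.{u} n}

theorem exists_mapTotal (f : E ⟶ E') : ∃ t : E.frames.total ⟶ E'.frames.total,
    E.frames.proj ≫ t = Hom.base f ≫ E'.frames.proj ∧
      ∀ v, mapVec n t (E.frames.frame v) = E'.frames.frame (Hom.mapF f v) := by
  obtain ⟨t, h₁, h₂⟩ := E.frames.exists_lift _ (Hom.base f ≫ E'.frames.proj)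
    (compS E'.frames.frame (Hom.mapF f)) (E'.frames.isPullback.compS (Hom.pullbackF f))
  exact ⟨t, h₁, fun v => (h₂ v).symm⟩

/-- The map between spaces of frames induced by an arrow of bundles. -/
def mapTotal (f : E ⟶ E') : E.frames.total ⟶ E'.frames.total := (exists_mapTotal f).choose

theorem proj_mapTotal (f : E ⟶ E') :
    E.frames.proj ≫ mapTotal f = Hom.base f ≫ E'.frames.proj := (exists_mapTotal f).choose_spec.1

theorem mapVec_mapTotal (f : E ⟶ E') (v : E.F) :
    mapVec n (mapTotal f) (E.frames.frame v) = E'.frames.frame (Hom.mapF f v) :=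
  (exists_mapTotal f).choose_spec.2 v

theorem mapTotal_act (f : E ⟶ E') (C : Alg.{u}) (g : G.obj C) (q : E'.frames.total ⟶ C) :
    mapTotal f ≫ ((E'.frameAction e).act C g q : E'.frames.total ⟶ C) =
      (E.frameAction e).act C g (mapTotal f ≫ q) := by
  refine E.frames.hom_ext C _ _ ?_ fun v => ?_
  · rw [proj_frameAction, ← Category.assoc, ← Category.assoc, proj_mapTotal, Category.assoc,
      Category.assoc, proj_frameAction]
  · rw [mapVec_frameAction, mapVec_comp, mapVec_comp, mapVec_mapTotal, mapVec_frameAction]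

theorem mapTotal_id : mapTotal (𝟙 E) = 𝟙 _ :=
  E.frames.hom_ext _ _ _ ((proj_mapTotal (𝟙 E)).trans (by
    rw [Category.comp_id]; exact Category.id_comp _)) fun v => mapVec_mapTotal (𝟙 E) v

theorem mapTotal_comp {E'' : Bundle.{u} n} (f : E ⟶ E') (g : E' ⟶ E'') :
    mapTotal (f ≫ g) = mapTotal f ≫ mapTotal g := by
  refine E.frames.hom_ext _ _ _ ?_ fun v => ?_
  · rw [proj_mapTotal, ← Category.assoc, proj_mapTotal, Category.assoc, proj_mapTotal,
      ← Category.assoc]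
    rfl
  · rw [mapVec_mapTotal, mapVec_comp, mapVec_mapTotal, mapVec_mapTotal]
    rfl

/-- The functor of frames, from bundles to torsors. -/
def frameFunctor : Bundle.{u} n ⥤ QuotientObj (trivialAction G) where
  obj E := E.frameObj e { app := fun _ => TypeCat.ofHom fun _ => PUnit.unit } fun _ _ _ => rfl
  map {E E'} f :=
    { base := Hom.base f
      total := mapTotal f
      comm := proj_mapTotal f
      map_act := mapTotal_act e f
      map_toSpace := fun _ _ => rfl }
  map_id E := QuotientObj.Hom.ext rfl mapTotal_id
  map_comp f g := QuotientObj.Hom.ext rfl (mapTotal_comp f g)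

/-- Descent of vectors: a vector that transforms like the coordinates of a vector of the bundle
comes from the bundle. The coordinates in a dual basis are functions that descend. -/
theorem exists_of_equivariant (E : Bundle.{u} n) (w : Fin n → E.frames.total)
    (hw : ∀ (C : Alg.{u}) (g : G.obj C) (p : E.frames.total ⟶ C),
      mapVec n ((E.frameAction e).act C g p : E.frames.total ⟶ C) w = e.act g (mapVec n p w)) :
    ∃ v, E.frames.frame v = w := by
  obtain ⟨m, x, ξ, hx⟩ := exists_dualBasis E.base E.F
  choose η hη using fun i => E.frames.isPullback.exists_dual (ξ i)
  have hd : ∀ i, ∃ a, rh E.frames.proj a = η i w := fun i => by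
    refine exists_of_forall_eq _ E.frames.faithfullyFlat _ fun C p q hpq => ?_
    -- extensions of the functional `η i` along points
    have hext : ∀ r : E.frames.total ⟶ C, ∃ θ : (Fin n → C) →ₗ[C] C,
        ∀ v, θ (mapVec n r v) = rh r (η i v) := fun r => (isPullback_mapVec r).exists_dual (η i)
    obtain ⟨θ, hθ⟩ := hext p
    obtain ⟨τ, hτ⟩ := hext q
    obtain ⟨g, hg, -⟩ := E.frameAction_simply_transitive e C p q hpq
    have h1 : τ ∘ₗ e.act g = θ := (E.isPullback_frameAt p).ext fun v => by
      rw [LinearMap.comp_apply, frameAt_apply, ← mapVec_frameAction, hg, hτ, hθ, hη]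
      exact congr(rh $hpq.symm (ξ i v))
    rw [← hθ, ← hτ, ← h1, LinearMap.comp_apply, ← hw, hg]
  choose c hc using hd
  refine ⟨∑ i, c i • x i, ?_⟩
  have : ∑ i, (η i).smulRight (E.frames.frame (x i)) = LinearMap.id :=
    E.frames.isPullback.ext fun v => by
      simp only [LinearMap.sum_apply, LinearMap.smulRight_apply, hη, LinearMap.id_apply]
      conv_rhs => rw [← hx v]
      simp [map_sum, LinearMap.map_smulₛₗ]
  have h := congr($this w)
  simp only [LinearMap.sum_apply, LinearMap.smulRight_apply, LinearMap.id_apply] at h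
  conv_rhs => rw [← h]
  simp only [map_sum, LinearMap.map_smulₛₗ, hc]

instance : (frameFunctor e).Faithful where
  map_injective {E E' f g} h := by
    have h1 : Hom.base f = Hom.base g := congrArg QuotientObj.Hom.base h
    have h2 : mapTotal f = mapTotal g := congrArg QuotientObj.Hom.total h
    refine hom_ext h1 fun v => E'.frames.isPullback.injective E'.frames.faithfullyFlat ?_
    rw [← mapVec_mapTotal, ← mapVec_mapTotal, h2]

instance : (frameFunctor e).Full where
  map_surjective {E E'} f := by
    obtain ⟨b, t, hcomm, hact, -⟩ := f
    change E.base ⟶ E'.base at b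
    change E.frames.total ⟶ E'.frames.total at t
    change E.frames.proj ≫ t = b ≫ E'.frames.proj at hcomm
    have hv : ∀ v, ∃ y, E'.frames.frame y = mapVec n t (E.frames.frame v) := fun v => by
      refine exists_of_equivariant e E' _ fun C g p => ?_
      rw [← mapVec_comp]
      refine (congrArg (fun s => mapVec n s (E.frames.frame v)) (hact C g p)).trans ?_
      exact E.mapVec_frameAction e g (t ≫ p) v
    choose k hk using hv
    have hi := E'.frames.isPullback.injective E'.frames.faithfullyFlat
    let f : E.F →ₛₗ[rh b] E'.F :=
      { toFun := k
        map_add' := fun v w => hi (by rw [hk, map_add, map_add, map_add, hk, hk])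
        map_smul' := fun a v => hi (by
          rw [hk, LinearMap.map_smulₛₗ, LinearMap.map_smulₛₗ, LinearMap.map_smulₛₗ, hk]
          exact congr(rh $hcomm a • mapVec n t (E.frames.frame v))) }
    have hf : IsPullback (rh b) f :=
      E'.frames.isPullback.of_faithfullyFlat E'.frames.faithfullyFlat
        (χ := rh (E.frames.proj ≫ t)) (fun a => congr(rh $hcomm a))
        (h := compS (mapVec n t) E.frames.frame) (fun v => (hk v).symm)
        ((isPullback_mapVec t).compS E.frames.isPullback)
    let f' : E ⟶ E' := Bundle.Hom.mk b f hf
    refine ⟨f', QuotientObj.Hom.ext rfl (E.frames.hom_ext _ _ _ ?_ fun v => ?_)⟩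
    · exact (proj_mapTotal f').trans hcomm.symm
    · exact (mapVec_mapTotal f' v).trans (hk v)

end Bundle

/-! ### Descent of torsors to bundles -/

section ModuleDescent

variable (A S : Type*) [CommRing A] [CommRing S] [Algebra A S] [Module.FaithfullyFlat A S]

/-- A module is finite projective if it is so after a faithfully flat base change. -/
theorem finite_projective_of_faithfullyFlat (M : Type*) [AddCommGroup M] [Module A M]
    [Module.Finite S (S ⊗[A] M)] [Module.Projective S (S ⊗[A] M)] :
    Module.Finite A M ∧ Module.Projective A M := by
  have hfin : Module.Finite A M := Module.Finite.of_finite_tensorProduct_of_faithfullyFlat S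
  have hflat : Module.Flat A M := Module.Flat.of_flat_tensorProduct A M S
  refine ⟨hfin, ?_⟩
  obtain ⟨m, f, hf⟩ := Module.Finite.exists_fin' A M
  -- the module of relations is finite, because it becomes so over `S`
  have hker : Module.Finite A (LinearMap.ker f) := by
    have : Module.FinitePresentation S (S ⊗[A] M) := Module.finitePresentation_of_projective S _
    have hg : Function.Surjective (f.baseChange S) := by
      have := LinearMap.lTensor_surjective S hf
      exact this
    have hfg := Module.FinitePresentation.fg_ker (f.baseChange S) hg
    have hex : Function.Exact ((LinearMap.ker f).subtype.baseChange S) (f.baseChange S) :=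
      Module.Flat.lTensor_exact S (LinearMap.exact_subtype_ker_map f)
    have hinj : Function.Injective ((LinearMap.ker f).subtype.baseChange S) :=
      Module.Flat.lTensor_preserves_injective_linearMap (M := S) (LinearMap.ker f).subtype
        (Submodule.injective_subtype _)
    have hr := LinearMap.exact_iff.1 hex
    rw [hr] at hfg
    have : Module.Finite S (LinearMap.range ((LinearMap.ker f).subtype.baseChange S)) :=
      Module.Finite.iff_fg.2 hfg
    have : Module.Finite S (S ⊗[A] LinearMap.ker f) :=
      Module.Finite.equiv (LinearEquiv.ofInjective _ hinj).symm
    exact Module.Finite.of_finite_tensorProduct_of_faithfullyFlat S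
  have : Module.FinitePresentation A M :=
    Module.finitePresentation_of_surjective f hf (Module.Finite.iff_fg.1 hker)
  exact Module.Flat.projective_of_finitePresentation

end ModuleDescent

section Descent

variable {A S : Type*} [CommRing A] [CommRing S] [Algebra A S] {n : ℕ}

/-- The descended module of the trivial module `Sⁿ` with gluing matrix `γ`. -/
def descended (γ : Matrix (Fin n) (Fin n) (S ⊗[A] S)) : Submodule A (Fin n → S) where
  carrier := {v | γ.mulVec (fun i => v i ⊗ₜ 1) = fun i => 1 ⊗ₜ v i}
  zero_mem' := by
    simp only [Set.mem_ofPred_eq, Pi.zero_apply, zero_tmul, tmul_zero]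
    exact γ.mulVec_zero
  add_mem' {v w} hv hw := by
    simp only [Set.mem_ofPred_eq, Pi.add_apply, add_tmul, tmul_add] at *
    rw [← Pi.add_def, Matrix.mulVec_add, hv, hw]
    rfl
  smul_mem' a v hv := by
    have h : (fun i => (a • v) i ⊗ₜ[A] (1 : S)) = a • (fun i => v i ⊗ₜ 1) := funext fun i => rfl
    change γ.mulVec _ = _
    rw [h, Matrix.mulVec_smul, hv]
    ext i
    simp

theorem mem_descended {γ : Matrix (Fin n) (Fin n) (S ⊗[A] S)} {v : Fin n → S} :
    v ∈ descended γ ↔ γ.mulVec (fun i => v i ⊗ₜ 1) = fun i => 1 ⊗ₜ v i := Iff.rfl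

theorem map_mulVec_algHom {T T' : Type*} [CommRing T] [CommRing T'] [Algebra A T] [Algebra A T']
    (f : T →ₐ[A] T') (g : Matrix (Fin n) (Fin n) T) (v : Fin n → T) :
    (fun i => f (g.mulVec v i)) = (g.map f).mulVec fun i => f (v i) :=
  funext fun i => RingHom.map_mulVec f.toRingHom g v i

/-- Effectivity of descent for the module `Sⁿ`: if the gluing matrix `γ` on `S ⊗ S` satisfies the
cocycle condition on `S ⊗ S ⊗ S`, then the descended module becomes `Sⁿ` over `S`. -/
theorem bijective_liftBaseChange_descended [Module.Flat A S]
    (γ : Matrix (Fin n) (Fin n) (S ⊗[A] S))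
    (h₁ : γ.map (Algebra.TensorProduct.map (AlgHom.id A S)
        (Algebra.TensorProduct.includeRight : S →ₐ[A] S ⊗[A] S)) =
      γ.map (Algebra.TensorProduct.includeRight : S ⊗[A] S →ₐ[A] S ⊗[A] (S ⊗[A] S)) *
      γ.map (Algebra.TensorProduct.map (AlgHom.id A S)
        (Algebra.TensorProduct.includeLeft : S →ₐ[A] S ⊗[A] S)))
    (h₂ : γ.map (Algebra.TensorProduct.lmul' A (S := S)) = 1) :
    Function.Bijective (LinearMap.liftBaseChange S (descended γ).subtype) := by
  set sq := Algebra.TensorProduct.map (AlgHom.id A S)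
    (Algebra.TensorProduct.includeRight : S →ₐ[A] S ⊗[A] S) with hsq
  set sp := Algebra.TensorProduct.map (AlgHom.id A S)
    (Algebra.TensorProduct.includeLeft : S →ₐ[A] S ⊗[A] S) with hsp
  set pq := (Algebra.TensorProduct.includeRight : S ⊗[A] S →ₐ[A] S ⊗[A] (S ⊗[A] S)) with hpq
  set δ := Algebra.TensorProduct.lmul' A (S := S) with hδ
  let κ : S ⊗[A] (S ⊗[A] S) →ₐ[A] S ⊗[A] S :=
    (Algebra.TensorProduct.map δ (AlgHom.id A S)).comp
      (Algebra.TensorProduct.assoc A A A S S S).symm.toAlgHom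
  have hκ : ∀ a b c : S, κ (a ⊗ₜ (b ⊗ₜ c)) = (a * b) ⊗ₜ c := fun a b c => rfl
  have κpq : ∀ x, κ (pq x) = x := fun x => by
    induction x with
    | zero => simp
    | tmul a b => simp [hpq, hκ]
    | add x y hx hy => simp only [map_add, hx, hy]
  have κsp : ∀ x, κ (sp x) = δ x ⊗ₜ 1 := fun x => by
    induction x with
    | zero => simp
    | tmul a b => simp [hsp, hκ, hδ]
    | add x y hx hy => simp only [map_add, hx, hy, add_tmul]
  have κsq : ∀ x, κ (sq x) = x := fun x => by
    induction x with
    | zero => simp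
    | tmul a b => simp [hsq, hκ]
    | add x y hx hy => simp only [map_add, hx, hy]
  have sp₁ : ∀ x, sp (x ⊗ₜ 1) = sq (x ⊗ₜ 1) := fun x => by
    simp [hsp, hsq, Algebra.TensorProduct.one_def]
  let d : (Fin n → S) →ₗ[A] (Fin n → S ⊗[A] S) :=
    { toFun := fun v => γ.mulVec (fun i => v i ⊗ₜ 1) - fun i => 1 ⊗ₜ v i
      map_add' := fun v w => by
        have : (fun i => (v + w) i ⊗ₜ[A] (1 : S)) = (fun i => v i ⊗ₜ 1) + fun i => w i ⊗ₜ 1 :=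
          funext fun i => add_tmul _ _ _
        rw [this, Matrix.mulVec_add]
        ext i
        simp only [Pi.sub_apply, Pi.add_apply, tmul_add]
        abel
      map_smul' := fun a v => by
        have : (fun i => (a • v) i ⊗ₜ[A] (1 : S)) = a • (fun i => v i ⊗ₜ 1) :=
          funext fun i => rfl
        rw [this, Matrix.mulVec_smul]
        ext i
        simp [smul_sub] }
  have hd : ∀ v, d v = γ.mulVec (fun i => v i ⊗ₜ 1) - fun i => 1 ⊗ₜ v i := fun _ => rfl
  have hker : LinearMap.ker d = descended γ := by
    ext v
    rw [LinearMap.mem_ker, hd, sub_eq_zero, mem_descended]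
  let Φ := TensorProduct.piRight A A S (fun _ : Fin n => S)
  let Ψ := TensorProduct.piRight A A S (fun _ : Fin n => S ⊗[A] S)
  have hΦ : ∀ s (v : Fin n → S) i, Φ (s ⊗ₜ v) i = s ⊗ₜ v i := fun _ _ _ => rfl
  have hΨ : ∀ s (v : Fin n → S ⊗[A] S) i, Ψ (s ⊗ₜ v) i = s ⊗ₜ v i := fun _ _ _ => rfl
  have key : ∀ y, Ψ (d.lTensor S y) =
      (γ.map pq).mulVec (fun i => sp (Φ y i)) - fun i => sq (Φ y i) := fun y => by
    induction y with
    | zero =>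
      simp only [map_zero, Pi.zero_apply]
      exact ((congrArg₂ _ (Matrix.mulVec_zero _) rfl).trans (sub_zero _)).symm
    | tmul s v =>
      ext i
      rw [LinearMap.lTensor_tmul, hΨ, hd]
      simp only [Pi.sub_apply, tmul_sub, Matrix.mulVec, dotProduct, tmul_sum, hΦ]
      refine congrArg₂ (· - ·) (Finset.sum_congr rfl fun j _ => ?_) ?_
      · simp [hpq, hsp]
      · simp [hsq]
    | add x y hx hy =>
      have : (fun i => sp (Φ (x + y) i)) = (fun i => sp (Φ x i)) + fun i => sp (Φ y i) :=
        funext fun i => by simp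
      rw [map_add, map_add, hx, hy, this, Matrix.mulVec_add]
      ext i
      simp only [Pi.sub_apply, Pi.add_apply, map_add]
      abel
  let μ : S ⊗[A] (Fin n → S) →ₗ[S] (Fin n → S) := LinearMap.liftBaseChange S LinearMap.id
  have hμ : ∀ y, μ y = fun i => δ (Φ y i) := fun y => by
    induction y with
    | zero => ext i; simp
    | tmul s v => ext i; simp [μ, hΦ, hδ]
    | add x y hx hy => rw [map_add, hx, hy]; ext i; simp
  have hinc : ∀ t, LinearMap.liftBaseChange S (descended γ).subtype t =
      μ ((descended γ).subtype.lTensor S t) := fun t => by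
    induction t with
    | zero => simp
    | tmul s v => simp [μ]
    | add x y hx hy => simp only [map_add, hx, hy]
  have hex : Function.Exact ((descended γ).subtype.lTensor S) (d.lTensor S) := by
    refine Module.Flat.lTensor_exact S ?_
    rw [← hker]
    exact LinearMap.exact_subtype_ker_map d
  have hinj : Function.Injective ((descended γ).subtype.lTensor S) :=
    Module.Flat.lTensor_preserves_injective_linearMap _ (Submodule.injective_subtype _)
  -- an element killed by `d` is determined by its image in `Sⁿ`
  have hrec : ∀ y, d.lTensor S y = 0 → Φ y = γ.mulVec (fun i => μ y i ⊗ₜ 1) := fun y hy => by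
    have h := key y
    rw [hy, map_zero] at h
    have h' := (sub_eq_zero.1 h.symm)
    have h3 := congrArg (fun (v : Fin n → S ⊗[A] (S ⊗[A] S)) => fun i => κ (v i)) h'
    simp only [κsq] at h3
    refine h3.symm.trans ?_
    refine (map_mulVec_algHom κ (γ.map pq) _).trans ?_
    congr 1
    · ext i j; exact κpq _
    · ext i
      rw [hμ]
      exact κsp _
  refine ⟨fun s t h => hinj (Φ.injective ?_), fun u => ?_⟩
  · rw [hrec _ (hex.apply_apply_eq_zero s), hrec _ (hex.apply_apply_eq_zero t), ← hinc, ← hinc, h]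
  · let y := Φ.symm (γ.mulVec fun i => u i ⊗ₜ 1)
    have hy : Φ y = γ.mulVec fun i => u i ⊗ₜ 1 := Φ.apply_symm_apply _
    have hdy : d.lTensor S y = 0 := Ψ.injective (by
      rw [key, map_zero, hy]
      have e1 := map_mulVec_algHom sp γ (fun i => u i ⊗ₜ 1)
      have e2 := map_mulVec_algHom sq γ (fun i => u i ⊗ₜ 1)
      rw [e1, e2, Matrix.mulVec_mulVec, sub_eq_zero]
      refine congrArg₂ Matrix.mulVec h₁.symm (funext fun i => sp₁ _))
    obtain ⟨t, ht⟩ := (hex y).1 hdy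
    refine ⟨t, ?_⟩
    rw [hinc, ht, hμ, hy]
    refine (map_mulVec_algHom δ γ _).trans ?_
    refine (congrArg (Matrix.mulVec · _) h₂).trans ?_
    rw [Matrix.one_mulVec]
    ext i
    simp [hδ]

end Descent

namespace QuotientObj

variable {n : ℕ} {G : Alg.{u} ⥤ GrpCat.{u}} {X : Alg.{u} ⥤ Type u} {ρ : GAction G X}
  (e : LinearStructure n G)

/-- An object of `[X/G]`, viewed over an isomorphic base. -/
def ofIso (P : QuotientObj ρ) {A : Alg.{u}} (b : A ≅ P.base) : QuotientObj ρ where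
  base := A
  total := P.total
  proj := b.hom ≫ P.proj
  faithfullyFlat := RingHom.FaithfullyFlat.stableUnderComposition _ _
    (.of_bijective (ConcreteCategory.bijective_of_isIso b.hom)) P.faithfullyFlat
  finitePresentation := P.finitePresentation.comp
    (.of_bijective (ConcreteCategory.bijective_of_isIso b.hom))
  action := P.action
  proj_act C g p := by rw [Category.assoc, Category.assoc, P.proj_act]
  simply_transitive C p q h := P.simply_transitive C p q ((cancel_epi b.hom).1 (by
    rw [← Category.assoc, h, Category.assoc]))
  toSpace := P.toSpace
  equivariant := P.equivariant

/-- The frames of the bundle obtained from `Sⁿ`, where `S` is the ring of a torsor, by descent along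
the matrix that relates the two tautological points of the torsor over `S ⊗ S`. -/
theorem exists_equivariant_frame (P : QuotientObj ρ) :
    ∃ (F : Type u) (_ : AddCommGroup F) (_ : Module P.base F)
    (_ : Module.Finite P.base F) (_ : Module.Projective P.base F)
    (h : F →ₛₗ[rh P.proj] (Fin n → P.total)),
    (∀ p : PrimeSpectrum P.base, Module.rankAtStalk (R := P.base) F p = n) ∧
      IsPullback (rh P.proj) h ∧ ∀ (C : Alg.{u}) (g : G.obj C) (p : P.total ⟶ C) (v : F),
        mapVec n (P.action.act C g p : P.total ⟶ C) (h v) = e.act g (mapVec n p (h v)) := by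
  let _ : Algebra P.base P.total := (rh P.proj).toAlgebra
  have hff : Module.FaithfullyFlat P.base P.total := P.faithfullyFlat
  let D : Alg.{u} := algOver P.total (P.total ⊗[P.base] P.total)
    Algebra.TensorProduct.includeLeftRingHom
  let T : Alg.{u} := algOver P.total (P.total ⊗[P.base] (P.total ⊗[P.base] P.total))
    Algebra.TensorProduct.includeLeftRingHom
  let i₁ : P.total ⟶ D := ofRingHom (B := D) Algebra.TensorProduct.includeLeftRingHom
  let i₂ : P.total ⟶ D := ofRingHom (B := D)
    (Algebra.TensorProduct.includeRight (R := P.base)).toRingHom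
  have hD : P.proj ≫ i₁ = P.proj ≫ i₂ := alg_hom_ext fun a => by
    change (algebraMap P.base P.total a) ⊗ₜ[P.base] (1 : P.total) =
      (1 : P.total) ⊗ₜ[P.base] (algebraMap P.base P.total a)
    rw [Algebra.algebraMap_eq_smul_one, TensorProduct.smul_tmul]
  obtain ⟨g₀, hg₀, -⟩ := P.simply_transitive D i₁ i₂ hD
  let sq : D ⟶ T := ofRingHom (A := D) (B := T)
    (Algebra.TensorProduct.map (AlgHom.id P.base P.total)
      (Algebra.TensorProduct.includeRight : P.total →ₐ[P.base] P.total ⊗[P.base] P.total)).toRingHom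
  let sp : D ⟶ T := ofRingHom (A := D) (B := T)
    (Algebra.TensorProduct.map (AlgHom.id P.base P.total)
      (Algebra.TensorProduct.includeLeft : P.total →ₐ[P.base] P.total ⊗[P.base] P.total)).toRingHom
  let pq : D ⟶ T := ofRingHom (A := D) (B := T)
    (Algebra.TensorProduct.includeRight : P.total ⊗[P.base] P.total →ₐ[P.base]
      P.total ⊗[P.base] (P.total ⊗[P.base] P.total)).toRingHom
  let δ : D ⟶ P.total := ofRingHom (A := D) (Algebra.TensorProduct.lmul' P.base).toRingHom
  have hmap : ∀ {C : Alg.{u}} (t : D ⟶ C),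
      P.action.act C (G.map t g₀) (i₁ ≫ t) = i₂ ≫ t := fun t => by
    rw [← P.act_natural, hg₀]
  have e₁ : i₁ ≫ sp = i₁ ≫ sq := alg_hom_ext fun a => by
    change a ⊗ₜ[P.base] ((1 : P.total) ⊗ₜ[P.base] (1 : P.total)) =
      a ⊗ₜ[P.base] ((1 : P.total) ⊗ₜ[P.base] (1 : P.total))
    rfl
  have e₂ : i₁ ≫ pq = i₂ ≫ sp := alg_hom_ext fun a => rfl
  have e₃ : i₂ ≫ pq = i₂ ≫ sq := alg_hom_ext fun a => rfl
  have e₄ : i₁ ≫ δ = 𝟙 _ := alg_hom_ext fun a => _root_.mul_one a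
  have e₅ : i₂ ≫ δ = 𝟙 _ := alg_hom_ext fun a => _root_.one_mul a
  -- the tautological element satisfies the cocycle condition, because the action is free
  have hcoc : G.map sq g₀ = G.map pq g₀ * G.map sp g₀ := P.act_injective (p := i₁ ≫ sq) (by
    rw [hmap, P.action.mul_act, ← e₁, hmap, ← e₂, hmap, e₃])
  have hone : G.map δ g₀ = 1 := P.act_injective (p := i₁ ≫ δ) (by
    rw [hmap, P.action.one_act, e₄, e₅])
  let γ : Matrix (Fin n) (Fin n) (P.total ⊗[P.base] P.total) := (e.equiv D g₀).val
  have hγ : ∀ {C : Alg.{u}} (t : D ⟶ C), γ.map (rh t) = (e.equiv C (G.map t g₀)).val :=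
    fun t => by
      rw [e.natural]
      rfl
  have h₁ := (hγ sq).trans (congrArg (fun g => (e.equiv T g).val) hcoc)
  have h₂ := (hγ δ).trans (congrArg (fun g => (e.equiv P.total g).val) hone)
  rw [_root_.map_mul, Units.val_mul, ← hγ, ← hγ] at h₁
  rw [_root_.map_one, Units.val_one] at h₂
  have hbij := bijective_liftBaseChange_descended γ h₁ h₂
  let eqv := LinearEquiv.ofBijective _ hbij
  let h : descended γ →ₛₗ[rh P.proj] (Fin n → P.total) :=
    { toFun := fun v => v
      map_add' := fun v w => rfl
      map_smul' := fun a v => by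
        ext i
        exact Algebra.smul_def (A := P.total) a (v.1 i) }
  have hh : IsPullback (rh P.proj) h := isPullback_of_equiv eqv fun v => by
    change LinearMap.liftBaseChange P.total (descended γ).subtype (1 ⊗ₜ v) = v
    simp
  have : Module.Finite P.total (P.total ⊗[P.base] descended γ) := Module.Finite.equiv eqv.symm
  have : Module.Projective P.total (P.total ⊗[P.base] descended γ) :=
    Module.Projective.of_equiv eqv.symm
  obtain ⟨hfin, hproj⟩ := finite_projective_of_faithfullyFlat P.base P.total (descended γ)
  refine ⟨descended γ, inferInstance, inferInstance, hfin, hproj, h, fun p => ?_, hh,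
    fun C g p v => ?_⟩
  · obtain ⟨q, rfl⟩ := PrimeSpectrum.comap_surjective_of_faithfullyFlat (A := P.base)
      (B := P.total) p
    have : Nontrivial P.total := ⟨0, 1, fun h => q.2.ne_top
      ((Ideal.eq_top_iff_one _).2 (h ▸ Ideal.zero_mem _))⟩
    refine (hh.rankAtStalk_eq q).symm.trans ?_
    rw [Module.rankAtStalk_eq_finrank_of_free]
    simp
  have hp := P.proj_act C g p
  let t : D ⟶ C := ofRingHom (A := D)
    (letI : Algebra P.base C := (rh (P.proj ≫ p)).toAlgebra
     (Algebra.TensorProduct.lift (R := P.base) (S := P.base)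
      ({ rh p with commutes' := fun _ => rfl } : P.total →ₐ[P.base] C)
      ({ rh (P.action.act C g p : P.total ⟶ C) with commutes' := fun a => congr(rh $hp a) } :
        P.total →ₐ[P.base] C) (fun _ _ => Commute.all _ _)).toRingHom)
  have ht₁ : i₁ ≫ t = p := alg_hom_ext fun a => by
    change rh p a * rh (P.action.act C g p : P.total ⟶ C) 1 = rh p a
    rw [_root_.map_one, _root_.mul_one]
  have ht₂ : i₂ ≫ t = P.action.act C g p := alg_hom_ext fun a => by
    change rh p 1 * rh (P.action.act C g p : P.total ⟶ C) a = _
    rw [_root_.map_one, _root_.one_mul]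
  have hgt : G.map t g₀ = g := P.act_injective (p := p) (by
    have := hmap t
    rwa [ht₁, ht₂] at this)
  have hv : mapVec n i₂ (h v) = e.act g₀ (mapVec n i₁ (h v)) := (mem_descended.1 v.2).symm
  rw [← ht₂, mapVec_comp, hv, e.map_act, hgt, ← mapVec_comp, ht₁]

/-- An object of `[X/G]` whose torsor has an equivariant frame for the bundle `E` is isomorphic to
the object given by the frames of `E`. -/
theorem exists_frameObj_iso (P : QuotientObj ρ) (E : Bundle.{u} n) (b : E.base ≅ P.base)
    (h : E.F →ₛₗ[rh (b.hom ≫ P.proj)] (Fin n → P.total))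
    (hh : IsPullback (rh (b.hom ≫ P.proj)) h)
    (hact : ∀ (C : Alg.{u}) (g : G.obj C) (p : P.total ⟶ C) (v : E.F),
      mapVec n (P.action.act C g p : P.total ⟶ C) (h v) = e.act g (mapVec n p (h v)))
    (s : coyoneda.obj (Opposite.op E.frames.total) ⟶ X)
    (hs : ∀ (C : Alg.{u}) (g : G.obj C) (p : E.frames.total ⟶ C),
      s.app C ((E.frameAction e).act C g p) = ρ.act C g (s.app C p))
    (hts : ∀ t : E.frames.total ⟶ P.total, E.frames.proj ≫ t = b.hom ≫ P.proj →
      (∀ v, h v = mapVec n t (E.frames.frame v)) → ∀ (C : Alg.{u}) (q : P.total ⟶ C),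
        s.app C (t ≫ q) = P.toSpace.app C q) :
    ∃ i : E.frameObj e s hs ≅ P, Hom.base i.hom = b.hom := by
  obtain ⟨t, ht, ht'⟩ := E.frames.exists_lift _ _ h hh
  have hmap : ∀ (C : Alg.{u}) (g : G.obj C) (q : P.total ⟶ C),
      t ≫ (P.action.act C g q : P.total ⟶ C) = (E.frameAction e).act C g (t ≫ q) := by
    refine fun C g q => E.frames.hom_ext C _ _ ?_ fun v => ?_
    · rw [E.proj_frameAction e g, ← Category.assoc, ← Category.assoc, ht, Category.assoc,
        Category.assoc]
      exact congrArg _ (P.proj_act C g q)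
    · rw [E.mapVec_frameAction e g, mapVec_comp, mapVec_comp, ← ht', hact]
  let f : Hom (E.frameObj e s hs) P :=
    { base := b.hom
      total := t
      comm := ht
      map_act := hmap
      map_toSpace := hts t ht ht' }
  have := Hom.isIso f (inferInstanceAs (IsIso b.hom))
  exact ⟨asIso (X := E.frameObj e s hs) f, rfl⟩

/-- Every torsor under `G ≃ GLₙ` is the torsor of frames of a bundle. -/
theorem exists_frameFunctor_iso (P : QuotientObj (trivialAction G)) {A : Alg.{u}}
    (b : A ≅ P.base) :
    ∃ (F : Type u) (_ : AddCommGroup F) (_ : Module A F) (_ : Module.Finite A F)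
      (_ : Module.Projective A F)
      (hr : ∀ p : PrimeSpectrum A, Module.rankAtStalk (R := A) F p = n)
      (i : (Bundle.frameFunctor e).obj { base := A, F := F, rankF := hr } ≅ P),
      Hom.base i.hom = b.hom := by
  obtain ⟨F, _, _, _, _, h, hr, hh, hact⟩ := (P.ofIso b).exists_equivariant_frame e
  let E : Bundle.{u} n := { base := (P.ofIso b).base, F := F, rankF := hr }
  obtain ⟨i, hi⟩ := P.exists_frameObj_iso e E b h hh hact
    { app := fun _ => TypeCat.ofHom fun _ => PUnit.unit } (fun _ _ _ => rfl) fun _ _ _ _ _ => rfl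
  exact ⟨F, _, _, _, _, hr, i, hi⟩

end QuotientObj

/-- The stack of locally free sheaves of rank `n`. -/
def bundleStack (n : ℕ) : BasedCategory Alg.{u} := BasedCategory.ofFunctor (Bundle.proj (n := n))

/-- Locally free sheaves of rank `n` are torsors under `G ≃ GLₙ`. -/
theorem stackEquiv_bundleStack {n : ℕ} {G : Alg.{u} ⥤ GrpCat.{u}} (e : LinearStructure n G) :
    StackEquiv (bundleStack.{u} n) (classifyingStack G) := by
  refine ⟨⟨Bundle.frameFunctor e, rfl⟩, inferInstanceAs (Bundle.frameFunctor e).Full,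
    inferInstanceAs (Bundle.frameFunctor e).Faithful, fun (P : QuotientObj (trivialAction G)) => ?_⟩
  obtain ⟨F, _, _, _, _, hr, i, hi⟩ := QuotientObj.exists_frameFunctor_iso e P (Iso.refl P.base)
  refine ⟨{ base := P.base, F := F, rankF := hr }, i, ?_⟩
  have h1 := IsHomLift.map (p := (classifyingStack G).p) i.hom
  change (classifyingStack G).p.IsHomLift (QuotientObj.Hom.base i.hom) i.hom at h1
  rw [hi] at h1
  exact h1

/-! ### The quotient stack presentation of the stack of triples -/

section TripleStack

/-- `GL₂` as a linear group. -/
def linearGL₂ : LinearStructure 2 GL₂.{u} where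
  equiv C := MulEquiv.refl _
  natural _ _ := rfl

/-- `𝔾ₘ` acts on the functions on the line of vectors by the inverse of its action on vectors; this
sign is chosen so that a linear form, evaluated on a frame, is an equivariant map to `𝔸¹`. -/
def linearGm : LinearStructure 1 Gm.{u} where
  equiv C := (MulEquiv.inv (show Type u from Cˣ)).trans
    (Units.mapEquiv (Matrix.uniqueRingEquiv (m := Fin 1) (A := C)).symm.toMulEquiv)
  natural {C D} ψ g := by
    ext i j
    rfl

theorem linearGm_act {C : Alg.{u}} (g : Gm.{u}.obj C) (v : Fin 1 → C) :
    ((show Cˣ from g) : C) * linearGm.act g v 0 = v 0 := by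
  have : linearGm.act g v 0 = (((show Cˣ from g)⁻¹ : Cˣ) : C) * v 0 := by
    change Matrix.mulVec _ v 0 = _
    rw [Matrix.mulVec, dotProduct, Fin.sum_univ_one]
    rfl
  rw [this]
  exact Units.mul_inv_cancel_left (show Cˣ from g) (v 0)

/-- Scalars are determined by their action on a frame of an invertible module. -/
theorem IsPullback.eq_of_mul_eq {A C M : Type*} [CommRing A] [CommRing C] [AddCommGroup M]
    [Module A M] {φ : A →+* C} {h : M →ₛₗ[φ] (Fin 1 → C)} (hh : IsPullback φ h) {a b : C}
    (H : ∀ m, a * h m 0 = b * h m 0) : a = b := by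
  have : LinearMap.mulLeft C a ∘ₗ LinearMap.proj 0 =
      LinearMap.mulLeft C b ∘ₗ (LinearMap.proj 0 : (Fin 1 → C) →ₗ[C] C) := hh.ext H
  simpa using congr($this 1)

namespace Bundle

variable (E : Bundle.{u} 1) (μ : E.F →ₗ[E.base] E.base)

theorem exists_coord :
    ∃ a : E.frames.total, ∀ l, a * E.frames.frame l 0 = rh E.frames.proj (μ l) := by
  obtain ⟨η, hη⟩ := E.frames.isPullback.exists_dual μ
  refine ⟨η 1, fun l => ?_⟩
  rw [← hη, mul_comm, ← smul_eq_mul, ← map_smul]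
  congr 1
  ext i
  fin_cases i
  simp

/-- The function on frames given by a linear form on an invertible sheaf. -/
def coord : E.frames.total := (E.exists_coord μ).choose

theorem coord_mul (l : E.F) : E.coord μ * E.frames.frame l 0 = rh E.frames.proj (μ l) :=
  (E.exists_coord μ).choose_spec l

theorem rh_coord_mul {C : Alg.{u}} (p : E.frames.total ⟶ C) (l : E.F) :
    rh p (E.coord μ) * mapVec 1 p (E.frames.frame l) 0 = rh (E.frames.proj ≫ p) (μ l) := by
  rw [mapVec_apply, ← map_mul, coord_mul, rh_comp]

theorem rh_coord_act {C : Alg.{u}} (g : Gm.{u}.obj C) (p : E.frames.total ⟶ C) :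
    rh ((E.frameAction linearGm).act C g p : E.frames.total ⟶ C) (E.coord μ) =
      ((show Cˣ from g) : C) * rh p (E.coord μ) := by
  refine (E.isPullback_frameAt ((E.frameAction linearGm).act C g p)).eq_of_mul_eq fun l => ?_
  rw [frameAt_apply, rh_coord_mul, proj_frameAction, mapVec_frameAction, mul_right_comm,
    linearGm_act, ← rh_coord_mul, mul_comm]

/-- The map to `𝔸¹` from the frames of an invertible sheaf with a linear form. -/
def coordMap : coyoneda.obj (Opposite.op E.frames.total) ⟶ affineLine.{u} where
  app C := TypeCat.ofHom fun p => rh p (E.coord μ)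

/-- The object of `[𝔸¹/𝔾ₘ]` given by an invertible sheaf with a linear form. -/
def lineObj : QuotientObj scaling.{u} :=
  E.frameObj linearGm (E.coordMap μ) fun _ g p => E.rh_coord_act μ g p

end Bundle

namespace Triple

/-- The invertible sheaf of a triple. -/
def line (z : Triple.{u}) : Bundle.{u} 1 := { base := z.base, F := z.L, rankF := z.rankL }

/-- The locally free sheaf of rank two of a triple. -/
def plane (z : Triple.{u}) : Bundle.{u} 2 := { base := z.base, F := z.F, rankF := z.rankF }

variable {z z' : Triple.{u}}

/-- The map of invertible sheaves of an arrow of triples. -/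
def Hom.line (f : Hom z z') : z.line ⟶ z'.line :=
  Bundle.Hom.mk (E := z.line) (E' := z'.line) f.base f.mapL f.pullbackL

/-- The map of locally free sheaves of rank two of an arrow of triples. -/
def Hom.plane (f : Hom z z') : z.plane ⟶ z'.plane :=
  Bundle.Hom.mk (E := z.plane) (E' := z'.plane) f.base f.mapF f.pullbackF

theorem hom_ext {f g : z ⟶ z'} (h : Hom.line f = Hom.line g) (h' : Hom.plane f = Hom.plane g) :
    f = g := by
  obtain ⟨b, l, m, hl, hm, H⟩ := f
  obtain ⟨b', l', m', hl', hm', H'⟩ := g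
  obtain ⟨rfl, h⟩ := Bundle.Hom.mk.injEq .. ▸ h
  obtain ⟨-, h'⟩ := Bundle.Hom.mk.injEq .. ▸ h'
  obtain rfl := eq_of_heq h
  obtain rfl := eq_of_heq h'
  rfl

/-- The linear form of a triple. -/
abbrev form (z : Triple.{u}) : z.line.F →ₗ[z.line.base] z.line.base := z.μ

theorem rh_coord_mapTotal (f : Hom z z') {C : Alg.{u}} (q : z'.line.frames.total ⟶ C) :
    rh (Bundle.mapTotal f.line ≫ q) (z.line.coord z.form) = rh q (z'.line.coord z'.form) := by
  refine (((Bundle.isPullback_frameAt _ q).compS f.line.pullbackF)).eq_of_mul_eq fun l => ?_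
  change _ * mapVec 1 q (z'.line.frames.frame (f.line.mapF l)) 0 =
    _ * mapVec 1 q (z'.line.frames.frame (f.line.mapF l)) 0
  rw [z'.line.rh_coord_mul, ← Bundle.mapVec_mapTotal, ← mapVec_comp, Bundle.rh_coord_mul,
    ← Category.assoc, Bundle.proj_mapTotal]
  exact congrArg (rh (z'.line.frames.proj ≫ q)) (f.map_μ l)

/-- The functor from triples to `[𝔸¹/𝔾ₘ] × BGL₂`, given by the frames of the two sheaves. -/
def toProd :
    Triple.{u} ⥤ (stackProd (quotientStack scaling.{u}) (classifyingStack GL₂.{u})).obj where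
  obj z := Limits.CategoricalPullback.mk (F := (quotientStack scaling.{u}).p)
    (G := (classifyingStack GL₂.{u}).p)
    (z.line.lineObj z.form) ((Bundle.frameFunctor linearGL₂).obj z.plane) (Iso.refl z.base)
  map {z z'} f := Limits.CategoricalPullback.Hom.mk
    (QuotientObj.Hom.mk (P := z.line.lineObj z.form) (Q := z'.line.lineObj z'.form) (Hom.base f)
      (Bundle.mapTotal (Hom.line f)) (Bundle.proj_mapTotal (Hom.line f))
      (Bundle.mapTotal_act linearGm (Hom.line f)) (fun C q => rh_coord_mapTotal f q))
    ((Bundle.frameFunctor linearGL₂).map (Hom.plane f))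
    ((Category.comp_id _).trans (Category.id_comp _).symm)
  map_id z := Limits.CategoricalPullback.hom_ext
    (QuotientObj.Hom.ext rfl (Bundle.mapTotal_id (E := z.line)))
    ((Bundle.frameFunctor linearGL₂).map_id z.plane)
  map_comp f g := Limits.CategoricalPullback.hom_ext
    (QuotientObj.Hom.ext rfl (Bundle.mapTotal_comp (Hom.line f) (Hom.line g)))
    ((Bundle.frameFunctor linearGL₂).map_comp (Hom.plane f) (Hom.plane g))

instance : toProd.{u}.Faithful where
  map_injective {z z' f g} h := by
    have h1 : QuotientObj.Hom.torsor (toProd.map f).fst =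
        QuotientObj.Hom.torsor (toProd.map g).fst := by rw [h]
    have h2 : (toProd.map f).snd = (toProd.map g).snd := by rw [h]
    exact hom_ext ((Bundle.frameFunctor linearGm).map_injective
      (X := z.line) (Y := z'.line) h1) ((Bundle.frameFunctor linearGL₂).map_injective h2)

instance : toProd.{u}.Full where
  map_surjective {z z'} f := by
    obtain ⟨b₁, h₁⟩ := (Bundle.frameFunctor linearGm).map_surjective
      (X := z.line) (Y := z'.line) (QuotientObj.Hom.torsor f.fst)
    obtain ⟨b₂, h₂⟩ := (Bundle.frameFunctor linearGL₂).map_surjective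
      (X := z.plane) (Y := z'.plane) f.snd
    have hb₁ : Bundle.Hom.base b₁ = QuotientObj.Hom.base f.fst :=
      congrArg QuotientObj.Hom.base h₁
    have ht₁ : Bundle.mapTotal b₁ = QuotientObj.Hom.total f.fst :=
      congrArg QuotientObj.Hom.total h₁
    have hb₂ : Bundle.Hom.base b₂ = QuotientObj.Hom.base f.snd :=
      congrArg QuotientObj.Hom.base h₂
    have hw : QuotientObj.Hom.base f.fst = QuotientObj.Hom.base f.snd :=
      (Category.comp_id _).symm.trans (f.w.trans (Category.id_comp _))
    have hμ : ∀ l : z.line.F,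
        rh (Bundle.Hom.base b₁) (z.form l) = z'.form (Bundle.Hom.mapF b₁ l) := fun l => by
      refine z'.line.frames.faithfullyFlat.injective ?_
      have h := QuotientObj.Hom.map_toSpace f.fst _ (𝟙 _)
      rw [Category.comp_id, ← ht₁] at h
      change rh (Bundle.mapTotal b₁) (z.line.coord z.form) = z'.line.coord z'.form at h
      have h3 := congrArg (rh (Bundle.mapTotal b₁)) (z.line.coord_mul z.form l)
      rw [map_mul, h, ← mapVec_apply, Bundle.mapVec_mapTotal, z'.line.coord_mul, ← rh_comp,
        Bundle.proj_mapTotal] at h3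
      exact h3.symm
    obtain ⟨b, m₁, p₁⟩ := b₁
    obtain ⟨b', m₂, p₂⟩ := b₂
    obtain rfl : b = b' := hb₁.trans (hw.trans hb₂.symm)
    let k : Hom z z' := ⟨b, m₁, m₂, p₁, p₂, hμ⟩
    exact ⟨k, Limits.CategoricalPullback.hom_ext (QuotientObj.Hom.ext hb₁ ht₁) h₂⟩

end Triple

/-- The function on a `𝔾ₘ`-torsor given by an equivariant map to `𝔸¹` pairs with the vectors of
the associated invertible sheaf. -/
theorem exists_form (P : QuotientObj scaling.{u}) {L : Type u} [AddCommGroup L] [Module P.base L]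
    (h : L →ₛₗ[rh P.proj] (Fin 1 → P.total))
    (hact : ∀ (C : Alg.{u}) (g : Gm.{u}.obj C) (p : P.total ⟶ C) (l : L),
      mapVec 1 (P.action.act C g p : P.total ⟶ C) (h l) = linearGm.act g (mapVec 1 p (h l))) :
    ∃ (a : P.total) (μ : L →ₗ[P.base] P.base),
      (∀ (C : Alg.{u}) (q : P.total ⟶ C), rh q a = P.toSpace.app C q) ∧
        ∀ l, rh P.proj (μ l) = a * h l 0 := by
  let a : P.total := P.toSpace.app P.total (𝟙 P.total)
  have ha : ∀ (C : Alg.{u}) (q : P.total ⟶ C), rh q a = P.toSpace.app C q := fun C q => by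
    have := congr($(P.toSpace.naturality q) (𝟙 P.total))
    exact this.symm.trans (congrArg (P.toSpace.app C) (Category.id_comp q))
  have hd : ∀ l, ∃ c, rh P.proj c = a * h l 0 := fun l => by
    refine exists_of_forall_eq P.proj P.faithfullyFlat _ fun C p q hpq => ?_
    obtain ⟨g, rfl, -⟩ := P.simply_transitive C p q hpq
    rw [map_mul, map_mul, ha, ha, P.equivariant]
    have h1 := congr($(hact C g p l) 0)
    rw [mapVec_apply] at h1
    rw [h1]
    change _ = ((show Cˣ from g) : C) * (show C from P.toSpace.app C p) * _
    rw [mul_right_comm, linearGm_act, mapVec_apply, mul_comm]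
  choose μ hμ using hd
  have hi := P.faithfullyFlat.injective
  exact ⟨a,
    { toFun := μ
      map_add' := fun l l' => hi (by
        rw [map_add, hμ, hμ, hμ, map_add, Pi.add_apply, mul_add])
      map_smul' := fun c l => hi (by
        rw [smul_eq_mul, map_mul, hμ, RingHom.id_apply, hμ, LinearMap.map_smulₛₗ, Pi.smul_apply,
          smul_eq_mul, mul_left_comm]) }, ha, hμ⟩

/-- Every object of `[𝔸¹/𝔾ₘ]` comes from an invertible sheaf with a linear form. -/
theorem exists_lineObj_iso (P : QuotientObj scaling.{u}) :
    ∃ (L : Type u) (_ : AddCommGroup L) (_ : Module P.base L) (_ : Module.Finite P.base L)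
      (_ : Module.Projective P.base L)
      (hr : ∀ p : PrimeSpectrum P.base, Module.rankAtStalk (R := P.base) L p = 1)
      (μ : L →ₗ[P.base] P.base)
      (i : Bundle.lineObj { base := P.base, F := L, rankF := hr } μ ≅ P),
      QuotientObj.Hom.base i.hom = 𝟙 P.base := by
  obtain ⟨L, _, _, _, _, h, hr, hh, hact⟩ := P.exists_equivariant_frame linearGm
  obtain ⟨a, μ, ha, hμ⟩ := exists_form P h hact
  let E : Bundle.{u} 1 := { base := P.base, F := L, rankF := hr }
  obtain ⟨i, hi⟩ := P.exists_frameObj_iso linearGm E (Iso.refl P.base) h hh hact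
    (E.coordMap μ) (fun _ g p => E.rh_coord_act μ g p) fun t ht ht' C q => by
      have e : rh t (E.coord μ) = a := hh.eq_of_mul_eq fun l => by
        refine (congrArg (rh t (E.coord μ) * · 0) (ht' l)).trans
          ((E.rh_coord_mul μ t l).trans ?_)
        rw [ht]
        exact hμ l
      change rh q (rh t (E.coord μ)) = _
      rw [e, ha]
  exact ⟨L, _, _, _, _, hr, μ, i, hi⟩

/-- A line bundle with a linear form is a `𝔾ₘ`-torsor with an equivariant map to `𝔸¹`, and a bundle
of rank two is a `GL₂`-torsor. -/
theorem stackEquiv_tripleStack : StackEquiv tripleStack.{u}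
    (stackProd (quotientStack scaling) (classifyingStack GL₂)) := by
  refine ⟨⟨Triple.toProd, rfl⟩, inferInstanceAs Triple.toProd.Full,
    inferInstanceAs Triple.toProd.Faithful, fun y => ?_⟩
  obtain ⟨(P : QuotientObj scaling), (Q : QuotientObj (trivialAction GL₂)), b⟩ := y
  change P.base ≅ Q.base at b
  obtain ⟨L, _, _, _, _, hr, μ, i, hi⟩ := exists_lineObj_iso P
  obtain ⟨F, _, _, _, _, kr, j, hj⟩ := QuotientObj.exists_frameFunctor_iso linearGL₂ Q b
  let z : Triple.{u} := { base := P.base, L := L, F := F, rankL := hr, rankF := kr, μ := μ }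
  let m : Triple.toProd.obj z ≅ Limits.CategoricalPullback.mk (F := (quotientStack scaling.{u}).p)
      (G := (classifyingStack GL₂.{u}).p) P Q b :=
    Limits.CategoricalPullback.mkIso i j (by
      change QuotientObj.Hom.base i.hom ≫ b.hom = 𝟙 _ ≫ QuotientObj.Hom.base j.hom
      rw [hi, hj]
      rfl)
  refine ⟨z, m, ?_⟩
  have h1 := IsHomLift.map
    (p := (stackProd (quotientStack scaling.{u}) (classifyingStack GL₂.{u})).p) m.hom
  change Functor.IsHomLift _ (QuotientObj.Hom.base i.hom) m.hom at h1
  rw [hi] at h1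
  exact h1

end TripleStack

/-! ### The coordinates of the regular representation -/

section Half

/-- The element `1/2` of a `ℤ[1/2]`-algebra. -/
abbrev hf (A : Alg.{u}) : A := algebraMap BaseRing A half

theorem two_mul_hf (A : Alg.{u}) : 2 * hf A = 1 := by
  have : (2 : BaseRing) * half = 1 := by
    have := IsLocalization.Away.mul_invSelf (S := BaseRing) (2 : ℤ)
    rwa [map_ofNat] at this
  have h := congrArg (algebraMap BaseRing A) this
  rwa [map_mul, map_ofNat, map_one] at h

theorem rh_hf {A B : Alg.{u}} (φ : A ⟶ B) : rh φ (hf A) = hf B := φ.hom.commutes half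

theorem hf_smul_add {A : Alg.{u}} {M : Type*} [AddCommGroup M] [Module A M] (m : M) :
    hf A • (m + m) = m := by
  rw [← two_smul A m, smul_smul, mul_comm, two_mul_hf, one_smul]

theorem eq_zero_of_add_self {A : Alg.{u}} {M : Type*} [AddCommGroup M] [Module A M] {m : M}
    (h : m + m = 0) : m = 0 := by
  rw [← hf_smul_add (A := A) m, h, smul_zero]

end Half

namespace GRing

section Coefficients

variable (A : Alg.{u})

/-- The restriction of functions to the component `e = ε` of `G`, a copy of `μ₃`, followed by the
coefficient of `x ^ i`. -/
def restrictCoeff (ε : A) (hε : ε ^ 2 = ε) (i : ZMod 3) : GRing A →ₗ[A] A :=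
  (Finsupp.lapply i ∘ₗ
      (AddMonoidAlgebra.coeffLinearEquiv A : AddMonoidAlgebra A (ZMod 3) ≃ₗ[A] _).toLinearMap) ∘ₗ
    (lift (A := A) (AddMonoidAlgebra.single (1 : ZMod 3) (1 : A))
      (algebraMap A (AddMonoidAlgebra A (ZMod 3)) ε)
      (by rw [AddMonoidAlgebra.single_pow, AddMonoidAlgebra.one_def, one_pow]; rfl)
      (by rw [← _root_.map_pow, hε])).toLinearMap

theorem restrictCoeff_x_pow_mul (ε : A) (hε : ε ^ 2 = ε) (i : ZMod 3) (k : ℕ) (a b : A) :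
    restrictCoeff A ε hε i (x A ^ k * (algebraMap A _ a + b • e A)) =
      if (k : ZMod 3) = i then a + b * ε else 0 := by
  have h : algebraMap A (AddMonoidAlgebra A (ZMod 3)) a +
      b • algebraMap A (AddMonoidAlgebra A (ZMod 3)) ε = AddMonoidAlgebra.single 0 (a + b * ε) := by
    rw [Algebra.smul_def, ← _root_.map_mul, ← map_add]
    rfl
  rw [restrictCoeff, LinearMap.comp_apply, AlgHom.toLinearMap_apply, _root_.map_mul,
    _root_.map_pow, map_add, map_smul, AlgHom.commutes, lift_x, lift_e, h,
    AddMonoidAlgebra.single_pow, AddMonoidAlgebra.single_mul_single]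
  simp only [zero_add, nsmul_eq_mul, mul_one, one_pow, one_mul, add_zero]
  simp only [LinearMap.comp_apply, LinearEquiv.coe_coe, Finsupp.lapply_apply]
  exact Finsupp.single_apply

/-- The basis `1, s, u₁, u₂, v₁, v₂` of the coordinate ring of `G`. -/
def basisFun : Fin 6 → GRing A := ![1, s A, u₁ A, u₂ A, v₁ A, v₂ A]

/-- The coordinates in the basis `1, s, u₁, u₂, v₁, v₂`. -/
def coeff : Fin 6 → GRing A →ₗ[A] A :=
  let r₀ := restrictCoeff A 0 (zero_pow two_ne_zero)
  let r₁ := restrictCoeff A 1 (one_pow 2)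
  ![hf A • (r₀ 0 + r₁ 0), hf A • (r₀ 0 - r₁ 0), r₀ 1, r₀ 2, r₁ 1, r₁ 2]

theorem coeff_basisFun (i j : Fin 6) :
    coeff A i (basisFun A j) = if i = j then 1 else 0 := by
  have h2 := two_mul_hf A
  have h3 : hf A * 2 = 1 := by rw [mul_comm, h2]
  have e0 : (1 : GRing A) = x A ^ 0 * (algebraMap A _ 1 + (0 : A) • e A) := by simp
  have e1 : s A = x A ^ 0 * (algebraMap A _ 1 + (-2 : A) • e A) := by
    rw [s, Algebra.smul_def, _root_.map_neg, map_ofNat, pow_zero, _root_.map_one]; ring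
  have e2 : u₁ A = x A ^ 1 * (algebraMap A _ 1 + (-1 : A) • e A) := by
    rw [u₁, _root_.map_one, neg_one_smul, pow_one]; ring
  have e3 : u₂ A = x A ^ 2 * (algebraMap A _ 1 + (-1 : A) • e A) := by
    rw [u₂, _root_.map_one, neg_one_smul]; ring
  have e4 : v₁ A = x A ^ 1 * (algebraMap A _ 0 + (1 : A) • e A) := by
    rw [v₁, _root_.map_zero, one_smul, pow_one, zero_add]
  have e5 : v₂ A = x A ^ 2 * (algebraMap A _ 0 + (1 : A) • e A) := by
    rw [v₂, _root_.map_zero, one_smul, zero_add]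
  have d1 : ¬ (0 : ZMod 3) = 1 := by decide
  have d2 : ¬ (0 : ZMod 3) = 2 := by decide
  have d3 : ¬ (1 : ZMod 3) = 0 := by decide
  have d4 : ¬ (1 : ZMod 3) = 2 := by decide
  have d5 : ¬ (2 : ZMod 3) = 0 := by decide
  have d6 : ¬ (2 : ZMod 3) = 1 := by decide
  fin_cases j <;> fin_cases i <;>
  simp only [basisFun, coeff, Fin.zero_eta, Fin.mk_one, Fin.reduceFinMk, Matrix.cons_val] <;>
  first | rw [e0] | rw [e1] | rw [e2] | rw [e3] | rw [e4] | rw [e5]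
  all_goals
    simp only [LinearMap.smul_apply, LinearMap.add_apply, LinearMap.sub_apply,
      restrictCoeff_x_pow_mul, Nat.cast_zero, Nat.cast_one, Nat.cast_ofNat, d1, d2, d3, d4, d5, d6,
      if_true, if_false]
    norm_num [h2, h3]
  all_goals exact fun h => absurd h (by decide)

theorem sum_coeff (p : GRing A) : ∑ i, coeff A i p • basisFun A i = p := by
  have hs : ∀ t : GRing A, (hf A) • ((2 : GRing A) * t) = t := fun t => by
    rw [two_mul, hf_smul_add]
  have hs' : e A = hf A • (1 - s A) := by
    rw [s, sub_sub_cancel, hs]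
  have h1 : 1 - e A = hf A • (1 + s A) := by
    rw [s, show (1 : GRing A) + (1 - 2 * e A) = 2 * (1 - e A) by ring, hs]
  let T : Submodule A (GRing A) := Submodule.span A (Set.range (basisFun A))
  have b := fun i => Submodule.subset_span (R := A) (Set.mem_range_self (f := basisFun A) i)
  have hx := x_pow A
  have he := e_sq A
  -- the span of the basis is closed under multiplication by the generators `x` and `e`
  have hTx : ∀ p ∈ T, p * x A ∈ T := fun p hp => by
    refine Submodule.span_induction (p := fun p _ => p * x A ∈ T) ?_ (by simp)
      (fun p q _ _ hp hq => by rw [add_mul]; exact T.add_mem hp hq)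
      (fun a p _ hp => by rw [smul_mul_assoc]; exact T.smul_mem a hp) hp
    rintro _ ⟨i, rfl⟩
    have k0 : 1 * x A = u₁ A + v₁ A := by rw [u₁, v₁]; ring
    have k1 : s A * x A = u₁ A - v₁ A := by rw [s, u₁, v₁]; ring
    have k2 : u₁ A * x A = u₂ A := by rw [u₁, u₂]; ring
    have k3 : u₂ A * x A = hf A • (1 + s A) := by
      rw [← h1, u₂, show x A ^ 2 * (1 - e A) * x A = x A ^ 3 * (1 - e A) by ring, hx, one_mul]
    have k4 : v₁ A * x A = v₂ A := by rw [v₁, v₂]; ring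
    have k5 : v₂ A * x A = hf A • (1 - s A) := by
      rw [← hs', v₂, show x A ^ 2 * e A * x A = x A ^ 3 * e A by ring, hx, one_mul]
    fin_cases i
    · exact k0 ▸ T.add_mem (b 2) (b 4)
    · exact k1 ▸ T.sub_mem (b 2) (b 4)
    · exact k2 ▸ b 3
    · exact k3 ▸ T.smul_mem _ (T.add_mem (b 0) (b 1))
    · exact k4 ▸ b 5
    · exact k5 ▸ T.smul_mem _ (T.sub_mem (b 0) (b 1))
  have hTe : ∀ p ∈ T, p * e A ∈ T := fun p hp => by
    refine Submodule.span_induction (p := fun p _ => p * e A ∈ T) ?_ (by simp)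
      (fun p q _ _ hp hq => by rw [add_mul]; exact T.add_mem hp hq)
      (fun a p _ hp => by rw [smul_mul_assoc]; exact T.smul_mem a hp) hp
    rintro _ ⟨i, rfl⟩
    have k0 : 1 * e A = hf A • (1 - s A) := by rw [one_mul, ← hs']
    have k1 : s A * e A = -(hf A • (1 - s A)) := by
      rw [← hs', s, show (1 - 2 * e A) * e A = e A - 2 * e A ^ 2 by ring, he]; ring
    have k2 : u₁ A * e A = 0 := by
      rw [u₁, show x A * (1 - e A) * e A = x A * (e A - e A ^ 2) by ring, he]; ring
    have k3 : u₂ A * e A = 0 := by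
      rw [u₂, show x A ^ 2 * (1 - e A) * e A = x A ^ 2 * (e A - e A ^ 2) by ring, he]; ring
    have k4 : v₁ A * e A = v₁ A := by
      rw [v₁, show x A * e A * e A = x A * e A ^ 2 by ring, he]
    have k5 : v₂ A * e A = v₂ A := by
      rw [v₂, show x A ^ 2 * e A * e A = x A ^ 2 * e A ^ 2 by ring, he]
    fin_cases i
    · exact k0 ▸ T.smul_mem _ (T.sub_mem (b 0) (b 1))
    · exact k1 ▸ T.neg_mem (T.smul_mem _ (T.sub_mem (b 0) (b 1)))
    · exact k2 ▸ T.zero_mem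
    · exact k3 ▸ T.zero_mem
    · exact k4 ▸ b 4
    · exact k5 ▸ b 5
  have hT : ∀ p, p ∈ T := fun p => by
    obtain ⟨p, rfl⟩ := mk_surjective p
    induction p using MvPolynomial.induction_on with
    | C a =>
      have : mk A (MvPolynomial.C a) = a • (1 : GRing A) := by
        rw [← MvPolynomial.algebraMap_eq, AlgHom.commutes, Algebra.algebraMap_eq_smul_one]
      rw [this]
      exact T.smul_mem a (b 0)
    | add p q hp hq => rw [map_add]; exact T.add_mem hp hq
    | mul_X p i hp =>
      rw [_root_.map_mul]
      fin_cases i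
      · exact hTx _ hp
      · exact hTe _ hp
  refine Submodule.span_induction (p := fun p _ => ∑ i, coeff A i p • basisFun A i = p) ?_
    (by simp) (fun p q _ _ hp hq => ?_) (fun a p _ hp => ?_) (hT p)
  · rintro _ ⟨j, rfl⟩
    simp [coeff_basisFun]
  · simp only [map_add, add_smul, Finset.sum_add_distrib, hp, hq]
  · simp only [map_smul, smul_assoc, ← Finset.smul_sum, hp]

theorem map_basisFun {A B : Alg.{u}} (φ : A ⟶ B) (i : Fin 6) :
    map (rh φ) (basisFun A i) = basisFun B i := by
  obtain ⟨t1, t2, t3, t4, t5, t6⟩ := map_table A (rh φ)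
  fin_cases i
  exacts [t1, t2, t3, t4, t5, t6]

theorem coeff_map {A B : Alg.{u}} (φ : A ⟶ B) (i : Fin 6) (p : GRing A) :
    coeff B i (map (rh φ) p) = rh φ (coeff A i p) := by
  conv_lhs => rw [← sum_coeff A p]
  simp only [map_sum, LinearMap.map_smulₛₗ, map_basisFun, coeff_basisFun]
  simp

/-- The structure constants of the comultiplication: the pairs `(i, j)` such that `bᵢ ⊗ bⱼ` occurs
in the comultiplication of the basis elements `b₀, …, b₅`. -/
theorem comul_basisFun :
    Coalgebra.comul (R := A) (basisFun A 0) = basisFun A 0 ⊗ₜ basisFun A 0 ∧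
    Coalgebra.comul (R := A) (basisFun A 1) = basisFun A 1 ⊗ₜ basisFun A 1 ∧
    Coalgebra.comul (R := A) (basisFun A 2) =
      basisFun A 2 ⊗ₜ basisFun A 2 + basisFun A 4 ⊗ₜ basisFun A 5 ∧
    Coalgebra.comul (R := A) (basisFun A 3) =
      basisFun A 3 ⊗ₜ basisFun A 3 + basisFun A 5 ⊗ₜ basisFun A 4 ∧
    Coalgebra.comul (R := A) (basisFun A 4) =
      basisFun A 2 ⊗ₜ basisFun A 4 + basisFun A 4 ⊗ₜ basisFun A 3 ∧
    Coalgebra.comul (R := A) (basisFun A 5) =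
      basisFun A 3 ⊗ₜ basisFun A 5 + basisFun A 5 ⊗ₜ basisFun A 2 :=
  comul_table A

end Coefficients

end GRing

/-! ### Isotypic components -/

namespace GAlgebra

section Components

variable (X : GAlgebra.{u})

/-- The coordinates of the coaction, as operators on the comodule: `ρ a = ∑ i, comp i a ⊗ bᵢ`. -/
def comp (i : Fin 6) : X.carrier →ₗ[X.base] X.carrier :=
  (TensorProduct.rid X.base X.carrier).toLinearMap ∘ₗ
    (GRing.coeff X.base i).lTensor X.carrier ∘ₗ X.coact

theorem rid_lTensor_sum {M : Type*} [AddCommGroup M] [Module X.base M]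
    (t : M ⊗[X.base] GRing X.base) :
    ∑ i, TensorProduct.rid X.base M ((GRing.coeff X.base i).lTensor M t) ⊗ₜ
      GRing.basisFun X.base i = t := by
  induction t with
  | zero => simp
  | tmul m p =>
    simp only [LinearMap.lTensor_tmul, TensorProduct.rid_tmul, TensorProduct.smul_tmul,
      ← TensorProduct.tmul_sum, GRing.sum_coeff]
  | add s t hs ht =>
    simp only [map_add, TensorProduct.add_tmul, Finset.sum_add_distrib, hs, ht]

theorem coact_eq (a : X.carrier) :
    X.coact a = ∑ i, X.comp i a ⊗ₜ GRing.basisFun X.base i :=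
  (X.rid_lTensor_sum _).symm

theorem comp_eq_of_coact_eq {a : X.carrier} {c : Fin 6 → X.carrier}
    (h : X.coact a = ∑ i, c i ⊗ₜ GRing.basisFun X.base i) (i : Fin 6) : X.comp i a = c i := by
  rw [comp, LinearMap.comp_apply, LinearMap.comp_apply, h]
  simp only [map_sum, LinearMap.lTensor_tmul, GRing.coeff_basisFun, LinearEquiv.coe_coe,
    TensorProduct.rid_tmul]
  simp

/-- The composition of the coordinates of the coaction is given by the structure constants of the
comultiplication. -/
theorem comp_comp_eq (i j : Fin 6) (a : X.carrier) :
    X.comp i (X.comp j a) = ∑ k, TensorProduct.rid X.base X.base (TensorProduct.map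
      (GRing.coeff X.base i) (GRing.coeff X.base j)
      (Coalgebra.comul (R := X.base) (GRing.basisFun X.base k))) • X.comp k a := by
  let T : X.carrier ⊗[X.base] (GRing X.base ⊗[X.base] GRing X.base) →ₗ[X.base] X.carrier :=
    (TensorProduct.rid X.base X.carrier).toLinearMap ∘ₗ
      ((TensorProduct.rid X.base X.base).toLinearMap ∘ₗ TensorProduct.map
      (GRing.coeff X.base i) (GRing.coeff X.base j)).lTensor X.carrier
  have hT : ∀ (m : X.carrier) t, T (m ⊗ₜ t) = TensorProduct.rid X.base X.base (TensorProduct.map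
      (GRing.coeff X.base i) (GRing.coeff X.base j) t) • m := fun m t => by simp [T]
  have h := congr(T ($X.coassoc a))
  simp only [LinearMap.comp_apply] at h
  have hl : ∀ t : X.carrier ⊗[X.base] GRing X.base,
      T ((TensorProduct.assoc X.base X.carrier (GRing X.base) (GRing X.base)).toLinearMap
        (TensorProduct.map X.coact LinearMap.id t)) = X.comp i
          (TensorProduct.rid X.base X.carrier ((GRing.coeff X.base j).lTensor X.carrier t)) := by
    intro t
    induction t with
    | zero => simp
    | tmul m p =>
      have h2 : ∀ t : X.carrier ⊗[X.base] GRing X.base,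
          T ((TensorProduct.assoc X.base X.carrier (GRing X.base) (GRing X.base)) (t ⊗ₜ p)) =
            GRing.coeff X.base j p • TensorProduct.rid X.base X.carrier
              ((GRing.coeff X.base i).lTensor X.carrier t) := fun t => by
        induction t with
        | zero => simp
        | tmul n q => simp [hT, smul_smul]
        | add s t hs ht => simp only [TensorProduct.add_tmul, map_add, hs, ht, smul_add]
      simp only [TensorProduct.map_tmul, LinearMap.id_apply, LinearEquiv.coe_coe, h2,
        LinearMap.lTensor_tmul, TensorProduct.rid_tmul, map_smul]
      rfl
    | add s t hs ht => simp only [map_add, hs, ht]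
  rw [hl] at h
  refine h.trans ?_
  rw [X.coact_eq a]
  simp only [map_sum, TensorProduct.map_tmul, LinearMap.id_apply, hT]

theorem comp_comp (a : X.carrier) :
    X.comp 0 (X.comp 0 a) = X.comp 0 a ∧ X.comp 1 (X.comp 1 a) = X.comp 1 a ∧
    X.comp 2 (X.comp 2 a) = X.comp 2 a ∧ X.comp 4 (X.comp 5 a) = X.comp 2 a ∧
    X.comp 3 (X.comp 3 a) = X.comp 3 a ∧ X.comp 5 (X.comp 4 a) = X.comp 3 a ∧
    X.comp 2 (X.comp 4 a) = X.comp 4 a ∧ X.comp 4 (X.comp 3 a) = X.comp 4 a ∧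
    X.comp 3 (X.comp 5 a) = X.comp 5 a ∧ X.comp 5 (X.comp 2 a) = X.comp 5 a := by
  obtain ⟨c0, c1, c2, c3, c4, c5⟩ := GRing.comul_basisFun X.base
  refine ⟨?_, ?_, ?_, ?_, ?_, ?_, ?_, ?_, ?_, ?_⟩ <;>
  simp [comp_comp_eq, Fin.sum_univ_six, c0, c1, c2, c3, c4, c5, GRing.coeff_basisFun]

/-- The composites of coordinates of the coaction for which the structure constants vanish. -/
theorem comp_comp_zero (a : X.carrier) :
    (∀ i : Fin 6, i ≠ 0 → X.comp i (X.comp 0 a) = 0) ∧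
    (∀ i : Fin 6, i ≠ 1 → X.comp i (X.comp 1 a) = 0) ∧
    (∀ i : Fin 6, i ≠ 2 → i ≠ 5 → X.comp i (X.comp 2 a) = 0) ∧
    (∀ i : Fin 6, i ≠ 3 → i ≠ 4 → X.comp i (X.comp 3 a) = 0) := by
  obtain ⟨c0, c1, c2, c3, c4, c5⟩ := GRing.comul_basisFun X.base
  refine ⟨fun i h => ?_, fun i h => ?_, fun i h h' => ?_, fun i h h' => ?_⟩ <;>
  simp [comp_comp_eq, Fin.sum_univ_six, c0, c1, c2, c3, c4, c5, GRing.coeff_basisFun, h] <;>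
  simp [h']

theorem sum_comp (a : X.carrier) : X.comp 0 a + X.comp 1 a + X.comp 2 a + X.comp 3 a = a := by
  obtain ⟨e0, e1, e2, e3, e4, e5⟩ := GRing.counit_table X.base
  have h := congr($X.counit a)
  simp only [LinearMap.comp_apply, X.coact_eq a, Fin.sum_univ_six, map_add,
    TensorProduct.map_tmul, GRing.basisFun, Matrix.cons_val, e0, e1, e2, e3, e4, e5] at h
  simpa using h

variable {X} {Y : GAlgebra.{u}}

/-- Equivariant maps commute with the coordinates of the coaction. -/
theorem comp_map_of_coact {A B : Alg.{u}} {φ : A ⟶ B} {M N : Type*} [AddCommGroup M] [Module A M]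
    [AddCommGroup N] [Module B N] (f : M →ₛₗ[rh φ] N) (i : Fin 6) (t : M ⊗[A] GRing A) :
    TensorProduct.rid B N ((GRing.coeff B i).lTensor N
      (TensorProduct.map f (GRing.map (rh φ)) t)) =
      f (TensorProduct.rid A M ((GRing.coeff A i).lTensor M t)) := by
  induction t with
  | zero => simp
  | tmul m p => simp [GRing.coeff_map, LinearMap.map_smulₛₗ]
  | add s t hs ht => simp only [map_add, hs, ht]

theorem Hom.map_comp (f : Hom X Y) (i : Fin 6) (a : X.carrier) :
    f.map (X.comp i a) = Y.comp i (f.map a) := by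
  simp only [comp, LinearMap.comp_apply, f.map_coact]
  exact (comp_map_of_coact f.map i (X.coact a)).symm

theorem hom_ext {f g : X ⟶ Y} (h : Hom.base f = Hom.base g)
    (h' : ∀ a, Hom.map f a = Hom.map g a) : f = g := by
  obtain ⟨b, m, _⟩ := f
  obtain ⟨b', m', _⟩ := g
  obtain rfl : b = b' := h
  obtain rfl : m = m' := LinearMap.ext h'
  rfl

end Components

end GAlgebra

namespace Datum

section FullyFaithful

variable (χ : Datum.{u})

theorem algCoact_eq_sum (v : χ.Carrier) : χ.algCoact v =
    ∑ i, (![χ.in₀ v.1, χ.inL v.2.1, χ.in₁ v.2.2.1, χ.in₂ v.2.2.2, χ.in₁ v.2.2.2,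
      χ.in₂ v.2.2.1] i : χ.Carrier) ⊗ₜ[χ.base] GRing.basisFun χ.base i := by
  rw [algCoact_apply, Fin.sum_univ_six]
  simp only [GRing.basisFun, Matrix.cons_val]
  abel

theorem comp_apply (i : Fin 6) (v : χ.Carrier) : χ.toGAlgebra.comp i v =
    (![χ.in₀ v.1, χ.inL v.2.1, χ.in₁ v.2.2.1, χ.in₂ v.2.2.2, χ.in₁ v.2.2.2, χ.in₂ v.2.2.1] i :
      χ.Carrier) :=
  χ.toGAlgebra.comp_eq_of_coact_eq (χ.algCoact_eq_sum v) i

theorem eq_sum_in (v : χ.Carrier) :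
    v = χ.in₀ v.1 + χ.inL v.2.1 + χ.in₁ v.2.2.1 + χ.in₂ v.2.2.2 := by
  simp [in₀, inL, in₁, in₂]

/-- The projection of `A_χ` to `L`. -/
def prL : χ.Carrier →ₗ[χ.base] χ.L := LinearMap.fst _ _ _ ∘ₗ LinearMap.snd _ _ _

/-- The projection of `A_χ` to `F₁`. -/
def pr₁ : χ.Carrier →ₗ[χ.base] χ.F :=
  LinearMap.fst _ _ _ ∘ₗ LinearMap.snd _ _ _ ∘ₗ LinearMap.snd _ _ _

variable {χ} {χ' : Datum.{u}}

section Components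

variable {b : χ.base ⟶ χ'.base} {k : χ.Carrier →ₛₗ[rh b] χ'.Carrier}

/-- Equivariance forces a map `A_χ → A_χ'` to preserve the summands, and to act in the same way on
`F₁` and `F₂`. -/
theorem map_in_eq (h1 : k (χ.in₀ 1) = χ'.in₀ 1)
    (hk : ∀ i v, k (χ.toGAlgebra.comp i v) = χ'.toGAlgebra.comp i (k v))
    (a : χ.base) (l : χ.L) (v : χ.F) :
    k (χ.in₀ a) = χ'.in₀ (rh b a) ∧ k (χ.inL l) = χ'.inL (χ'.prL (k (χ.inL l))) ∧
    k (χ.in₁ v) = χ'.in₁ (χ'.pr₁ (k (χ.in₁ v))) ∧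
    k (χ.in₂ v) = χ'.in₂ (χ'.pr₁ (k (χ.in₁ v))) := by
  have hk' := fun i v => (congrArg k (χ.comp_apply i v)).symm.trans
    ((hk i v).trans (χ'.comp_apply i (k v)))
  refine ⟨?_, hk' 1 (χ.inL l), hk' 2 (χ.in₁ v), hk' 5 (χ.in₁ v)⟩
  have e1 : χ.in₀ a = a • χ.in₀ 1 := by rw [← map_smul, smul_eq_mul, mul_one]
  have e2 : χ'.in₀ (rh b a) = rh b a • χ'.in₀ 1 := by rw [← map_smul, smul_eq_mul, mul_one]
  rw [e1, e2, k.map_smulₛₗ, h1]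

/-- The arrow of `𝒴` given by a map `A_χ → A_χ'`. -/
theorem exists_hom_of_map (hp : IsPullback (rh b) k) (h1 : k (χ.in₀ 1) = χ'.in₀ 1)
    (hk : ∀ i v, k (χ.toGAlgebra.comp i v) = χ'.toGAlgebra.comp i (k v))
    (hm : ∀ v w, k (χ.algMul v w) = χ'.algMul (k v) (k w)) :
    ∃ f : χ ⟶ χ', Hom.base f = b ∧ ∀ v, Hom.mapCarrier f v = k v := by
  let mL : χ.L →ₛₗ[rh b] χ'.L :=
    { toFun := fun l => χ'.prL (k (χ.inL l))
      map_add' := fun l l' => by rw [map_add, map_add, map_add]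
      map_smul' := fun a l => by rw [map_smul, k.map_smulₛₗ, map_smul] }
  let mF : χ.F →ₛₗ[rh b] χ'.F :=
    { toFun := fun l => χ'.pr₁ (k (χ.in₁ l))
      map_add' := fun l l' => by rw [map_add, map_add, map_add]
      map_smul' := fun a l => by rw [map_smul, k.map_smulₛₗ, map_smul] }
  have h₀ : ∀ a, k (χ.in₀ a) = χ'.in₀ (rh b a) := fun a => (map_in_eq h1 hk a 0 0).1
  have hL : ∀ l, k (χ.inL l) = χ'.inL (mL l) := fun l => (map_in_eq h1 hk 0 l 0).2.1
  have h₁ : ∀ v, k (χ.in₁ v) = χ'.in₁ (mF v) := fun v => (map_in_eq h1 hk 0 0 v).2.2.1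
  have h₂ : ∀ v, k (χ.in₂ v) = χ'.in₂ (mF v) := fun v => (map_in_eq h1 hk 0 0 v).2.2.2
  have hz : ∀ v : χ.Carrier, k v = (rh b v.1, mL v.2.1, mF v.2.2.1, mF v.2.2.2) := fun v => by
    have e := congrArg k (χ.eq_sum_in v)
    rw [map_add, map_add, map_add, h₀, hL, h₁, h₂] at e
    rw [e]
    simp [in₀, inL, in₁, in₂]
  let f : Hom χ χ' :=
    { base := b
      mapL := mL
      mapF := mF
      pullbackL := hp.retract χ.inL χ.prL χ'.inL χ'.prL (fun _ => rfl) (fun _ => rfl) hL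
        (fun v => by rw [hz]; rfl)
      pullbackF := hp.retract χ.in₁ χ.pr₁ χ'.in₁ χ'.pr₁ (fun _ => rfl) (fun _ => rfl) h₁
        (fun v => by rw [hz]; rfl)
      map_α := fun l v => by
        have h := hm (χ.inL l) (χ.in₁ v)
        rw [hL, h₁, (χ.algMul_table 0 0 l 0 v 0).2.2.2.2.2.2.2.2.1,
          (χ'.algMul_table 0 0 (mL l) 0 (mF v) 0).2.2.2.2.2.2.2.2.1, h₁] at h
        exact congrArg χ'.pr₁ h
      map_β := fun u v => by
        have h := hm (χ.in₁ u) (χ.in₁ v)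
        rw [h₁, h₁, (χ.algMul_table 0 0 0 0 u v).2.2.2.2.2.2.2.2.2.2.2.2.1,
          (χ'.algMul_table 0 0 0 0 (mF u) (mF v)).2.2.2.2.2.2.2.2.2.2.2.2.1, h₂] at h
        exact congr($h.2.2.2)
      map_ω := fun u v => by
        have h := hm (χ.in₁ u) (χ.in₂ v)
        rw [h₁, h₂, (χ.algMul_table 0 0 0 0 u v).2.2.2.2.2.2.2.2.2.2.2.2.2.2.1,
          (χ'.algMul_table 0 0 0 0 (mF u) (mF v)).2.2.2.2.2.2.2.2.2.2.2.2.2.2.1, map_add, h₀,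
          hL] at h
        have h' := congrArg χ'.prL h
        rw [map_add, map_add] at h'
        have e : ∀ (a : χ'.base) (l : χ'.L), χ'.prL (χ'.in₀ a) + χ'.prL (χ'.inL l) = l :=
          fun a l => zero_add l
        rwa [e, e] at h' }
  exact ⟨f, rfl, fun v => (hz v).symm⟩

end Components

theorem hom_ext {f g : χ ⟶ χ'} (h : Hom.base f = Hom.base g)
    (hL : ∀ l, Hom.mapL f l = Hom.mapL g l) (hF : ∀ v, Hom.mapF f v = Hom.mapF g v) : f = g := by
  obtain ⟨b, l, m, _⟩ := f
  obtain ⟨b', l', m', _⟩ := g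
  obtain rfl : b = b' := h
  obtain rfl : l = l' := LinearMap.ext hL
  obtain rfl : m = m' := LinearMap.ext hF
  rfl

instance : toGAlgebraFunctor.{u}.Full where
  map_surjective {χ χ'} g := by
    obtain ⟨f, hf, hf'⟩ := exists_hom_of_map (χ := χ) (χ' := χ') (b := GAlgebra.Hom.base g)
      (k := GAlgebra.Hom.map g) (GAlgebra.Hom.pullback g) (GAlgebra.Hom.map_one g)
      (GAlgebra.Hom.map_comp g) (GAlgebra.Hom.map_mul g)
    exact ⟨f, GAlgebra.hom_ext hf hf'⟩

instance : toGAlgebraFunctor.{u}.Faithful where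
  map_injective {χ χ' f g} h := by
    have hb : Hom.base f = Hom.base g := congrArg GAlgebra.Hom.base h
    have hc : ∀ v : χ.Carrier, Hom.mapCarrier f v = Hom.mapCarrier g v := fun v =>
      congrArg (fun k : χ.toGAlgebra ⟶ χ'.toGAlgebra => GAlgebra.Hom.map k v) h
    exact hom_ext hb (fun l => congr($(hc (χ.inL l)).2.1)) (fun v => congr($(hc (χ.in₁ v)).2.2.1))

end FullyFaithful

end Datum

/-! ### Traces and bilinear maps on modules of rank one and two -/

section Rank

theorem trace_eq_sum {A : Type*} [CommRing A] {M : Type*} [AddCommGroup M] [Module A M]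
    [Module.Finite A M] [Module.Projective A M] {ι : Type*} [Fintype ι] {x : ι → M}
    {ξ : ι → M →ₗ[A] A} (hx : ∀ m, ∑ i, ξ i m • x i = m) (g : M →ₗ[A] M) :
    trace g = ∑ i, ξ i (g (x i)) := by
  have : g = dualTensorHom A M M (∑ i, ξ i ⊗ₜ g (x i)) := by
    ext m
    conv_lhs => rw [← hx m]
    simp [map_sum, LinearMap.sum_apply]
  conv_lhs => rw [this]
  rw [trace_dualTensorHom]
  simp [map_sum]

theorem trace_pi {C : Type*} [CommRing C] {n : ℕ} (g : (Fin n → C) →ₗ[C] (Fin n → C)) :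
    trace g = ∑ i, g (Pi.single i 1) i :=
  trace_eq_sum (x := fun i => Pi.single i 1) (ξ := fun i => LinearMap.proj i)
    (fun v => pi_sum_single v) g

/-- Base change of bilinear maps. -/
theorem IsPullback.exists_bilinear {A B : Type*} [CommRing A] [CommRing B] {φ : A →+* B}
    {M N P M' N' P' : Type*} [AddCommGroup M] [Module A M] [AddCommGroup N] [Module A N]
    [AddCommGroup P] [Module A P] [AddCommGroup M'] [Module B M'] [AddCommGroup N'] [Module B N']
    [AddCommGroup P'] [Module B P'] {h : M →ₛₗ[φ] M'} {k : N →ₛₗ[φ] N'} (hh : IsPullback φ h)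
    (hk : IsPullback φ k) (f : M →ₗ[A] N →ₗ[A] P) (g : P →ₛₗ[φ] P') :
    ∃ f' : M' →ₗ[B] N' →ₗ[B] P', ∀ m n, f' (h m) (k n) = g (f m n) := by
  choose t ht using fun m => hk.exists_lift
    (Q := P') { toFun := fun n => g (f m n)
                map_add' := fun n n' => by rw [map_add, map_add]
                map_smul' := fun a n => by rw [map_smul, g.map_smulₛₗ] }
  obtain ⟨f', hf'⟩ := hh.exists_lift (Q := N' →ₗ[B] P')
    { toFun := t
      map_add' := fun m m' => hk.ext fun n => by
        rw [LinearMap.add_apply, ht, ht, ht]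
        change g _ = g _ + g _
        rw [map_add, LinearMap.add_apply, map_add]
      map_smul' := fun a m => hk.ext fun n => by
        rw [LinearMap.smul_apply, ht, ht]
        change g _ = φ a • g _
        rw [map_smul, LinearMap.smul_apply, g.map_smulₛₗ] }
  exact ⟨f', fun m n => by rw [hf']; exact ht m n⟩

variable {A : Alg.{u}} {M N : Type u} [AddCommGroup M] [Module A M] [Module.Finite A M]
  [Module.Projective A M] [AddCommGroup N] [Module A N]

/-- Locally free modules of rank `n` have a frame over a faithfully flat extension of finite
presentation. -/
theorem exists_frame {n : ℕ} (hr : ∀ p : PrimeSpectrum A, Module.rankAtStalk (R := A) M p = n) :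
    ∃ (B : Alg.{u}) (φ : A ⟶ B) (h : M →ₛₗ[rh φ] (Fin n → B)), (rh φ).FaithfullyFlat ∧
      (rh φ).FinitePresentation ∧ IsPullback (rh φ) h :=
  let E : Bundle.{u} n := { base := A, F := M, rankF := hr }
  ⟨_, _, E.frames.frame, E.frames.faithfullyFlat, E.frames.finitePresentation, E.frames.isPullback⟩

/-- Bilinear maps on an invertible module are symmetric. -/
theorem bilinear_symm_of_rank_one
    (hr : ∀ p : PrimeSpectrum A, Module.rankAtStalk (R := A) M p = 1)
    (f : M →ₗ[A] M →ₗ[A] N) (l l' : M) : f l l' = f l' l := by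
  obtain ⟨B, φ, h, hφ, -, hh⟩ := exists_frame hr
  have hg := isPullback_baseChangeMap (M := N) (rh φ)
  refine hg.injective hφ ?_
  obtain ⟨f', hf'⟩ := hh.exists_bilinear hh f (baseChangeMap (rh φ) N)
  have hs : ∀ v : Fin 1 → B, v = v 0 • (1 : Fin 1 → B) := fun v => by
    ext i
    fin_cases i
    simp
  rw [← hf', ← hf', hs (h l), hs (h l')]
  simp only [map_smul, LinearMap.smul_apply]
  exact smul_comm _ _ _

/-- Endomorphisms of an invertible module are scalars. -/
theorem apply_eq_trace_smul_of_rank_one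
    (hr : ∀ p : PrimeSpectrum A, Module.rankAtStalk (R := A) M p = 1) (g : M →ₗ[A] M) (l : M) :
    g l = trace g • l := by
  obtain ⟨n, x, ξ, hx⟩ := exists_dualBasis A M
  rw [trace_eq_sum hx, Finset.sum_smul]
  conv_lhs => rw [← hx (g l)]
  exact Finset.sum_congr rfl fun i _ => bilinear_symm_of_rank_one hr
    (LinearMap.lsmul A M ∘ₗ (ξ i ∘ₗ g)) l (x i)

/-- A frame, together with the matrix of an endomorphism in it. -/
theorem exists_frame_endo {n : ℕ}
    (hr : ∀ p : PrimeSpectrum A, Module.rankAtStalk (R := A) M p = n) (g : M →ₗ[A] M) :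
    ∃ (B : Alg.{u}) (φ : A ⟶ B) (h : M →ₛₗ[rh φ] (Fin n → B))
      (g' : (Fin n → B) →ₗ[B] (Fin n → B)), (rh φ).FaithfullyFlat ∧ IsPullback (rh φ) h ∧
        (∀ m, g' (h m) = h (g m)) ∧ rh φ (trace g) = ∑ i, g' (Pi.single i 1) i ∧
        rh φ (trace (g ∘ₗ g)) = ∑ i, g' (g' (Pi.single i 1)) i := by
  obtain ⟨B, φ, h, hφ, -, hh⟩ := exists_frame hr
  obtain ⟨g', hg'⟩ := hh.exists_lift (h.comp g)
  refine ⟨B, φ, h, g', hφ, hh, hg', ?_, ?_⟩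
  · rw [← trace_pi, trace_pullback hh g g' hg']
  · rw [← trace_pullback hh (g ∘ₗ g) (g' ∘ₗ g') fun m => by
      rw [LinearMap.comp_apply, hg', LinearMap.comp_apply, hg', LinearMap.comp_apply,
        LinearMap.comp_apply], trace_pi]
    rfl

theorem trace_id_of_rank {n : ℕ}
    (hr : ∀ p : PrimeSpectrum A, Module.rankAtStalk (R := A) M p = n) :
    trace (LinearMap.id : M →ₗ[A] M) = n := by
  obtain ⟨B, φ, h, hφ, -, hh⟩ := exists_frame hr
  refine hφ.injective ?_
  rw [← trace_pullback hh LinearMap.id (LinearMap.id) (fun _ => rfl), trace_pi, map_natCast]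
  simp

theorem trace_smul_id_of_rank {n : ℕ}
    (hr : ∀ p : PrimeSpectrum A, Module.rankAtStalk (R := A) M p = n) (a : A) {g : M →ₗ[A] M}
    (hg : ∀ m, g m = a • m) : trace g = n * a := by
  have : g = a • LinearMap.id := LinearMap.ext hg
  rw [this, map_smul, trace_id_of_rank hr, smul_eq_mul, mul_comm]

theorem pi_two_eq {C : Type*} [CommRing C] (v : Fin 2 → C) :
    v = v 0 • (Pi.single 0 1 : Fin 2 → C) + v 1 • (Pi.single 1 1 : Fin 2 → C) := by
  ext i
  fin_cases i <;> simp

/-- On a module of rank two, the trace is the infinitesimal action on alternating forms. -/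
theorem alternating_add_of_rank_two
    (hr : ∀ p : PrimeSpectrum A, Module.rankAtStalk (R := A) M p = 2) (g : M →ₗ[A] M)
    (ω : M →ₗ[A] M →ₗ[A] N) (hω : ∀ u, ω u u = 0) (u v : M) :
    ω (g u) v + ω u (g v) = trace g • ω u v := by
  obtain ⟨B, φ, h, g', hφ, hh, hg', ht, -⟩ := exists_frame_endo hr g
  let k := baseChangeMap (rh φ) N
  have hg := isPullback_baseChangeMap (M := N) (rh φ)
  refine hg.injective hφ ?_
  obtain ⟨f', hf'⟩ := hh.exists_bilinear hh ω k
  -- the extended form is alternating on the standard basis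
  have hsw : ∀ u v, ω u v = -ω v u := fun u v => by
    have := hω (u + v)
    simp only [map_add, LinearMap.add_apply, hω, zero_add, add_zero] at this
    exact eq_neg_of_add_eq_zero_right this
  have hsw' : ∀ x y, f' x y = -f' y x := fun x y => by
    have e : f' + f'.flip = 0 := hh.ext fun u => hh.ext fun v => by
      rw [LinearMap.add_apply, LinearMap.add_apply, LinearMap.flip_apply, hf', hf', hsw, map_neg,
        neg_add_cancel]
      rfl
    exact eq_neg_of_add_eq_zero_left congr($e x y)
  have hz : ∀ x, f' x x = 0 := fun x => by
    refine eq_zero_of_add_self (A := B) ?_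
    nth_rewrite 1 [hsw']
    exact neg_add_cancel _
  change k _ = k _
  rw [map_add, k.map_smulₛₗ, ← hf', ← hf', ← hf', ← hg', ← hg', ht, Fin.sum_univ_two]
  generalize h u = x
  generalize h v = y
  set e₀ : Fin 2 → B := Pi.single 0 1
  set e₁ : Fin 2 → B := Pi.single 1 1
  have hx : x = x 0 • e₀ + x 1 • e₁ := pi_two_eq x
  have hy : y = y 0 • e₀ + y 1 • e₁ := pi_two_eq y
  have h0 : g' e₀ = g' e₀ 0 • e₀ + g' e₀ 1 • e₁ := pi_two_eq (g' e₀)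
  have h1 : g' e₁ = g' e₁ 0 • e₀ + g' e₁ 1 • e₁ := pi_two_eq (g' e₁)
  generalize g' e₀ 0 = a at *
  generalize g' e₀ 1 = b at *
  generalize g' e₁ 0 = c at *
  generalize g' e₁ 1 = d at *
  rw [hx, hy]
  simp only [map_add, map_smul, LinearMap.add_apply, LinearMap.smul_apply, h0, h1, hz,
    hsw' e₁ e₀]
  module

/-- The theorem of Cayley and Hamilton in rank two. -/
theorem cayley_hamilton_of_rank_two
    (hr : ∀ p : PrimeSpectrum A, Module.rankAtStalk (R := A) M p = 2) (g : M →ₗ[A] M) (u : M) :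
    g (g u) + (hf A * (trace g * trace g - trace (g ∘ₗ g))) • u = trace g • g u := by
  obtain ⟨B, φ, h, g', hφ, hh, hg', ht, ht'⟩ := exists_frame_endo hr g
  refine hh.injective hφ ?_
  rw [map_add, h.map_smulₛₗ, h.map_smulₛₗ, ← hg', ← hg', map_mul, map_sub, map_mul, ht, ht',
    Fin.sum_univ_two, Fin.sum_univ_two, rh_hf]
  generalize h u = x
  set e₀ : Fin 2 → B := Pi.single 0 1 with he₀
  set e₁ : Fin 2 → B := Pi.single 1 1 with he₁
  have hx : x = x 0 • e₀ + x 1 • e₁ := pi_two_eq x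
  have h0 : g' e₀ = g' e₀ 0 • e₀ + g' e₀ 1 • e₁ := pi_two_eq (g' e₀)
  have h1 : g' e₁ = g' e₁ 0 • e₀ + g' e₁ 1 • e₁ := pi_two_eq (g' e₁)
  have k0 : g' (g' e₀) 0 = g' e₀ 0 * g' e₀ 0 + g' e₀ 1 * g' e₁ 0 := by
    conv_lhs => rw [h0]
    simp [he₀, he₁]
  have k1 : g' (g' e₁) 1 = g' e₁ 0 * g' e₀ 1 + g' e₁ 1 * g' e₁ 1 := by
    conv_lhs => rw [h1]
    simp [he₀, he₁]
  rw [k0, k1]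
  generalize g' e₀ 0 = a at *
  generalize g' e₀ 1 = b at *
  generalize g' e₁ 0 = c at *
  generalize g' e₁ 1 = d at *
  have h2 := two_mul_hf B
  have e : hf B * ((a + d) * (a + d) - (a * a + b * c + (c * b + d * d))) = a * d - b * c := by
    linear_combination (a * d - b * c) * h2
  rw [e, hx]
  simp only [map_add, map_smul, h0, h1, smul_add]
  module

end Rank

/-! ### The covers attached to triples -/

namespace Datum

section LocallyRegular

/-- The comodule `B ⊕ B ⊕ B² ⊕ B²` is the regular representation: the standard bases of the last
two summands correspond to `u₁, v₂` and to `v₁, u₂`. -/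
def toRegular (B : Alg.{u}) :
    (B × (Fin 1 → B) × (Fin 2 → B) × (Fin 2 → B)) →ₗ[B] GRing B where
  toFun v := ∑ i, (![v.1, v.2.1 0, v.2.2.1 0, v.2.2.2 1, v.2.2.2 0, v.2.2.1 1] i : B) •
    GRing.basisFun B i
  map_add' v w := by
    simp only [Fin.sum_univ_six, Matrix.cons_val, Prod.fst_add, Prod.snd_add, Pi.add_apply,
      add_smul]
    abel
  map_smul' a v := by
    simp only [Fin.sum_univ_six, Matrix.cons_val, Prod.smul_fst, Prod.smul_snd, Pi.smul_apply,
      smul_assoc, smul_add, RingHom.id_apply]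

theorem toRegular_apply (B : Alg.{u}) (v : B × (Fin 1 → B) × (Fin 2 → B) × (Fin 2 → B)) :
    toRegular B v = ∑ i, (![v.1, v.2.1 0, v.2.2.1 0, v.2.2.2 1, v.2.2.2 0, v.2.2.1 1] i : B) •
      GRing.basisFun B i := rfl

theorem coeff_toRegular (B : Alg.{u}) (i : Fin 6)
    (v : B × (Fin 1 → B) × (Fin 2 → B) × (Fin 2 → B)) :
    GRing.coeff B i (toRegular B v) =
      (![v.1, v.2.1 0, v.2.2.1 0, v.2.2.2 1, v.2.2.2 0, v.2.2.1 1] i : B) := by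
  rw [toRegular_apply]
  simp only [map_sum, map_smul, GRing.coeff_basisFun, smul_eq_mul]
  simp

theorem toRegular_bijective (B : Alg.{u}) : Function.Bijective (toRegular B) := by
  refine ⟨fun v w h => ?_, fun p => ?_⟩
  · have h' := fun i => (coeff_toRegular B i v).symm.trans
      ((congrArg (GRing.coeff B i) h).trans (coeff_toRegular B i w))
    refine Prod.ext (h' 0) (Prod.ext ?_ (Prod.ext ?_ ?_))
    · ext i; fin_cases i; exact h' 1
    · ext i; fin_cases i
      exacts [h' 2, h' 5]
    · ext i; fin_cases i
      exacts [h' 4, h' 3]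
  · refine ⟨(GRing.coeff B 0 p, ![GRing.coeff B 1 p], ![GRing.coeff B 2 p, GRing.coeff B 5 p],
      ![GRing.coeff B 4 p, GRing.coeff B 3 p]), ?_⟩
    conv_rhs => rw [← GRing.sum_coeff B p]
    rw [toRegular_apply]
    refine Finset.sum_congr rfl fun i _ => ?_
    fin_cases i <;> rfl

variable {χ : Datum.{u}} {B : Alg.{u}} {φ : χ.base ⟶ B} (l : χ.L →ₛₗ[rh φ] (Fin 1 → B))
  (k : χ.F →ₛₗ[rh φ] (Fin 2 → B))

/-- The map on `A_χ` given by frames of `L` and `F`. -/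
def frameMap : χ.Carrier →ₛₗ[rh φ] (B × (Fin 1 → B) × (Fin 2 → B) × (Fin 2 → B)) where
  toFun v := (rh φ v.1, l v.2.1, k v.2.2.1, k v.2.2.2)
  map_add' v w := by ext <;> simp
  map_smul' c v := by ext <;> simp

/-- The map from `A_χ` to the regular representation over `B` given by frames of `L` and `F`. -/
def regularMap : χ.Carrier →ₛₗ[rh φ] GRing B := (toRegular B).comp (frameMap l k)

theorem regularMap_apply (v : χ.Carrier) : regularMap l k v =
    toRegular B (rh φ v.1, l v.2.1, k v.2.2.1, k v.2.2.2) := rfl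

theorem isPullback_regularMap {l : χ.L →ₛₗ[rh φ] (Fin 1 → B)} {k : χ.F →ₛₗ[rh φ] (Fin 2 → B)}
    (hl : IsPullback (rh φ) l) (hk : IsPullback (rh φ) k) :
    IsPullback (rh φ) (regularMap l k) := by
  have hp₂ := IsPullback.prod hk hk
    { toFun := fun v => (k v.1, k v.2)
      map_add' := fun v w => by ext <;> simp
      map_smul' := fun c v => by ext <;> simp } (fun _ => rfl)
  have hp₁ := IsPullback.prod hl hp₂
    { toFun := fun v => (l v.1, k v.2.1, k v.2.2)
      map_add' := fun v w => by ext <;> simp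
      map_smul' := fun c v => by ext <;> simp } (fun _ => rfl)
  have hp₀ := IsPullback.prod (isPullback_ringHom (rh φ)
    { toFun := rh φ, map_add' := map_add _, map_smul' := map_mul _ } (fun _ => rfl)) hp₁
    (frameMap l k) (fun _ => rfl)
  exact hp₀.comp (ψ := RingHom.id B)
    (isPullback_of_bijective Function.bijective_id (toRegular_bijective B)) (fun _ => rfl) _
    (fun _ => rfl)

theorem regularMap_in (a : χ.base) (m : χ.L) (v : χ.F) :
    regularMap l k (χ.in₀ a) = rh φ a • GRing.basisFun B 0 ∧
    regularMap l k (χ.inL m) = l m 0 • GRing.basisFun B 1 ∧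
    regularMap l k (χ.in₁ v) = k v 0 • GRing.basisFun B 2 + k v 1 • GRing.basisFun B 5 ∧
    regularMap l k (χ.in₂ v) = k v 0 • GRing.basisFun B 4 + k v 1 • GRing.basisFun B 3 := by
  refine ⟨?_, ?_, ?_, ?_⟩ <;>
  simp [regularMap_apply, toRegular_apply, in₀, inL, in₁, in₂, Fin.sum_univ_six]
  exact add_comm _ _

theorem comul_regularMap (v : χ.Carrier) : Coalgebra.comul (R := B) (regularMap l k v) =
    TensorProduct.map (regularMap l k) (GRing.map (rh φ)) (χ.algCoact v) := by
  obtain ⟨t1, t2, t3, t4, t5, t6⟩ := GRing.map_table χ.base (rh φ)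
  obtain ⟨c1, c2, c3, c4, c5, c6⟩ := GRing.comul_table B
  have p1 := fun a => (regularMap_in l k a 0 0).1
  have p2 := fun m => (regularMap_in l k 0 m 0).2.1
  have p3 := fun v => (regularMap_in l k 0 0 v).2.2.1
  have p4 := fun v => (regularMap_in l k 0 0 v).2.2.2
  simp only [GRing.basisFun, Matrix.cons_val] at p1 p2 p3 p4
  refine χ.carrier_induction (p := fun v => Coalgebra.comul (R := B) (regularMap l k v) =
    TensorProduct.map (regularMap l k) (GRing.map (rh φ)) (χ.algCoact v))
    (fun a => ?_) (fun a => ?_) (fun a => ?_) (fun a => ?_)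
    (fun v v' hv hv' => by simp only [map_add, hv, hv']) v <;>
  simp only [p1, p2, p3, p4, algCoact_in₀, algCoact_inL, algCoact_in₁, algCoact_in₂,
    map_add, map_smul, TensorProduct.map_tmul, t1, t2, t3, t4, t5, t6, c1, c2, c3, c4, c5, c6,
    TensorProduct.smul_tmul', TensorProduct.add_tmul, smul_add] <;>
  abel

variable (χ)

/-- Frames of `L` and of `F` over a common cover. -/
theorem exists_frames : ∃ (B : Alg.{u}) (φ : χ.base ⟶ B) (l : χ.L →ₛₗ[rh φ] (Fin 1 → B))
    (k : χ.F →ₛₗ[rh φ] (Fin 2 → B)), (rh φ).FaithfullyFlat ∧ (rh φ).FinitePresentation ∧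
      IsPullback (rh φ) l ∧ IsPullback (rh φ) k := by
  obtain ⟨S, φ, l, hφ, hφ', hl⟩ := exists_frame χ.rankL
  obtain ⟨T, ψ, k, hψ, hψ', hk⟩ := exists_frame χ.rankF
  obtain ⟨B, s, t, hst, hff, hfp⟩ := exists_pushout φ ψ
  obtain ⟨k', hk'⟩ : ∃ k' : χ.F →ₛₗ[rh (φ ≫ s)] (Fin 2 → B), IsPullback (rh (φ ≫ s)) k' := by
    rw [hst]
    exact ⟨compS (mapVec 2 t) k, (isPullback_mapVec t).compS hk⟩
  exact ⟨B, φ ≫ s, compS (mapVec 1 s) l, k',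
    RingHom.FaithfullyFlat.stableUnderComposition _ _ hφ (hff hψ), (hfp hψ').comp hφ',
    (isPullback_mapVec s).compS hl, hk'⟩

/-- `A_χ` is locally the regular representation. -/
theorem exists_regular : ∃ (B : Alg.{u}) (φ : χ.base ⟶ B), (rh φ).FaithfullyFlat ∧
    (rh φ).FinitePresentation ∧ ∃ f : χ.Carrier →ₛₗ[rh φ] GRing B, IsPullback (rh φ) f ∧
      ∀ a, Coalgebra.comul (R := B) (f a) =
        TensorProduct.map f (GRing.map (rh φ)) (χ.algCoact a) := by
  obtain ⟨B, φ, l, k, hφ, hφ', hl, hk⟩ := χ.exists_frames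
  exact ⟨B, φ, hφ, hφ', regularMap l k, isPullback_regularMap hl hk, comul_regularMap l k⟩

end LocallyRegular

end Datum

/-! ### Triples and `Z₂` -/

namespace Datum

variable {χ : Datum.{u}} {μ : χ.L →ₗ[χ.base] χ.base}

theorem trace_α_of_smul (hα : ∀ l u, χ.α l u = μ l • u) (l : χ.L) :
    trace (χ.α l) = 2 * μ l := by
  rw [trace_smul_id_of_rank χ.rankF (μ l) (hα l)]
  norm_cast

theorem m_of_smul (hα : ∀ l u, χ.α l u = μ l • u) (l l' : χ.L) : χ.m l l' = μ l * μ l' := by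
  rw [m_apply, trace_smul_id_of_rank χ.rankF (μ l * μ l') fun v => by
    rw [LinearMap.comp_apply, hα, hα, smul_smul]]
  push_cast
  linear_combination (μ l * μ l') * two_mul_hf χ.base

theorem bracket_of_ω_eq_zero (hω : χ.ω = 0) (u v : χ.F) : χ.bracket u v = 0 := by
  have : (χ.α.flip v).comp (χ.ω.flip u) = 0 := by
    ext w
    simp [hω]
  rw [bracket_apply, this, map_zero]

theorem algMul_of_smul (hα : ∀ l u, χ.α l u = μ l • u) (hβ : χ.β = 0) (hω : χ.ω = 0)
    (a b : χ.base) (l k : χ.L) (u v u' v' : χ.F) :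
    χ.algMul (a, l, u, v) (b, k, u', v') =
      (a * b + μ l * μ k, a • k + b • l, (a + μ l) • u' + (b + μ k) • u,
        (a - μ l) • v' + (b - μ k) • v) := by
  simp only [algMul, LinearMap.mk₂_apply, m_of_smul hα, bracket_of_ω_eq_zero hω, hα, hβ, hω,
    LinearMap.zero_apply, add_zero, sub_zero]
  refine Prod.ext rfl (Prod.ext rfl (Prod.ext ?_ ?_))
  all_goals
    dsimp only
    module

/-- For `α = μ ⊗ id` and `β = ⟨-,-⟩ = 0` the algebra `A_χ` is commutative and associative.
Associativity on `L ⊗ L ⊗ L` holds because `(l, l') ↦ μ(l) l'` is symmetric for an invertible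
`L`. -/
theorem isGCover_of_smul (hα : ∀ l u, χ.α l u = μ l • u) (hβ : χ.β = 0) (hω : χ.ω = 0) :
    IsGCover χ.toGAlgebra := by
  have hμ : ∀ l l' : χ.L, μ l • l' = μ l' • l := fun l l' =>
    bilinear_symm_of_rank_one χ.rankL (LinearMap.lsmul χ.base χ.L ∘ₗ μ) l l'
  refine ⟨?_, ?_, χ.exists_regular⟩
  · rintro ⟨a, l, u, v⟩ ⟨b, k, u', v'⟩
    change χ.algMul _ _ = χ.algMul _ _
    rw [algMul_of_smul hα hβ hω, algMul_of_smul hα hβ hω, mul_comm b, mul_comm (μ k),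
      add_comm (b • l), add_comm ((b + μ k) • u), add_comm ((b - μ k) • v)]
  · rintro ⟨a, l, u, v⟩ ⟨b, k, u', v'⟩ ⟨c, j, u'', v''⟩
    change χ.algMul (χ.algMul _ _) _ = χ.algMul _ (χ.algMul _ _)
    simp only [algMul_of_smul hα hβ hω, map_add, map_smul, smul_eq_mul]
    refine Prod.ext ?_ (Prod.ext ?_ (Prod.ext ?_ ?_)) <;> dsimp only
    · ring
    · have h : (μ l * μ k) • j = (μ k * μ j) • l := by
        rw [mul_comm, mul_smul, mul_smul, hμ l j]
      rw [add_smul, h]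
      module
    · module
    · module

/-- `α = (tr α / 2) ⊗ id` if `α = μ ⊗ id`. -/
theorem α_eq_trace_smul {χ : Datum.{u}} {μ : χ.L →ₗ[χ.base] χ.base}
    (hα : ∀ l u, χ.α l u = μ l • u) (l : χ.L) (u : χ.F) :
    χ.α l u = (hf χ.base * trace (χ.α l)) • u := by
  rw [trace_α_of_smul hα, hα, ← mul_assoc, mul_comm (hf χ.base), two_mul_hf, one_mul]

end Datum

namespace Triple

variable (z : Triple.{u})

/-- The cover given by a triple. -/
def toGCov : Triple.{u} ⥤ GCov.{u} :=
  IsGCover.lift (toDatum ⋙ Datum.toGAlgebraFunctor) fun z =>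
    Datum.isGCover_of_smul (χ := toDatum.obj z) (μ := z.μ) (fun _ _ => rfl) rfl rfl

theorem isOfDatum_toGCov : GCov.IsOfDatum (toGCov.obj z) (toDatum.obj z) :=
  ⟨Iso.refl _, IsHomLift.map (p := GAlgebra.proj) (𝟙 (toDatum.obj z).toGAlgebra)⟩

theorem toGCov_mem_Z₂ : GCov.Z₂ (toGCov.obj z) :=
  ⟨toDatum.obj z, z.isOfDatum_toGCov, rfl, rfl,
    Datum.α_eq_trace_smul (χ := toDatum.obj z) (μ := z.μ) fun _ _ => rfl⟩

/-- The functor from triples to `Z₂`. -/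
def toZ₂ : Triple.{u} ⥤ GCov.Z₂.{u}.FullSubcategory := GCov.Z₂.lift toGCov toGCov_mem_Z₂

instance : toDatum.{u}.Faithful where
  map_injective {z z' f g} h := by
    have hb : Hom.base f = Hom.base g := congrArg Datum.Hom.base h
    have hl : ∀ l : z.L, Hom.mapL f l = Hom.mapL g l := fun l =>
      congrArg (fun k : toDatum.obj z ⟶ toDatum.obj z' => Datum.Hom.mapL k l) h
    have hv : ∀ v : z.F, Hom.mapF f v = Hom.mapF g v := fun v =>
      congrArg (fun k : toDatum.obj z ⟶ toDatum.obj z' => Datum.Hom.mapF k v) h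
    exact hom_ext (Bundle.hom_ext hb hl) (Bundle.hom_ext hb hv)

/-- `μ` can be recovered from `μ ⊗ id` by taking traces. -/
theorem eq_of_smul_eq {A : Alg.{u}} {M : Type u} [AddCommGroup M] [Module A M] [Module.Finite A M]
    [Module.Projective A M] (hr : ∀ p : PrimeSpectrum A, Module.rankAtStalk (R := A) M p = 2)
    {a b : A} (h : ∀ m : M, a • m = b • m) : a = b := by
  have h1 := trace_smul_id_of_rank hr a (g := a • LinearMap.id) fun m => rfl
  have h2 := trace_smul_id_of_rank hr b (g := a • LinearMap.id) h
  have h3 := h1.symm.trans h2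
  have h4 := two_mul_hf A
  push_cast at h3
  linear_combination (hf A) * h3 - (a - b) * h4

instance : toDatum.{u}.Full where
  map_surjective {z z'} f := by
    let b : z.base ⟶ z'.base := Datum.Hom.base f
    let mL : z.L →ₛₗ[rh b] z'.L := Datum.Hom.mapL f
    let mF : z.F →ₛₗ[rh b] z'.F := Datum.Hom.mapF f
    have hF : IsPullback (rh b) mF := Datum.Hom.pullbackF f
    have hα : ∀ l u, mF (z.μ l • u) = z'.μ (mL l) • mF u := Datum.Hom.map_α f
    have hμ : ∀ l : z.L, rh b (z.μ l) = z'.μ (mL l) := fun l => by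
      refine eq_of_smul_eq z'.rankF fun m => ?_
      have : (rh b (z.μ l)) • (LinearMap.id : z'.F →ₗ[z'.base] z'.F) =
          (z'.μ (mL l)) • LinearMap.id := hF.ext fun v => by
        have h := hα l v
        rw [mF.map_smulₛₗ] at h
        exact h
      exact congr($this m)
    exact ⟨(⟨b, mL, mF, Datum.Hom.pullbackL f, hF, hμ⟩ : Hom z z'), rfl⟩

instance : toGCov.{u}.Full :=
  haveI : (toGCov.{u} ⋙ IsGCover.ι).Full :=
    inferInstanceAs (toDatum ⋙ Datum.toGAlgebraFunctor).Full
  Functor.Full.of_comp_faithful toGCov IsGCover.ι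

instance : toGCov.{u}.Faithful :=
  haveI : (toGCov.{u} ⋙ IsGCover.ι).Faithful :=
    inferInstanceAs (toDatum ⋙ Datum.toGAlgebraFunctor).Faithful
  Functor.Faithful.of_comp toGCov IsGCover.ι

instance : toZ₂.{u}.Full :=
  haveI : (toZ₂.{u} ⋙ GCov.Z₂.ι).Full := inferInstanceAs toGCov.Full
  Functor.Full.of_comp_faithful toZ₂ GCov.Z₂.ι

instance : toZ₂.{u}.Faithful :=
  haveI : (toZ₂.{u} ⋙ GCov.Z₂.ι).Faithful := inferInstanceAs toGCov.Faithful
  Functor.Faithful.of_comp toZ₂ GCov.Z₂.ι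

theorem exists_toDatum_eq {χ : Datum.{u}} {μ : χ.L →ₗ[χ.base] χ.base}
    (hα : χ.α = LinearMap.lsmul χ.base χ.F ∘ₗ μ) (hβ : χ.β = 0) (hω : χ.ω = 0) :
    ∃ z : Triple.{u}, toDatum.obj z = χ := by
  obtain ⟨A, L, F, rL, rF, α, β, ω, hβ', hω'⟩ := χ
  obtain rfl : β = 0 := hβ
  obtain rfl : ω = 0 := hω
  change L →ₗ[A] A at μ
  change α = LinearMap.lsmul A F ∘ₗ μ at hα
  subst hα
  exact ⟨{ base := A, L := L, F := F, rankL := rL, rankF := rF, μ := μ }, rfl⟩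

/-- Every object of `Z₂` comes from a triple. -/
theorem exists_isOfDatum_of_mem_Z₂ {X : GCov.{u}} (hX : GCov.Z₂ X) :
    ∃ z : Triple.{u}, GCov.IsOfDatum X (toDatum.obj z) := by
  obtain ⟨χ, hχ, hβ, hω, hα⟩ := hX
  obtain ⟨z, hz⟩ := exists_toDatum_eq (μ := hf χ.base • (trace ∘ₗ χ.α))
    (LinearMap.ext fun l => LinearMap.ext fun v => hα l v) hβ hω
  exact ⟨z, hz ▸ hχ⟩

theorem isHomLift_of_isHomLift {P : ObjectProperty GCov.{u}} {X Y : P.FullSubcategory} (f : X ⟶ Y)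
    (h : GAlgebra.proj.IsHomLift (𝟙 Y.obj.obj.base) f.hom.hom) :
    (GCov.substack P).p.IsHomLift (𝟙 ((GCov.substack P).p.obj Y)) f := by
  have e : X.obj.obj.base = Y.obj.obj.base := @IsHomLift.domain_eq _ _ _ _ _ _ _ _ _ _ _ h
  have e' := @IsHomLift.fac' _ _ _ _ _ _ _ _ _ _ _ h
  exact IsHomLift.of_fac' _ _ _ e rfl e'

/-- The equivalence of stacks from triples to `Z₂`. -/
theorem isStackEquiv_toZ₂ :
    IsStackEquiv (X := tripleStack.{u}) (Y := GCov.substack GCov.Z₂.{u}) ⟨toZ₂, rfl⟩ := by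
  refine ⟨inferInstanceAs toZ₂.Full, inferInstanceAs toZ₂.Faithful, fun X => ?_⟩
  obtain ⟨z, i, hi⟩ := exists_isOfDatum_of_mem_Z₂ X.property
  let j : toGCov.obj z ≅ X.obj := IsGCover.isoMk i
  let k : toZ₂.obj z ≅ X := GCov.Z₂.isoMk j
  exact ⟨z, k, isHomLift_of_isHomLift k.hom hi⟩

end Triple

/-! ### Products of the isotypic parts of a cover -/

namespace GRing

variable (A : Alg.{u})

/-- Products of the basis elements, with `1 - e = (1 + s) / 2` and `e = (1 - s) / 2`. -/
theorem basisFun_mul :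
    basisFun A 1 * basisFun A 1 = basisFun A 0 ∧ basisFun A 1 * basisFun A 2 = basisFun A 2 ∧
    basisFun A 1 * basisFun A 5 = -basisFun A 5 ∧ basisFun A 2 * basisFun A 2 = basisFun A 3 ∧
    basisFun A 2 * basisFun A 5 = 0 ∧ basisFun A 5 * basisFun A 2 = 0 ∧
    basisFun A 5 * basisFun A 5 = basisFun A 4 ∧
    basisFun A 2 * basisFun A 3 = hf A • basisFun A 0 + hf A • basisFun A 1 ∧
    basisFun A 2 * basisFun A 4 = 0 ∧ basisFun A 5 * basisFun A 3 = 0 ∧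
    basisFun A 5 * basisFun A 4 = hf A • basisFun A 0 - hf A • basisFun A 1 := by
  obtain ⟨r1, r2, r3, r4, r5, r6, r7, r8, r9, r10, r11, r12, r13, r14, r15, r16, r17, r18, r19,
    r20, r21, r22, r23, r24, r25⟩ := GRing.mul_table A
  have h : ∀ p : GRing A, hf A • (2 * p) = p := fun p => by
    rw [two_mul, hf_smul_add]
  refine ⟨r1, r2, r5, r10, r13, r22, r25, r11.trans ?_, r12, r23, r24.trans ?_⟩
  · rw [← smul_add, ← h (1 - e A)]
    congr 1
    simp only [basisFun, Matrix.cons_val, s]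
    ring
  · rw [← smul_sub, ← h (e A)]
    congr 1
    simp only [basisFun, Matrix.cons_val, s]
    ring

end GRing

namespace GAlgebra

variable (X : GAlgebra.{u})

/-- The coaction is multiplicative. -/
theorem comp_mul (k : Fin 6) (a b : X.carrier) : X.comp k (X.mul a b) =
    ∑ i, ∑ j, GRing.coeff X.base k (GRing.basisFun X.base i * GRing.basisFun X.base j) •
      X.mul (X.comp i a) (X.comp j b) := by
  conv_lhs => rw [comp, LinearMap.comp_apply, LinearMap.comp_apply, X.coact_mul, X.coact_eq a,
    X.coact_eq b]
  simp only [map_sum, LinearMap.sum_apply, TensorProduct.map₂_apply_tmul, LinearMap.mul_apply',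
    LinearMap.lTensor_tmul, LinearEquiv.coe_coe, TensorProduct.rid_tmul]
  exact Finset.sum_comm

variable {X} in
theorem comp_mul_of {a b : X.carrier} {c d : Fin 6 → X.carrier} (hc : ∀ i, X.comp i a = c i)
    (hd : ∀ i, X.comp i b = d i) (k : Fin 6) : X.comp k (X.mul a b) =
    ∑ i, ∑ j, GRing.coeff X.base k (GRing.basisFun X.base i * GRing.basisFun X.base j) •
      X.mul (c i) (d j) := by
  simp only [comp_mul, hc, hd]

theorem comp_one : X.comp 0 X.one = X.one :=
  X.comp_eq_of_coact_eq (c := ![X.one, 0, 0, 0, 0, 0])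
    (by simp [X.coact_one, Fin.sum_univ_six, GRing.basisFun]) 0

/-- The part where `μ₃` acts trivially and `σ` acts by `-1`. -/
abbrev L : Submodule X.base X.carrier := LinearMap.range (X.comp 1)

/-- The part of weight one for `μ₃`. -/
abbrev F : Submodule X.base X.carrier := LinearMap.range (X.comp 2)

/-- The invariants. -/
abbrev inv : Submodule X.base X.carrier := LinearMap.range (X.comp 0)

variable {X}

theorem comp_inv (a : X.inv) (i : Fin 6) :
    X.comp i (a : X.carrier) = (![(a : X.carrier), 0, 0, 0, 0, 0] i : X.carrier) := by
  obtain ⟨_, a, rfl⟩ := a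
  have h := (X.comp_comp_zero a).1
  fin_cases i
  exacts [(X.comp_comp a).1, h 1 (by decide), h 2 (by decide), h 3 (by decide), h 4 (by decide),
    h 5 (by decide)]

theorem comp_L (a : X.L) (i : Fin 6) :
    X.comp i (a : X.carrier) = (![0, (a : X.carrier), 0, 0, 0, 0] i : X.carrier) := by
  obtain ⟨_, a, rfl⟩ := a
  have h := (X.comp_comp_zero a).2.1
  fin_cases i
  exacts [h 0 (by decide), (X.comp_comp a).2.1, h 2 (by decide), h 3 (by decide), h 4 (by decide),
    h 5 (by decide)]

theorem comp_F (a : X.F) (i : Fin 6) : X.comp i (a : X.carrier) =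
    (![0, 0, (a : X.carrier), 0, 0, X.comp 5 (a : X.carrier)] i : X.carrier) := by
  obtain ⟨_, a, rfl⟩ := a
  have h := (X.comp_comp_zero a).2.2.1
  fin_cases i
  exacts [h 0 (by decide) (by decide), h 1 (by decide) (by decide), (X.comp_comp a).2.2.1,
    h 3 (by decide) (by decide), h 4 (by decide) (by decide), rfl]

theorem comp_comp_five (a : X.F) (i : Fin 6) : X.comp i (X.comp 5 (a : X.carrier)) =
    (![0, 0, 0, X.comp 5 (a : X.carrier), (a : X.carrier), 0] i : X.carrier) := by
  have h3 := (X.comp_comp (a : X.carrier)).2.2.2.2.2.2.2.2.1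
  have h4 := (X.comp_comp (a : X.carrier)).2.2.2.1
  have h := (X.comp_comp_zero (X.comp 5 (a : X.carrier))).2.2.2
  rw [h3] at h
  fin_cases i
  exacts [h 0 (by decide) (by decide), h 1 (by decide) (by decide), h 2 (by decide) (by decide),
    h3, h4.trans (comp_F a 2), h 5 (by decide) (by decide)]

theorem mul_L_L (l l' : X.L) : X.comp 0 (X.mul l l') = X.mul l l' := by
  rw [comp_mul_of (comp_L l) (comp_L l')]
  simp [Fin.sum_univ_six, GRing.basisFun_mul, GRing.coeff_basisFun]

theorem mul_L_F (l : X.L) (u : X.F) : X.comp 2 (X.mul l u) = X.mul l u ∧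
    X.comp 5 (X.mul l u) = -X.mul l (X.comp 5 u) := by
  constructor <;>
  rw [comp_mul_of (comp_L l) (comp_F u)] <;>
  simp [Fin.sum_univ_six, GRing.basisFun_mul, GRing.coeff_basisFun]

theorem mul_F_F (u v : X.F) : X.comp 3 (X.mul u v) = X.mul u v ∧
    X.comp 4 (X.mul u v) = X.mul (X.comp 5 u) (X.comp 5 v) := by
  constructor <;>
  rw [comp_mul_of (comp_F u) (comp_F v)] <;>
  simp [Fin.sum_univ_six, GRing.basisFun_mul, GRing.coeff_basisFun]

theorem mul_F_five (u v : X.F) :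
    X.comp 0 (X.mul u (X.comp 5 v)) =
      hf X.base • (X.mul u (X.comp 5 v) + X.mul (X.comp 5 u) v) ∧
    X.comp 1 (X.mul u (X.comp 5 v)) =
      hf X.base • (X.mul u (X.comp 5 v) - X.mul (X.comp 5 u) v) := by
  constructor <;>
  rw [comp_mul_of (comp_F u) (comp_comp_five v)] <;>
  simp [Fin.sum_univ_six, GRing.basisFun_mul, GRing.coeff_basisFun, smul_sub, sub_eq_add_neg]

end GAlgebra

/-! ### The isotypic parts of a cover are locally free -/

section Range

variable {A B : Alg.{u}} {M : Type u} [AddCommGroup M] [Module A M]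

theorem projective_range_of_idempotent [Module.Projective A M] {p : M →ₗ[A] M}
    (hp : ∀ m, p (p m) = p m) : Module.Projective A (LinearMap.range p) :=
  Module.Projective.of_split (LinearMap.range p).subtype p.rangeRestrict (by
    ext ⟨_, m, rfl⟩
    exact hp m)

/-- The rank of a finite projective module can be computed on a faithfully flat cover. -/
theorem rankAtStalk_eq_of_isPullback [Module.Finite A M] [Module.Projective A M] {n : ℕ}
    {φ : A ⟶ B} (hφ : (rh φ).FaithfullyFlat) {h : M →ₛₗ[rh φ] (Fin n → B)}
    (hh : IsPullback (rh φ) h) (p : PrimeSpectrum A) : Module.rankAtStalk (R := A) M p = n := by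
  algebraize [rh φ]
  obtain ⟨q, rfl⟩ := PrimeSpectrum.comap_surjective_of_faithfullyFlat (A := A) (B := B) p
  have : Nontrivial B := q.nontrivial
  refine (hh.rankAtStalk_eq q).symm.trans ?_
  rw [Module.rankAtStalk_eq_finrank_of_free]
  simp

/-- An idempotent that becomes the projection to `n` coordinates has an image of rank `n`. -/
theorem rankAtStalk_range [Module.Finite A M] [Module.Projective A M] {n : ℕ} {φ : A ⟶ B}
    (hφ : (rh φ).FaithfullyFlat) {f : M →ₛₗ[rh φ] GRing B} (hf : IsPullback (rh φ) f)
    {p : M →ₗ[A] M} (hp : ∀ m, p (p m) = p m) {e : Fin n → Fin 6} (he : Function.Injective e)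
    (hpe : ∀ m, f (p m) = ∑ k, GRing.coeff B (e k) (f m) • GRing.basisFun B (e k))
    (x : PrimeSpectrum A) : Module.rankAtStalk (R := A) (LinearMap.range p) x = n := by
  have := projective_range_of_idempotent hp
  let j : (Fin n → B) →ₗ[B] GRing B :=
    ∑ k, (LinearMap.proj k : (Fin n → B) →ₗ[B] B).smulRight (GRing.basisFun B (e k))
  let s : GRing B →ₗ[B] (Fin n → B) := LinearMap.pi fun k => GRing.coeff B (e k)
  have hj : ∀ v, j v = ∑ k, v k • GRing.basisFun B (e k) := fun v => by simp [j]
  have hs : ∀ t k, s t k = GRing.coeff B (e k) t := fun _ _ => rfl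
  have hsj : ∀ v, s (j v) = v := fun v => by
    ext k
    simp only [hs, hj, map_sum, map_smul, GRing.coeff_basisFun, smul_eq_mul, he.eq_iff]
    simp
  have hjs : ∀ m, f (p m) = j (s (f m)) := fun m => by rw [hpe, hj]; rfl
  refine rankAtStalk_eq_of_isPullback hφ (h := (s.comp f).comp (LinearMap.range p).subtype)
    (hf.retract (LinearMap.range p).subtype p.rangeRestrict j s ?_ hsj ?_ ?_) x
  · rintro ⟨_, m, rfl⟩
    exact Subtype.ext (hp m)
  · rintro ⟨_, m, rfl⟩
    change f (p m) = j (s (f (p m)))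
    rw [hjs, hsj]
  · intro m
    change s (f m) = s (f (p m))
    rw [hjs, hsj]

end Range

namespace GAlgebra

variable {X : GAlgebra.{u}}

instance : Module.Projective X.base X.L :=
  projective_range_of_idempotent fun a => (X.comp_comp a).2.1

instance : Module.Projective X.base X.F :=
  projective_range_of_idempotent fun a => (X.comp_comp a).2.2.1

instance : Module.Projective X.base X.inv :=
  projective_range_of_idempotent fun a => (X.comp_comp a).1

theorem comp_eq_of_regular {B : Alg.{u}} {φ : X.base ⟶ B} {f : X.carrier →ₛₗ[rh φ] GRing B}
    (h : ∀ a, Coalgebra.comul (R := B) (f a) = TensorProduct.map f (GRing.map (rh φ)) (X.coact a))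
    (a : X.carrier) :
    f (X.comp 0 a) = GRing.coeff B 0 (f a) • GRing.basisFun B 0 ∧
    f (X.comp 1 a) = GRing.coeff B 1 (f a) • GRing.basisFun B 1 ∧
    f (X.comp 2 a) = GRing.coeff B 2 (f a) • GRing.basisFun B 2 +
      GRing.coeff B 5 (f a) • GRing.basisFun B 5 := by
  obtain ⟨c0, c1, c2, c3, c4, c5⟩ := GRing.comul_basisFun B
  have key : ∀ i, f (X.comp i a) = TensorProduct.rid B (GRing B) ((GRing.coeff B i).lTensor _
      (Coalgebra.comul (R := B) (f a))) := fun i => by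
    rw [h]
    exact (comp_map_of_coact f i (X.coact a)).symm
  simp only [key]
  have e := GRing.sum_coeff B (f a)
  generalize hc : (fun i => GRing.coeff B i (f a)) = c
  have hc' : ∀ i, GRing.coeff B i (f a) = c i := fun i => congrFun hc i
  simp only [hc'] at e ⊢
  rw [← e]
  refine ⟨?_, ?_, ?_⟩ <;>
  simp [Fin.sum_univ_six, c0, c1, c2, c3, c4, c5, GRing.coeff_basisFun]

theorem rank_of_isGCover (hX : IsGCover X) (p : PrimeSpectrum X.base) :
    Module.rankAtStalk (R := X.base) X.inv p = 1 ∧ Module.rankAtStalk (R := X.base) X.L p = 1 ∧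
      Module.rankAtStalk (R := X.base) X.F p = 2 := by
  obtain ⟨-, -, B, φ, hφ, -, f, hf, h⟩ := hX
  have key := comp_eq_of_regular h
  refine ⟨rankAtStalk_range hφ hf (fun a => (X.comp_comp a).1) (e := ![0]) ?_ (fun m => ?_) p,
    rankAtStalk_range hφ hf (fun a => (X.comp_comp a).2.1) (e := ![1]) ?_ (fun m => ?_) p,
    rankAtStalk_range hφ hf (fun a => (X.comp_comp a).2.2.1) (e := ![2, 5]) ?_ (fun m => ?_) p⟩
  · exact Function.injective_of_subsingleton _
  · rw [Fin.sum_univ_one]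
    exact (key m).1
  · exact Function.injective_of_subsingleton _
  · rw [Fin.sum_univ_one]
    exact (key m).2.1
  · decide
  · rw [Fin.sum_univ_two]
    exact (key m).2.2

end GAlgebra

/-! ### The datum of a cover -/

namespace GAlgebra

variable {X : GAlgebra.{u}}

/-- The action of `L` on `F`. -/
def α : X.L →ₗ[X.base] X.F →ₗ[X.base] X.F :=
  (X.mul.domRestrict₁₂ X.L X.F).compr₂ (X.comp 2).rangeRestrict

/-- The product on the part of weight one, transported to that part by `σ`. -/
def β : X.F →ₗ[X.base] X.F →ₗ[X.base] X.F :=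
  (X.mul.domRestrict₁₂ X.F X.F).compr₂ ((X.comp 2).rangeRestrict ∘ₗ X.comp 4)

/-- The component in `L` of the product `u σ(v)`. -/
def ω : X.F →ₗ[X.base] X.F →ₗ[X.base] X.L :=
  ((X.mul.compl₂ (X.comp 5)).domRestrict₁₂ X.F X.F).compr₂ (X.comp 1).rangeRestrict

theorem coe_α (l : X.L) (u : X.F) : (X.α l u : X.carrier) = X.mul l u := (mul_L_F l u).1

theorem comp_five_α (l : X.L) (u : X.F) :
    X.comp 5 (X.α l u : X.carrier) = -X.mul l (X.comp 5 u) := by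
  rw [coe_α, (mul_L_F l u).2]

theorem coe_β (u v : X.F) : (X.β u v : X.carrier) = X.mul (X.comp 5 u) (X.comp 5 v) := by
  refine Eq.trans ?_ (mul_F_F u v).2
  exact (X.comp_comp _).2.2.2.2.2.2.1

theorem comp_five_β (u v : X.F) : X.comp 5 (X.β u v : X.carrier) = X.mul u v := by
  rw [coe_β, ← (mul_F_F u v).2, (X.comp_comp _).2.2.2.2.2.1, (mul_F_F u v).1]

theorem coe_ω (u v : X.F) : (X.ω u v : X.carrier) =
    hf X.base • (X.mul u (X.comp 5 v) - X.mul (X.comp 5 u) v) := (mul_F_five u v).2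

theorem β_symm (hc : ∀ a b, X.mul a b = X.mul b a) (u v : X.F) : X.β u v = X.β v u :=
  Subtype.ext (by rw [coe_β, coe_β, hc])

theorem ω_alt (hc : ∀ a b, X.mul a b = X.mul b a) (u : X.F) : X.ω u u = 0 :=
  Subtype.ext (by rw [coe_ω, hc, sub_self, smul_zero]; rfl)

/-- The coordinate of an element in the line of invariants: the scalar by which its invariant
component multiplies invariants. -/
def scalar : X.carrier →ₗ[X.base] X.base :=
  trace ∘ₗ ((X.mul.domRestrict₂ X.inv).compr₂ (X.comp 0).rangeRestrict) ∘ₗ X.comp 0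

section Cover

variable (hX : IsGCover X)
include hX

/-- The invariants are generated by the unit. -/
theorem scalar_smul_one (a : X.carrier) : X.scalar a • X.one = X.comp 0 a := by
  have h := apply_eq_trace_smul_of_rank_one (fun p => (rank_of_isGCover hX p).1)
    ((X.mul.domRestrict₂ X.inv).compr₂ (X.comp 0).rangeRestrict (X.comp 0 a))
    ⟨X.one, X.one, X.comp_one⟩
  refine (congrArg Subtype.val h).symm.trans ?_
  change X.comp 0 (X.mul (X.comp 0 a) X.one) = _
  rw [X.mul_one, (X.comp_comp a).1]

theorem eq_of_smul_one_eq {c d : X.base} (h : c • X.one = d • X.one) : c = d := by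
  have h1 := trace_smul_id_of_rank (fun p => (rank_of_isGCover hX p).1) c
    (g := d • (LinearMap.id : X.inv →ₗ[X.base] X.inv)) fun m => by
      refine Subtype.ext ?_
      change d • (m : X.carrier) = c • (m : X.carrier)
      rw [← X.one_mul (m : X.carrier), ← LinearMap.map_smul₂, ← LinearMap.map_smul₂, h]
  have h2 := trace_smul_id_of_rank (fun p => (rank_of_isGCover hX p).1) d
    (g := d • (LinearMap.id : X.inv →ₗ[X.base] X.inv)) fun m => rfl
  have := h1.symm.trans h2
  rwa [Nat.cast_one, _root_.one_mul, _root_.one_mul] at this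

theorem mul_L_L_eq (l l' : X.L) : X.mul l l' = X.scalar (X.mul l l') • X.one := by
  rw [scalar_smul_one hX, mul_L_L]

theorem hf_mul_trace_α (l l' : X.L) :
    hf X.base * trace (X.α l ∘ₗ X.α l') = X.scalar (X.mul l l') := by
  have h := mul_L_L_eq hX l l'
  generalize X.scalar (X.mul l l') = c at h
  rw [trace_smul_id_of_rank (fun p => (rank_of_isGCover hX p).2.2) c]
  · push_cast
    linear_combination c * two_mul_hf X.base
  · intro u
    refine Subtype.ext ?_
    rw [LinearMap.comp_apply, coe_α, coe_α, ← hX.2.1, h, LinearMap.map_smul₂, X.one_mul]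
    rfl

/-- The product of the parts of weights one and two. -/
theorem mul_F_five_eq (u v : X.F) :
    X.mul u (X.comp 5 v) = X.scalar (X.mul u (X.comp 5 v)) • X.one + X.ω u v ∧
    X.mul (X.comp 5 u) v = X.scalar (X.mul u (X.comp 5 v)) • X.one - X.ω u v := by
  rw [scalar_smul_one hX, coe_ω, (mul_F_five u v).1, ← smul_add, ← smul_sub]
  constructor
  · conv_lhs => rw [← hf_smul_add (A := X.base) (X.mul u (X.comp 5 v))]
    congr 1
    abel
  · conv_lhs => rw [← hf_smul_add (A := X.base) (X.mul (X.comp 5 u) v)]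
    congr 1
    abel

theorem scalar_symm (u v : X.F) :
    X.scalar (X.mul u (X.comp 5 v)) = X.scalar (X.mul v (X.comp 5 u)) := by
  refine eq_of_smul_one_eq hX ?_
  rw [scalar_smul_one hX, scalar_smul_one hX, (mul_F_five u v).1, (mul_F_five v u).1,
    hX.1 v, hX.1 _ (u : X.carrier), add_comm]

theorem ω_α_add (l : X.L) (u v : X.F) : X.ω (X.α l u) v + X.ω u (X.α l v) = 0 := by
  refine Subtype.ext ?_
  change (X.ω (X.α l u) v : X.carrier) + (X.ω u (X.α l v) : X.carrier) = 0
  have ha := hX.2.1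
  have hc := hX.1
  have hl : ∀ a b : X.carrier, X.mul a (X.mul l b) = X.mul l (X.mul a b) := fun a b => by
    rw [← ha, hc a, ha]
  simp only [coe_ω, comp_five_α]
  simp only [coe_α, map_neg, LinearMap.neg_apply, ha, hl]
  rw [← smul_add]
  have : ∀ a b : X.carrier, a - -b + (-a - b) = 0 := fun a b => by abel
  rw [this, smul_zero]

/-- The trace of `α` vanishes on the image of `ω`. -/
theorem trace_α_ω (u v : X.F) : trace (X.α (X.ω u v)) = 0 := by
  have hr := fun p => (rank_of_isGCover hX p).2.1
  have h : ∀ l : X.L, trace (X.α (X.ω u v)) • l = 0 := fun l => by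
    have h1 := bilinear_symm_of_rank_one hr (LinearMap.lsmul X.base X.L ∘ₗ (trace ∘ₗ X.α))
      (X.ω u v) l
    refine h1.trans ?_
    change trace (X.α l) • X.ω u v = 0
    rw [← alternating_add_of_rank_two (fun p => (rank_of_isGCover hX p).2.2) (X.α l) X.ω
      (ω_alt hX.1), ω_α_add hX]
  have h1 := trace_smul_id_of_rank hr (trace (X.α (X.ω u v)))
    (g := (0 : X.L →ₗ[X.base] X.L)) fun l => (h l).symm
  rw [map_zero, Nat.cast_one, _root_.one_mul] at h1
  exact h1.symm

/-- The component in the invariants of `u σ(v)` is the bracket. This is the associativity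
`w (σ(u) v) = (w σ(u)) v`, traced over `w`. -/
theorem trace_α_ω_flip (u v : X.F) :
    trace ((X.α.flip v).comp (X.ω.flip u)) = X.scalar (X.mul u (X.comp 5 v)) := by
  have hr := fun p => (rank_of_isGCover hX p).2.2
  let s : X.F →ₗ[X.base] X.base := X.scalar ∘ₗ (X.mul.flip (X.comp 5 u)) ∘ₗ X.F.subtype
  have key : (X.α.flip v).comp (X.ω.flip u) =
      X.scalar (X.mul u (X.comp 5 v)) • LinearMap.id - X.α (X.ω u v) - s.smulRight v := by
    refine LinearMap.ext fun w => Subtype.ext ?_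
    change (X.α (X.ω w u) v : X.carrier) = X.scalar (X.mul u (X.comp 5 v)) • (w : X.carrier) -
      (X.α (X.ω u v) w : X.carrier) - X.scalar (X.mul w (X.comp 5 u)) • (v : X.carrier)
    have h1 := hX.2.1 w (X.comp 5 u) v
    rw [(mul_F_five_eq hX w u).1, (mul_F_five_eq hX u v).2, map_add, LinearMap.add_apply,
      LinearMap.map_smul₂, X.one_mul, map_sub, map_smul, X.mul_one, hX.1 w (X.ω u v)] at h1
    rw [coe_α, coe_α, ← h1]
    abel
  have ht : trace (s.smulRight v) = X.scalar (X.mul u (X.comp 5 v)) := by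
    have : s.smulRight v = dualTensorHom X.base X.F X.F (s ⊗ₜ v) := by
      ext w
      rfl
    rw [this, trace_dualTensorHom, contractLeft_apply]
    exact scalar_symm hX v u
  rw [key, map_sub, map_sub, trace_α_ω hX, ht, map_smul, trace_id_of_rank hr]
  simp only [smul_eq_mul]
  push_cast
  ring

end Cover

end GAlgebra

/-! ### Every cover is of the form `A_χ` -/

namespace GAlgebra

/-- An arrow of algebras over an isomorphism of bases is an isomorphism. -/
theorem Hom.isIso {X Y : GAlgebra.{u}} (f : X ⟶ Y) (hb : IsIso (Hom.base f)) : IsIso f := by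
  have hbij : Function.Bijective (rh (Hom.base f)) := by
    refine Function.bijective_iff_has_inverse.2 ⟨rh (CategoryTheory.inv (Hom.base f)),
      fun a => ?_, fun a => ?_⟩
    · exact congrArg (fun g : X.base ⟶ X.base => rh g a) (IsIso.hom_inv_id (Hom.base f))
    · exact congrArg (fun g : Y.base ⟶ Y.base => rh g a) (IsIso.inv_hom_id (Hom.base f))
  let b := CategoryTheory.inv (Hom.base f)
  have hb' : ∀ a, rh (Hom.base f) (rh b a) = a := fun a =>
    congrArg (fun g : Y.base ⟶ Y.base => rh g a) (IsIso.inv_hom_id (Hom.base f))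
  have hbb : Function.Bijective (rh b) :=
    ⟨fun a a' h => by rw [← hb' a, h, hb'], fun a => ⟨rh (Hom.base f) a, hbij.1 (hb' _)⟩⟩
  let e := Equiv.ofBijective _ ((Hom.pullback f).bijective hbij)
  have he : ∀ y, Hom.map f (e.symm y) = y := e.apply_symm_apply
  have hi : ∀ x x', Hom.map f x = Hom.map f x' → x = x' := fun x x' h => e.injective h
  let g : Y.carrier →ₛₗ[rh b] X.carrier :=
    { toFun := e.symm
      map_add' := fun y y' => hi _ _ (by rw [he, map_add, he, he])
      map_smul' := fun a y => hi _ _ (by rw [he, LinearMap.map_smulₛₗ, he, hb']) }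
  have hg : ∀ y, Hom.map f (g y) = y := he
  have hg' : ∀ x, g (Hom.map f x) = x := e.symm_apply_apply
  let k : Hom Y X :=
    { base := b
      map := g
      pullback := isPullback_of_bijective hbb e.symm.bijective
      map_one := hi _ _ (by rw [hg, Hom.map_one f])
      map_mul := fun y y' => hi _ _ (by rw [hg, Hom.map_mul f, hg, hg])
      map_coact := fun y => by
        obtain ⟨x, rfl⟩ := e.surjective y
        change X.coact (g (Hom.map f x)) = TensorProduct.map g (GRing.map (rh b))
          (Y.coact (Hom.map f x))
        rw [hg', Hom.map_coact f]
        generalize X.coact x = t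
        induction t with
        | zero => simp
        | tmul x p =>
          rw [TensorProduct.map_tmul, TensorProduct.map_tmul, hg', ← GRing.map_comp]
          have : (rh b).comp (rh (Hom.base f)) = RingHom.id _ :=
            RingHom.ext fun a => hbij.1 (hb' _)
          rw [this, GRing.map_id]
        | add s t hs ht => rw [map_add, map_add, ← hs, ← ht] }
  exact ⟨k, hom_ext (IsIso.hom_inv_id (Hom.base f)) hg', hom_ext (IsIso.inv_hom_id (Hom.base f)) hg⟩

variable {X : GAlgebra.{u}} (hX : IsGCover X)

/-- The datum of a cover. -/
abbrev datum : Datum.{u} where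
  base := X.base
  L := X.L
  F := X.F
  rankL p := (rank_of_isGCover hX p).2.1
  rankF p := (rank_of_isGCover hX p).2.2
  α := X.α
  β := X.β
  ω := X.ω
  β_symm := β_symm hX.1
  ω_alt := ω_alt hX.1

/-- The comparison of `A_χ`, for `χ` the datum of `X`, with `X`. -/
def fromDatum : (datum hX).Carrier →ₗ[X.base] X.carrier :=
  (LinearMap.toSpanSingleton X.base X.carrier X.one).coprod
    (X.L.subtype.coprod (X.F.subtype.coprod (X.comp 5 ∘ₗ X.F.subtype)))

theorem fromDatum_in (a : X.base) (l : X.L) (u : X.F) :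
    fromDatum hX ((datum hX).in₀ a) = a • X.one ∧ fromDatum hX ((datum hX).inL l) = l ∧
    fromDatum hX ((datum hX).in₁ u) = u ∧ fromDatum hX ((datum hX).in₂ u) = X.comp 5 u := by
  refine ⟨?_, ?_, ?_, ?_⟩
  · change a • X.one + (((0 : X.L) : X.carrier) + (((0 : X.F) : X.carrier) +
      X.comp 5 ((0 : X.F) : X.carrier))) = _
    simp
  · change (0 : X.base) • X.one + ((l : X.carrier) + (((0 : X.F) : X.carrier) +
      X.comp 5 ((0 : X.F) : X.carrier))) = _
    simp
  · change (0 : X.base) • X.one + (((0 : X.L) : X.carrier) + ((u : X.carrier) +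
      X.comp 5 ((0 : X.F) : X.carrier))) = _
    simp
  · change (0 : X.base) • X.one + (((0 : X.L) : X.carrier) + (((0 : X.F) : X.carrier) +
      X.comp 5 (u : X.carrier))) = _
    simp

theorem fromDatum_bijective : Function.Bijective (fromDatum hX) := by
  have hv : ∀ v : (datum hX).Carrier, fromDatum hX v =
      (v.1 : X.base) • X.one + ((v.2.1 : X.L) : X.carrier) + ((v.2.2.1 : X.F) : X.carrier) +
        X.comp 5 ((v.2.2.2 : X.F) : X.carrier) := fun v => by
    rw [add_assoc, add_assoc]
    rfl
  have hone : ∀ i, X.comp i X.one = (![X.one, 0, 0, 0, 0, 0] i : X.carrier) :=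
    comp_inv ⟨X.one, X.one, X.comp_one⟩
  refine ⟨(injective_iff_map_eq_zero _).2 ?_, fun a => ?_⟩
  · rintro ⟨a, l, u, v⟩ h
    rw [hv] at h
    have key : ∀ i, a • (![X.one, 0, 0, 0, 0, 0] i : X.carrier) +
        (![0, (l : X.carrier), 0, 0, 0, 0] i : X.carrier) +
        (![0, 0, (u : X.carrier), 0, 0, X.comp 5 (u : X.carrier)] i : X.carrier) +
        (![0, 0, 0, X.comp 5 (v : X.carrier), (v : X.carrier), 0] i : X.carrier) = 0 := fun i => by
      rw [← hone, ← comp_L, ← comp_F, ← comp_comp_five, ← map_smul, ← map_add, ← map_add,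
        ← map_add]
      exact (congrArg (X.comp i) h).trans (map_zero _)
    have h0 : a • X.one = 0 := by simpa using key 0
    have h1 : (l : X.carrier) = 0 := by simpa using key 1
    have h2 : (u : X.carrier) = 0 := by simpa using key 2
    have h4 : (v : X.carrier) = 0 := by simpa using key 4
    refine Prod.ext ?_ (Prod.ext (Subtype.ext h1) (Prod.ext (Subtype.ext h2) (Subtype.ext h4)))
    exact eq_of_smul_one_eq hX (h0.trans (zero_smul _ _).symm)
  · refine ⟨(X.scalar a, ⟨X.comp 1 a, a, rfl⟩, ⟨X.comp 2 a, a, rfl⟩,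
      ⟨X.comp 4 a, X.comp 4 a, (X.comp_comp a).2.2.2.2.2.2.1⟩), ?_⟩
    rw [hv]
    change X.scalar a • X.one + X.comp 1 a + X.comp 2 a + X.comp 5 (X.comp 4 a) = a
    rw [scalar_smul_one hX, (X.comp_comp a).2.2.2.2.2.1, X.sum_comp]

theorem datum_m (l l' : X.L) : (datum hX).m l l' = X.scalar (X.mul l l') := hf_mul_trace_α hX l l'

theorem datum_bracket (u v : X.F) :
    (datum hX).bracket u v = X.scalar (X.mul u (X.comp 5 v)) := trace_α_ω_flip hX u v

theorem fromDatum_mul (v w : (datum hX).Carrier) :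
    fromDatum hX ((datum hX).algMul v w) = X.mul (fromDatum hX v) (fromDatum hX w) := by
  have k0 := fun a => (fromDatum_in hX a 0 0).1
  have kL := fun l => (fromDatum_in hX 0 l 0).2.1
  have k1 := fun u => (fromDatum_in hX 0 0 u).2.2.1
  have k2 := fun u => (fromDatum_in hX 0 0 u).2.2.2
  have t := (datum hX).algMul_table
  have h1m : ∀ (a : X.base) (x : X.carrier), X.mul (a • X.one) x = a • x := fun a x => by
    rw [LinearMap.map_smul₂, X.one_mul]
  have hm1 : ∀ (a : X.base) (x : X.carrier), X.mul x (a • X.one) = a • x := fun a x => by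
    rw [map_smul, X.mul_one]
  refine (datum hX).carrier_induction (p := fun v => fromDatum hX ((datum hX).algMul v w) =
    X.mul (fromDatum hX v) (fromDatum hX w)) (fun a => ?_) (fun l => ?_) (fun u => ?_)
    (fun u => ?_) (fun v v' hv hv' => by simp only [map_add, LinearMap.add_apply, hv, hv']) v
  · rw [k0, h1m]
    have h : (datum hX).in₀ a = a • (datum hX).in₀ 1 := by
      rw [← map_smul, smul_eq_mul, _root_.mul_one]
    have h1 : (datum hX).algMul ((datum hX).in₀ 1) w = w := (datum hX).toGAlgebra.one_mul w
    rw [h, LinearMap.map_smul₂, map_smul, h1]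
  all_goals
    refine (datum hX).carrier_induction (p := fun w => fromDatum hX ((datum hX).algMul _ w) =
      X.mul (fromDatum hX _) (fromDatum hX w)) (fun b => ?_) (fun l' => ?_) (fun v => ?_)
      (fun v => ?_) (fun v v' hv hv' => by simp only [map_add, hv, hv']) w
  · rw [(t b 0 l 0 0 0).2.2.2.2.1, kL, kL, k0, hm1]
    rfl
  · rw [(t 0 0 l l' 0 0).2.2.2.2.2.2.2.1, k0, kL, kL, datum_m]
    exact (mul_L_L_eq hX l l').symm
  · rw [(t 0 0 l 0 v 0).2.2.2.2.2.2.2.2.1, k1, kL, k1]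
    exact coe_α l v
  · rw [(t 0 0 l 0 v 0).2.2.2.2.2.2.2.2.2.1, map_neg, k2, kL, k2]
    exact neg_eq_iff_eq_neg.2 (comp_five_α l v)
  · rw [(t b 0 0 0 u 0).2.2.2.2.2.1, k1, k1, k0, hm1]
    rfl
  · rw [(t 0 0 l' 0 u 0).2.2.2.2.2.2.2.2.2.2.1, k1, k1, kL, hX.1]
    exact coe_α l' u
  · rw [(t 0 0 0 0 u v).2.2.2.2.2.2.2.2.2.2.2.2.1, k2, k1, k1]
    exact comp_five_β u v
  · rw [(t 0 0 0 0 u v).2.2.2.2.2.2.2.2.2.2.2.2.2.2.1, map_add, k0, kL, k1, k2, datum_bracket]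
    exact (mul_F_five_eq hX u v).1.symm
  · rw [(t b 0 0 0 u 0).2.2.2.2.2.2.1, k2, k2, k0, hm1]
    exact map_smul _ _ _
  · rw [(t 0 0 l' 0 u 0).2.2.2.2.2.2.2.2.2.2.2.1, map_neg, k2, k2, kL, hX.1]
    exact neg_eq_iff_eq_neg.2 (comp_five_α l' u)
  · rw [(t 0 0 0 0 u v).2.2.2.2.2.2.2.2.2.2.2.2.2.2.2, map_sub, k0, kL, k1, k2, datum_bracket]
    exact (mul_F_five_eq hX u v).2.symm
  · rw [(t 0 0 0 0 u v).2.2.2.2.2.2.2.2.2.2.2.2.2.1, k1, k2, k2]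
    exact coe_β u v

theorem fromDatum_coact (v : (datum hX).Carrier) : X.coact (fromDatum hX v) =
    TensorProduct.map (fromDatum hX) (GRing.map (RingHom.id X.base)) ((datum hX).algCoact v) := by
  have k0 := fun a => (fromDatum_in hX a 0 0).1
  have kL := fun l => (fromDatum_in hX 0 l 0).2.1
  have k1 := fun u => (fromDatum_in hX 0 0 u).2.2.1
  have k2 := fun u => (fromDatum_in hX 0 0 u).2.2.2
  have hid : ∀ p : GRing X.base, GRing.map (RingHom.id X.base) p = p := GRing.map_id
  refine (datum hX).carrier_induction (p := fun v => X.coact (fromDatum hX v) =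
    TensorProduct.map (fromDatum hX) (GRing.map (RingHom.id X.base)) ((datum hX).algCoact v))
    (fun a => ?_) (fun l => ?_) (fun u => ?_) (fun u => ?_)
    (fun v v' hv hv' => by simp only [map_add, hv, hv']) v
  · rw [Datum.algCoact_in₀, TensorProduct.map_tmul, k0, map_smul, X.coact_one, hid]
    rfl
  · rw [Datum.algCoact_inL, TensorProduct.map_tmul, kL, X.coact_eq, Fin.sum_univ_six, hid]
    simp only [comp_L l, GRing.basisFun, Matrix.cons_val, zero_tmul, zero_add, add_zero]
  · rw [Datum.algCoact_in₁, map_add, TensorProduct.map_tmul, TensorProduct.map_tmul, k1, k2,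
      X.coact_eq, Fin.sum_univ_six, hid, hid, comp_F u 0, comp_F u 1, comp_F u 2, comp_F u 3,
      comp_F u 4]
    simp only [GRing.basisFun, Matrix.cons_val, zero_tmul, zero_add, add_zero]
  · rw [Datum.algCoact_in₂, map_add, TensorProduct.map_tmul, TensorProduct.map_tmul, k1, k2,
      X.coact_eq, Fin.sum_univ_six, hid, hid]
    simp only [comp_comp_five u, GRing.basisFun, Matrix.cons_val, zero_tmul, zero_add, add_zero]

/-- The comparison as an arrow over the identity. -/
def ofDatum : (datum hX).toGAlgebra ⟶ X :=
  { base := 𝟙 X.base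
    map := (fromDatum hX : (datum hX).Carrier →ₗ[X.base] X.carrier)
    pullback := isPullback_of_bijective Function.bijective_id (fromDatum_bijective hX)
    map_one := (fromDatum_in hX 1 0 0).1.trans (one_smul _ _)
    map_mul := fromDatum_mul hX
    map_coact := fromDatum_coact hX : Hom (datum hX).toGAlgebra X }

end GAlgebra

/-- Every cover is isomorphic to the algebra `A_χ` of a datum. -/
theorem GCov.exists_isOfDatum (X : GCov.{u}) : ∃ χ : Datum.{u}, GCov.IsOfDatum X χ := by
  let f := GAlgebra.ofDatum X.property
  have : IsIso f := GAlgebra.Hom.isIso f (IsIso.id X.obj.base)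
  have h : GAlgebra.proj.IsHomLift (𝟙 X.obj.base) f := IsHomLift.map (p := GAlgebra.proj) f
  exact ⟨GAlgebra.datum X.property, asIso f, h⟩

/-! ### The open substack `Z₂ - {0}` -/

namespace Datum

variable {χ χ' : Datum.{u}}

theorem Hom.trace_α (f : χ ⟶ χ') (l : χ.L) :
    trace (χ'.α (Hom.mapL f l)) = rh (Hom.base f) (trace (χ.α l)) :=
  trace_pullback (Hom.pullbackF f) _ _ fun u => (Hom.map_α f l u).symm

/-- If `A_χ` is associative and `tr α` takes the value `1`, then `χ` is in `Z₂`. -/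
theorem eq_of_trace_eq_one
    (ha : ∀ v w t, χ.algMul (χ.algMul v w) t = χ.algMul v (χ.algMul w t)) {l₀ : χ.L}
    (h₀ : trace (χ.α l₀) = 1) :
    χ.β = 0 ∧ χ.ω = 0 ∧ ∀ l u, χ.α l u = (hf χ.base * trace (χ.α l)) • u := by
  have t := χ.algMul_table
  have tm := fun l k => (t 0 0 l k 0 0).2.2.2.2.2.2.2.1
  have t1 := fun l u => (t 0 0 l 0 u 0).2.2.2.2.2.2.2.2.1
  have t2 := fun a u => (t a 0 0 0 u 0).2.2.1
  have t3 := fun l u => (t 0 0 l 0 u 0).2.2.2.2.2.2.2.2.2.2.1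
  have t4 := fun l u => (t 0 0 l 0 u 0).2.2.2.2.2.2.2.2.2.1
  have t5 := fun l u => (t 0 0 l 0 u 0).2.2.2.2.2.2.2.2.2.2.2.1
  have t6 := fun u v => (t 0 0 0 0 u v).2.2.2.2.2.2.2.2.2.2.2.2.1
  have t7 := fun u v => (t 0 0 0 0 u v).2.2.2.2.2.2.2.2.2.2.2.2.2.2.1
  -- `α(l₀)` is a root of `X ^ 2 - c` and of `X ^ 2 - X + (1 - 2 c) / 2`
  have hα₀ : ∀ u, χ.α l₀ u = hf χ.base • u := fun u => by
    have h1 := ha (χ.inL l₀) (χ.inL l₀) (χ.in₁ u)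
    rw [tm, t1, t1, t2] at h1
    have h2 : χ.m l₀ l₀ • u = χ.α l₀ (χ.α l₀ u) := congr($h1.2.2.1)
    have h3 := cayley_hamilton_of_rank_two χ.rankF (χ.α l₀) u
    rw [h₀, one_smul, ← h2, m_apply, ← add_smul, mul_sub, mul_one, mul_one,
      add_sub_cancel] at h3
    exact h3.symm
  have hα : ∀ l u, χ.α l u = (hf χ.base * trace (χ.α l)) • u := fun l u => by
    have h1 := bilinear_symm_of_rank_one χ.rankL
      (((LinearMap.lsmul χ.base (χ.F →ₗ[χ.base] χ.F)).compl₂ χ.α) ∘ₗ (trace ∘ₗ χ.α)) l₀ l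
    have h2 : trace (χ.α l₀) • χ.α l u = trace (χ.α l) • χ.α l₀ u := congr($h1 u)
    rwa [h₀, one_smul, hα₀, smul_smul, mul_comm] at h2
  refine ⟨?_, ?_, hα⟩
  · refine LinearMap.ext fun u => LinearMap.ext fun v => ?_
    have h1 := ha (χ.in₁ u) (χ.in₁ v) (χ.inL l₀)
    rw [t6, t3, t5, t6] at h1
    have h2 : -χ.α l₀ (χ.β u v) = χ.β u (χ.α l₀ v) := congr($h1.2.2.2)
    rw [hα₀, hα₀, map_smul, neg_eq_iff_add_eq_zero, ← smul_add, hf_smul_add] at h2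
    exact h2
  · refine LinearMap.ext fun u => LinearMap.ext fun v => ?_
    have h1 := ha (χ.in₁ u) (χ.inL l₀) (χ.in₂ v)
    rw [t3, t4, map_neg, t7, t7] at h1
    have h2 : 0 + χ.ω (χ.α l₀ u) v = -(0 + χ.ω u (χ.α l₀ v)) := congr($h1.2.1)
    rw [zero_add, zero_add, hα₀, hα₀, map_smul, map_smul, LinearMap.smul_apply,
      eq_neg_iff_add_eq_zero, ← smul_add, hf_smul_add] at h2
    exact h2

end Datum

namespace Triple

/-- If `μ` vanishes after base change along `φ`, the pullback of the triple along `φ` has zero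
linear form. -/
theorem exists_zero_pullback (z : Triple.{u}) {B : Alg.{u}} (φ : z.base ⟶ B)
    (h : ∀ l, rh φ (z.μ l) = 0) : ∃ (z' : Triple.{u}) (_ : z ⟶ z'), z'.base = B ∧ z'.μ = 0 := by
  let _ : Algebra z.base B := (rh φ).toAlgebra
  have hL := isPullback_baseChangeMap (M := z.L) (rh φ)
  have hF := isPullback_baseChangeMap (M := z.F) (rh φ)
  let z' : Triple.{u} :=
    { base := B
      L := B ⊗[z.base] z.L
      F := B ⊗[z.base] z.F
      rankL := fun q => (hL.rankAtStalk_eq q).trans (z.rankL _)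
      rankF := fun q => (hF.rankAtStalk_eq q).trans (z.rankF _)
      μ := 0 }
  let f : Hom z z' :=
    { base := φ
      mapL := baseChangeMap (rh φ) z.L
      mapF := baseChangeMap (rh φ) z.F
      pullbackL := hL
      pullbackF := hF
      map_μ := h }
  exact ⟨z', f, rfl, rfl⟩

theorem zero_toGCov {z : Triple.{u}} (h : z.μ = 0) : GCov.zero (toGCov.obj z) := by
  refine ⟨toDatum.obj z, z.isOfDatum_toGCov, ?_, rfl, rfl⟩
  change LinearMap.lsmul z.base z.F ∘ₗ z.μ = 0
  rw [h, LinearMap.comp_zero]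

end Triple

namespace GCov

theorem IsOfDatum.assoc {X : GCov.{u}} {χ : Datum.{u}} (h : IsOfDatum X χ) (v w t : χ.Carrier) :
    χ.algMul (χ.algMul v w) t = χ.algMul v (χ.algMul w t) := by
  obtain ⟨i, -⟩ := h
  have hi : ∀ v w : χ.Carrier, GAlgebra.Hom.map i.hom v = GAlgebra.Hom.map i.hom w → v = w :=
    fun v w h => by
      have e : ∀ v : χ.Carrier, GAlgebra.Hom.map i.inv (GAlgebra.Hom.map i.hom v) = v := fun v =>
        congrArg (fun k : χ.toGAlgebra ⟶ χ.toGAlgebra => GAlgebra.Hom.map k v) i.hom_inv_id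
      rw [← e v, h, e w]
  have hm : ∀ v w : χ.Carrier, GAlgebra.Hom.map i.hom (χ.algMul v w) =
      X.obj.mul (GAlgebra.Hom.map i.hom v) (GAlgebra.Hom.map i.hom w) := GAlgebra.Hom.map_mul i.hom
  refine hi _ _ ?_
  rw [hm, hm, hm, hm, X.property.2.1]

/-- The arrow of data underlying an arrow of covers. -/
theorem exists_hom_of_isOfDatum {X Y : GCov.{u}} {χ χ' : Datum.{u}} (i : χ.toGAlgebra ≅ X.obj)
    (j : χ'.toGAlgebra ≅ Y.obj) (f : X ⟶ Y) : ∃ g : χ ⟶ χ', Datum.Hom.base g =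
      GAlgebra.Hom.base i.hom ≫ proj.map f ≫ GAlgebra.Hom.base j.inv :=
  ⟨Datum.toGAlgebraFunctor.preimage (i.hom ≫ f.hom ≫ j.inv),
    congrArg GAlgebra.Hom.base (Datum.toGAlgebraFunctor.map_preimage (i.hom ≫ f.hom ≫ j.inv))⟩

/-- On `Z₂ - {0}` the form `μ` of a triple takes the value `1`: otherwise the image of `μ` is
a proper ideal `I`, and the pullback to the closed subscheme of `I` is nonempty and lies in
`{0}`. -/
theorem exists_μ_eq_one {X : GCov.{u}} (hX : diff Z₂ zero X) {z : Triple.{u}}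
    (hz : IsOfDatum X (Triple.toDatum.obj z)) : ∃ l, z.μ l = 1 := by
  obtain ⟨i, -⟩ := hz
  let I : Ideal z.base := LinearMap.range z.μ
  let B : Alg.{u} := CommAlgCat.of BaseRing (z.base ⧸ I)
  let φ : z.base ⟶ B := ofRingHom (B := B) (Ideal.Quotient.mk I)
  obtain ⟨z', f, hB, hf⟩ := z.exists_zero_pullback φ fun l =>
    Ideal.Quotient.eq_zero_iff_mem.2 ⟨l, rfl⟩
  let j : X ≅ Triple.toGCov.obj z := IsGCover.isoMk i.symm
  have h : Subsingleton z'.base := hX.2 _ (j.hom ≫ Triple.toGCov.map f) (Triple.zero_toGCov hf)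
  rw [hB] at h
  have h1 : (1 : z.base) ∈ I := Ideal.Quotient.eq_zero_iff_mem.1 (Subsingleton.elim (α := B) _ _)
  exact h1

/-- The substack `Z₂ - {0}` is the locus where `tr α` generates the unit ideal. -/
theorem diff_iff_exists_trace_eq_one {X : GCov.{u}} {χ : Datum.{u}} (h : IsOfDatum X χ) :
    diff Z₂ zero X ↔ ∃ l, trace (χ.α l) = 1 := by
  constructor
  · intro hX
    obtain ⟨z, hz⟩ := Triple.exists_isOfDatum_of_mem_Z₂ hX.1
    obtain ⟨l, hl⟩ := exists_μ_eq_one hX hz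
    obtain ⟨i, -⟩ := hz
    obtain ⟨j, -⟩ := h
    obtain ⟨g, -⟩ := exists_hom_of_isOfDatum i j (𝟙 X)
    refine ⟨hf χ.base • Datum.Hom.mapL g l, ?_⟩
    let μ : (Triple.toDatum.obj z).L →ₗ[(Triple.toDatum.obj z).base] (Triple.toDatum.obj z).base :=
      z.μ
    have hμ : μ l = 1 := hl
    have h1 : trace ((Triple.toDatum.obj z).α l) = 2 := by
      rw [Datum.trace_α_of_smul (μ := μ) (fun _ _ => rfl) l, hμ, mul_one]
    have h2 : rh (Datum.Hom.base g) (trace ((Triple.toDatum.obj z).α l)) = 2 := by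
      rw [h1, map_ofNat]
    rw [map_smul, map_smul, Datum.Hom.trace_α g l, h2, smul_eq_mul, mul_comm, two_mul_hf]
  · rintro ⟨l, hl⟩
    obtain ⟨hβ, hω, hα⟩ := Datum.eq_of_trace_eq_one h.assoc hl
    refine ⟨⟨χ, h, hβ, hω, hα⟩, ?_⟩
    rintro Y f ⟨χ', ⟨j, -⟩, hα', -, -⟩
    obtain ⟨i, -⟩ := h
    obtain ⟨g, -⟩ := exists_hom_of_isOfDatum i j f
    have h1 := Datum.Hom.trace_α g l
    rw [hα', LinearMap.zero_apply, map_zero, hl, map_one] at h1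
    refine subsingleton_of_zero_eq_one ?_
    have h2 := congrArg (rh (GAlgebra.Hom.base j.hom)) h1
    exact (map_zero (rh (GAlgebra.Hom.base j.hom))).symm.trans
      (h2.trans (map_one (rh (GAlgebra.Hom.base j.hom))))

/-- The open subset is the union of the loci where `tr α(l)` is invertible. -/
theorem isOpenSubstack_diff : IsOpenSubstack (diff Z₂ zero.{u}) := by
  intro X
  obtain ⟨χ, i, -⟩ := X.exists_isOfDatum
  let b : χ.base ⟶ X.obj.base := GAlgebra.Hom.base i.hom
  refine ⟨⋃ l : χ.L, PrimeSpectrum.basicOpen (rh b (trace (χ.α l))),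
    isOpen_iUnion fun l => (PrimeSpectrum.basicOpen _).isOpen, fun Y f => ?_⟩
  obtain ⟨χ', hχ'⟩ := Y.exists_isOfDatum
  rw [diff_iff_exists_trace_eq_one hχ']
  obtain ⟨j, -⟩ := hχ'
  let d : X.obj.base ⟶ Y.obj.base := proj.map f
  obtain ⟨g, hg⟩ := exists_hom_of_isOfDatum i j f
  let c : χ'.base ⟶ Y.obj.base := GAlgebra.Hom.base j.hom
  let c' : Y.obj.base ⟶ χ'.base := GAlgebra.Hom.base j.inv
  have hj : ∀ a, rh c (rh c' a) = a := fun a =>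
    congrArg (fun k : Y.obj ⟶ Y.obj => rh (GAlgebra.Hom.base k) a) j.inv_hom_id
  have hgl : ∀ l, trace (χ'.α (Datum.Hom.mapL g l)) = rh c'
      (rh d (rh b (trace (χ.α l)))) := fun l => by
    rw [Datum.Hom.trace_α g l, hg]
    rfl
  have hU : ∀ q : PrimeSpectrum Y.obj.base, PrimeSpectrum.comap (rh d) q ∈
      (⋃ l : χ.L, PrimeSpectrum.basicOpen (rh b (trace (χ.α l))) :
        Set (PrimeSpectrum X.obj.base)) ↔
      ∃ l, rh d (rh b (trace (χ.α l))) ∉ q.asIdeal := fun q => by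
    exact Set.mem_iUnion
  refine Iff.trans ?_ (forall_congr' hU).symm
  constructor
  · rintro ⟨l', hl'⟩ q
    by_contra! hq
    have key : ∀ l', rh c (trace (χ'.α l')) ∈ q.asIdeal := fun l' => by
      refine (Datum.Hom.pullbackL g).induction
        (p := fun l' => rh c (trace (χ'.α l')) ∈ q.asIdeal) ?_ ?_ ?_ ?_ l'
      · rw [map_zero, map_zero, map_zero]
        exact q.asIdeal.zero_mem
      · intro l
        rw [hgl, hj]
        exact hq l
      · intro a l' h
        rw [map_smul, map_smul, smul_eq_mul, map_mul]
        exact q.asIdeal.mul_mem_left _ h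
      · intro l₁ l₂ h₁ h₂
        rw [map_add, map_add, map_add]
        exact q.asIdeal.add_mem h₁ h₂
    refine q.2.ne_top ((Ideal.eq_top_iff_one _).2 ?_)
    have h1 := key l'
    rwa [hl', map_one] at h1
  · intro H
    let I : Ideal χ'.base := LinearMap.range (trace ∘ₗ χ'.α)
    by_contra hI
    have hI' : I ≠ ⊤ := fun h => hI ((Ideal.eq_top_iff_one I).1 h)
    obtain ⟨p, hp, hIp⟩ := Ideal.exists_le_maximal I hI'
    obtain ⟨l, hl⟩ := H (PrimeSpectrum.comap (rh c') ⟨p, hp.isPrime⟩)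
    refine hl (hIp ⟨Datum.Hom.mapL g l, ?_⟩)
    exact hgl l

end GCov

/-! ### `Z₂ - {0}` is the classifying stack of `GL₂` -/

namespace Bundle

theorem rankAtStalk_self (A : Alg.{u}) (p : PrimeSpectrum A) :
    Module.rankAtStalk (R := A) A p = 1 := by
  have : Nontrivial A := p.nontrivial
  rw [Module.rankAtStalk_eq_finrank_of_free]
  simp

/-- The functor `F ↦ (O, F, id)`. -/
def toTriple : Bundle.{u} 2 ⥤ Triple.{u} where
  obj E :=
    { base := E.base
      L := E.base
      F := E.F
      rankL := rankAtStalk_self E.base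
      rankF := E.rankF
      μ := LinearMap.id }
  map {E E'} f :=
    { base := Hom.base f
      mapL :=
        { toFun := rh (Hom.base f)
          map_add' := map_add _
          map_smul' := map_mul _ }
      mapF := Hom.mapF f
      pullbackL := isPullback_ringHom _ _ fun _ => rfl
      pullbackF := Hom.pullbackF f
      map_μ := fun _ => rfl }
  map_id _ := rfl
  map_comp _ _ := rfl

instance : toTriple.{u}.Faithful where
  map_injective h := hom_ext (congrArg Triple.Hom.base h) fun v =>
    congrArg (fun k => Triple.Hom.mapF k v) h

instance : toTriple.{u}.Full where
  map_surjective {E E'} f := by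
    let g : Hom E E' := ⟨Triple.Hom.base f, Triple.Hom.mapF f, Triple.Hom.pullbackF f⟩
    exact ⟨g, Triple.hom_ext (hom_ext rfl fun a => Triple.Hom.map_μ f a) (hom_ext rfl fun v => rfl)⟩

theorem diff_toTriple (E : Bundle.{u} 2) :
    GCov.diff GCov.Z₂ GCov.zero ((toTriple ⋙ Triple.toGCov).obj E) := by
  refine (GCov.diff_iff_exists_trace_eq_one (Triple.isOfDatum_toGCov (toTriple.obj E))).2
    ⟨hf E.base, ?_⟩
  refine (trace_smul_id_of_rank E.rankF (hf E.base) fun _ => rfl).trans ?_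
  exact two_mul_hf E.base

/-- The functor from locally free sheaves of rank two to `Z₂ - {0}`. -/
def toDiff : Bundle.{u} 2 ⥤ (GCov.diff GCov.Z₂ GCov.zero.{u}).FullSubcategory :=
  (GCov.diff GCov.Z₂ GCov.zero).lift (toTriple ⋙ Triple.toGCov) diff_toTriple

instance : toDiff.{u}.Full :=
  haveI : (toDiff.{u} ⋙ (GCov.diff GCov.Z₂ GCov.zero).ι).Full :=
    inferInstanceAs (toTriple ⋙ Triple.toGCov).Full
  Functor.Full.of_comp_faithful toDiff (GCov.diff GCov.Z₂ GCov.zero).ι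

instance : toDiff.{u}.Faithful :=
  haveI : (toDiff.{u} ⋙ (GCov.diff GCov.Z₂ GCov.zero).ι).Faithful :=
    inferInstanceAs (toTriple ⋙ Triple.toGCov).Faithful
  Functor.Faithful.of_comp toDiff (GCov.diff GCov.Z₂ GCov.zero).ι

/-- If `μ(l₁) = 1`, then `a ↦ a l₁` identifies `(O, F, id)` with `(L, F, μ)`. -/
theorem exists_hom_of_μ_eq_one (z : Triple.{u}) {l₁ : z.L} (h : z.μ l₁ = 1) :
    ∃ f : toTriple.obj z.plane ⟶ z, Triple.Hom.base f = 𝟙 z.base := by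
  have hb : Function.Bijective (LinearMap.toSpanSingleton z.base z.L l₁) := by
    refine ⟨fun a b hab => ?_, fun l => ⟨z.μ l, ?_⟩⟩
    · have := congrArg z.μ hab
      simpa [h] using this
    · have := bilinear_symm_of_rank_one z.rankL (LinearMap.lsmul z.base z.L ∘ₗ z.μ) l l₁
      refine Eq.trans this ?_
      change z.μ l₁ • l = l
      rw [h, one_smul]
  let f : Triple.Hom (toTriple.obj z.plane) z :=
    { base := 𝟙 z.base
      mapL := LinearMap.toSpanSingleton z.base z.L l₁
      mapF := idS z.base z.F
      pullbackL := isPullback_of_bijective Function.bijective_id hb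
      pullbackF := isPullback_idS z.base z.F
      map_μ := fun a => by
        change a = z.μ ((show z.base from a) • l₁)
        rw [map_smul, h]
        exact (mul_one (M := z.base) a).symm }
  exact ⟨f, rfl⟩

end Bundle

/-- Locally free sheaves of rank two are equivalent to `Z₂ - {0}`. -/
theorem isStackEquiv_toDiff : IsStackEquiv (X := bundleStack.{u} 2)
    (Y := GCov.substack (GCov.diff GCov.Z₂ GCov.zero.{u})) ⟨Bundle.toDiff, rfl⟩ := by
  refine ⟨inferInstanceAs Bundle.toDiff.Full, inferInstanceAs Bundle.toDiff.Faithful, fun X => ?_⟩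
  obtain ⟨z, hz⟩ := Triple.exists_isOfDatum_of_mem_Z₂ X.property.1
  obtain ⟨l₁, hl₁⟩ := GCov.exists_μ_eq_one X.property hz
  obtain ⟨i, hi⟩ := hz
  obtain ⟨f, hf⟩ := Bundle.exists_hom_of_μ_eq_one z hl₁
  let F := Triple.toDatum ⋙ Datum.toGAlgebraFunctor
  let g : F.obj (Bundle.toTriple.obj z.plane) ⟶ F.obj z := F.map f
  let i' : F.obj z ≅ X.obj.obj := i
  have hi' : GAlgebra.proj.IsHomLift (𝟙 X.obj.obj.base) i'.hom := hi
  have hg : IsIso g := GAlgebra.Hom.isIso _ (by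
    change IsIso (Triple.Hom.base f)
    rw [hf]
    exact IsIso.id z.base)
  have e : z.base = X.obj.obj.base := IsHomLift.domain_eq GAlgebra.proj (𝟙 X.obj.obj.base) i'.hom
  have h1 : GAlgebra.proj.IsHomLift (Triple.Hom.base f) g := IsHomLift.map (p := GAlgebra.proj) g
  rw [hf] at h1
  have h2 : GAlgebra.proj.IsHomLift (𝟙 X.obj.obj.base) g := e ▸ h1
  let r := asIso g ≪≫ i'
  have h3 : GAlgebra.proj.IsHomLift (𝟙 X.obj.obj.base) r.hom :=
    IsHomLift.comp_of_lift_id GAlgebra.proj _ g i'.hom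
  let j : (Bundle.toDiff.obj z.plane).obj ≅ X.obj := IsGCover.isoMk r
  let k : Bundle.toDiff.obj z.plane ≅ X := (GCov.diff GCov.Z₂ GCov.zero).isoMk j
  exact ⟨z.plane, k, Triple.isHomLift_of_isHomLift k.hom h3⟩

end GCovers

end

theorem mainTheorem8 :
    (∃ Ψ : BasedFunctor GCovers.tripleStack.{u} (GCovers.GCov.substack GCovers.GCov.Z₂.{u}),
      Ψ.toFunctor ⋙ GCovers.GCov.Z₂.ι ⋙ GCovers.IsGCover.ι =
          GCovers.Triple.toDatum ⋙ GCovers.Datum.toGAlgebraFunctor ∧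
        GCovers.IsStackEquiv Ψ) ∧
    GCovers.StackEquiv GCovers.tripleStack.{u}
      (GCovers.stackProd (GCovers.quotientStack GCovers.scaling)
        (GCovers.classifyingStack GCovers.GL₂)) ∧
    GCovers.StackEquiv (GCovers.GCov.substack GCovers.GCov.Z₂.{u})
      (GCovers.stackProd (GCovers.quotientStack GCovers.scaling)
        (GCovers.classifyingStack GCovers.GL₂)) ∧
    GCovers.GCov.IsOpenSubstack
      (GCovers.GCov.diff GCovers.GCov.Z₂ GCovers.GCov.zero.{u}) ∧
    GCovers.StackEquiv
      (GCovers.GCov.substack (GCovers.GCov.diff GCovers.GCov.Z₂ GCovers.GCov.zero.{u}))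
      (GCovers.classifyingStack GCovers.GL₂) := by
  exact ⟨⟨⟨GCovers.Triple.toZ₂, rfl⟩, rfl, GCovers.Triple.isStackEquiv_toZ₂⟩,
    GCovers.stackEquiv_tripleStack,
    (GCovers.StackEquiv.symm ⟨_, GCovers.Triple.isStackEquiv_toZ₂⟩).trans
      GCovers.stackEquiv_tripleStack,
    GCovers.GCov.isOpenSubstack_diff,
    (GCovers.StackEquiv.symm ⟨_, GCovers.isStackEquiv_toDiff⟩).trans
      (GCovers.stackEquiv_bundleStack GCovers.linearGL₂)⟩
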